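/- Fix SINR parameters: path loss $\alpha>2$, threshold $\beta\ge 1$, sensitivity $\varepsilon>0$, ambient noise $\mathcal N>0$ and a uniform transmission power $P>0$. A network consists of $n$ stations at distinct points of the Euclidean plane, with unique labels in $\{1,\dots,N\}$. When exactly the stations of a set $\mathcal T$ transmit in a round, station $u$ receives the message of $v$ iff $v\in\mathcal T$, $u\notin\mathcal T$, $P\,\mathrm{dist}(v,u)^{-\alpha}\ge(1+\varepsilon)\beta\mathcal N$ and $$\frac{P\,\mathrm{dist}(v,u)^{-\alpha}}{\mathcal N+\sum_{w\in\mathcal T\setminus\{v\}}P\,\mathrm{dist}(w,u)^{-\alpha}}\ge\beta .$$ Let $r=(P/((1+\varepsilon)\beta\mathcal N))^{1/\alpha}$ be the communication range. The communication graph joins two different stations at distance at most $r$; $D$ is its diameter and $\Delta$ its maximum degree, and it is assumed to be connected. The pivotal grid divides the plane into half-open square boxes of side $r/\sqrt2$. A set $K\neq\emptyset$ of source stations initially holds $k\ge1$ distinct rumors in total (each source at least one). In a synchronous round every station either transmits a message, consisting of at most one rumor that it possesses and $O(\log n)$ control bits, or listens. There is no carrier sensing and no global clock, and the wake-up is non-spontaneous: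 a station outside $K$ is asleep, and does not transmit, until it has received a message. In the centralized setting every station knows the whole network (all positions and labels) and $k$, but not which stations are the other sources. A set $H$ of stations is a backbone structure with constant $c$ if it is a connected dominating set of the communication graph, its induced subgraph has diameter at most $cD$, it contains a station of every nonempty box of the pivotal grid and at most $c$ stations of each box, and its stations can be divided into $c$ classes such that, whenever any subset of one class transmits and no other station does, each message is received by all neighbors of its sender. Then there are a constant $c$, depending only on the SINR parameters, and a deterministic protocol for the centralized setting, with at most $c\log_2 n$ control bits per message, such that in every network with connected communication graph, for a backbone structure $H$ with constant $c$ that depends only on the network, for every $k\ge 1$ and every initial placement of $k$ distinct rumors, the following holds after at most $$c\,\bigl(D+k\log(\Delta+1)\bigr)$$ rounds: every station is awake, knows whether it belongs to $H$, and possesses all $k$ rumors, and no station transmits any more. (For $\Delta\ge2$ this is $O(D+k\log\Delta)$ rounds.) -/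

import Mathlib

/-! Multi-broadcast in the SINR model: wireless networks in the plane, deterministic
protocols with unit-size messages and non-spontaneous wake-up, backbone structures. -/

namespace SINR

/-- Parameters of the SINR model: path loss `α`, threshold `β`, signal sensitivity `ε`,
ambient noise, and the common transmission power of all stations. -/
structure Params where
  α : ℝ
  β : ℝ
  ε : ℝ
  noise : ℝ
  power : ℝ
  two_lt_α : 2 < α
  one_le_β : 1 ≤ β
  ε_pos : 0 < ε
  noise_pos : 0 < noise
  power_pos : 0 < power

/-- A network of `n` stations at distinct points of the Euclidean plane, with unique labels
in `{1, …, N}`. -/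
structure Network (n : ℕ) where
  pos : Fin n → EuclideanSpace ℝ (Fin 2)
  pos_injective : Function.Injective pos
  N : ℕ
  label : Fin n → ℕ
  label_injective : Function.Injective label
  label_mem : ∀ v, label v ∈ Set.Icc 1 N

section Physical

variable {n : ℕ} (S : Params) (G : Network n)

/-- The strength at `u` of the signal of `v`. -/
noncomputable def signal (v u : Fin n) : ℝ :=
  S.power * dist (G.pos v) (G.pos u) ^ (-S.α)

/-- The signal-to-interference-and-noise ratio of `v` at `u` when exactly the stations of `T`
transmit. -/
noncomputable def sinr (v u : Fin n) (T : Finset (Fin n)) : ℝ :=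
  signal S G v u / (S.noise + ∑ w ∈ T.erase v, signal S G w u)

/-- When exactly the stations of `T` transmit, `u` successfully receives the message of `v`. -/
def Receives (T : Finset (Fin n)) (v u : Fin n) : Prop :=
  v ∈ T ∧ u ∉ T ∧ (1 + S.ε) * S.β * S.noise ≤ signal S G v u ∧ S.β ≤ sinr S G v u T

/-- The communication range: the largest distance at which the signal is at least
`(1 + ε) β noise`. -/
noncomputable def range : ℝ :=
  (S.power / ((1 + S.ε) * S.β * S.noise)) ^ (1 / S.α)

/-- The communication graph: two different stations are adjacent iff they are in the range of
each other. -/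
def commGraph : SimpleGraph (Fin n) where
  Adj v u := v ≠ u ∧ dist (G.pos v) (G.pos u) ≤ range S
  symm := ⟨fun v u h => ⟨h.1.symm, by rw [dist_comm]; exact h.2⟩⟩
  loopless := ⟨fun _ h => h.1 rfl⟩

open Classical in
/-- The maximum degree `Δ` of the communication graph. -/
noncomputable def maxDeg : ℕ := (commGraph S G).maxDegree

/-- The coordinates of the box of the pivotal grid, of side `range / √2`, that contains `v`.
Boxes contain their left and bottom sides and not their right and top sides. -/
noncomputable def box (v : Fin n) : ℤ × ℤ :=
  (⌊G.pos v 0 / (range S / √2)⌋, ⌊G.pos v 1 / (range S / √2)⌋)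

theorem signal_nonneg (v u : Fin n) : 0 ≤ signal S G v u :=
  mul_nonneg S.power_pos.le (Real.rpow_nonneg dist_nonneg _)

/-- At most one station is heard by `u` in a round. -/
theorem Receives.unique {T : Finset (Fin n)} {v w u : Fin n}
    (hv : Receives S G T v u) (hw : Receives S G T w u) : v = w := by
  by_contra hne
  have key : ∀ a b : Fin n, a ≠ b → b ∈ T → S.β ≤ sinr S G a u T →
      signal S G b u < signal S G a u := by
    intro a b hab hb h
    have hle : signal S G b u ≤ ∑ z ∈ T.erase a, signal S G z u :=
      Finset.single_le_sum (f := fun z => signal S G z u)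
        (fun z _ => signal_nonneg S G z u) (Finset.mem_erase.2 ⟨hab.symm, hb⟩)
    have hb0 := signal_nonneg S G b u
    have hN := S.noise_pos
    have hpos : 0 < S.noise + ∑ z ∈ T.erase a, signal S G z u := by linarith
    have h1 : 1 ≤ sinr S G a u T := S.one_le_β.trans h
    rw [sinr, le_div_iff₀ hpos] at h1
    linarith
  exact lt_asymm (key v w hne hw.1 hv.2.2.2) (key w v (Ne.symm hne) hv.1 hw.2.2.2)

/-- Two different stations are adjacent iff the second one receives the message of the first
one when the first one transmits alone. -/
theorem commGraph_adj_iff (v u : Fin n) :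
    (commGraph S G).Adj v u ↔ Receives S G {v} v u := by
  have hA : 0 < (1 + S.ε) * S.β * S.noise := by
    have := S.ε_pos; have := S.one_le_β; have := S.noise_pos; positivity
  have hα : 0 < S.α := by linarith [S.two_lt_α]
  have hP := S.power_pos
  by_cases hvu : v = u
  · subst hvu; simp [commGraph, Receives]
  have hd : 0 < dist (G.pos v) (G.pos u) := dist_pos.2 fun h => hvu (G.pos_injective h)
  have hr : dist (G.pos v) (G.pos u) ≤ range S ↔
      (1 + S.ε) * S.β * S.noise ≤ signal S G v u := by
    rw [range, one_div, Real.le_rpow_inv_iff_of_pos hd.le (div_pos hP hA).le hα, signal,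
      Real.rpow_neg hd.le, ← div_eq_mul_inv, le_div_iff₀ hA,
      le_div_iff₀ (Real.rpow_pos_of_pos hd _), mul_comm]
  have hs : (1 + S.ε) * S.β * S.noise ≤ signal S G v u → S.β ≤ sinr S G v u {v} := by
    intro h
    rw [sinr, Finset.erase_singleton, Finset.sum_empty, add_zero, le_div_iff₀ S.noise_pos]
    have hm : 0 ≤ S.ε * (S.β * S.noise) := by
      have := S.ε_pos; have := S.one_le_β; have := S.noise_pos; positivity
    nlinarith
  constructor
  · rintro ⟨_, h⟩
    exact ⟨Finset.mem_singleton_self v, by simpa using Ne.symm hvu, hr.1 h, hs (hr.1 h)⟩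
  · rintro ⟨_, _, h, _⟩
    exact ⟨hvu, hr.2 h⟩

/-- `H` is a backbone structure, with constant `c`: a connected dominating set whose induced
subnetwork has diameter at most `c` times that of the network, which contains a leader of
every nonempty box of the pivotal grid and at most `c` stations of every box, and whose
stations can be divided into `c` classes such that simultaneous transmissions of stations of one
class are received by all their neighbors. -/
structure IsBackbone (c : ℕ) (H : Finset (Fin n)) : Prop where
  dominating : ∀ v, v ∈ H ∨ ∃ u ∈ H, (commGraph S G).Adj u v
  connected : ((commGraph S G).induce (H : Set (Fin n))).Connected
  diam_le : ((commGraph S G).induce (H : Set (Fin n))).diam ≤ c * (commGraph S G).diam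
  leader : ∀ v, ∃ u ∈ H, box S G u = box S G v
  card_box_le : ∀ q : ℤ × ℤ, (H.filter fun v => box S G v = q).card ≤ c
  schedule : ∃ slot : Fin n → Fin c, ∀ T ⊆ H, (∀ v ∈ T, ∀ w ∈ T, slot v = slot w) →
    ∀ v ∈ T, ∀ u, (commGraph S G).Adj v u → Receives S G T v u

end Physical

/-- A unit-size message: at most one rumor and `b` control bits. -/
structure Message (R : Type) (b : ℕ) where
  rumor : Option R
  control : Fin b → Bool

/-- What a station has observed since it woke up: for every round, the message that it received
in that round, if any. Stations have no global clock and no carrier sensing. -/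
abbrev History (R : Type) (b : ℕ) : Type := List (Option (Message R b))

/-- The station that starts with the rumors in `own` and has observed `h` possesses `ρ`. -/
def Holds {R : Type} {b : ℕ} (own : Finset R) (h : History R b) (ρ : R) : Prop :=
  ρ ∈ own ∨ ∃ m : Message R b, some m ∈ h ∧ m.rumor = some ρ

/-- A deterministic protocol for `n` stations, with rumors in `R` and `b` control bits per
message. What an awake station does in a round is a function of the station, of the rumors it
had in the beginning, and of what it has observed since it woke up. A rumor that is
transmitted has to be one that the station possesses. The output `inBackbone` tells whether the
station regards itself as a member of the backbone. -/
structure Protocol (n : ℕ) (R : Type) (b : ℕ) where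
  transmit : Fin n → Finset R → History R b → Option (Message R b)
  transmit_holds : ∀ v own h m ρ,
    transmit v own h = some m → m.rumor = some ρ → Holds own h ρ
  inBackbone : Fin n → Finset R → History R b → Bool

section Execution

variable {n b : ℕ} {R : Type} (S : Params) (G : Network n) (P : Protocol n R b)
  (own : Fin n → Finset R)

/-- A station is awake iff it is a source or has received a message. -/
def Awake (h : Fin n → History R b) (v : Fin n) : Prop := (own v).Nonempty ∨ h v ≠ []

open Classical in
/-- The message, if any, that `v` transmits when the present histories are `h`. -/
noncomputable def sent (h : Fin n → History R b) (v : Fin n) : Option (Message R b) :=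
  if Awake own h v then P.transmit v (own v) (h v) else none

open Classical in
/-- The stations that transmit when the present histories are `h`. -/
noncomputable def transmitters (h : Fin n → History R b) : Finset (Fin n) :=
  Finset.univ.filter fun v => sent P own h v ≠ none

open Classical in
/-- The message, if any, that `u` receives when the present histories are `h`. -/
noncomputable def received (h : Fin n → History R b) (u : Fin n) : Option (Message R b) :=
  if hv : ∃ v, Receives S G (transmitters P own h) v u then sent P own h hv.choose else none

open Classical in
/-- The histories of the stations after `t` rounds. The history of a station that is still
asleep is empty. -/
noncomputable def histories : ℕ → Fin n → History R b
  | 0 => fun _ => []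
  | t + 1 => fun u =>
      if Awake own (histories t) u ∨ received S G P own (histories t) u ≠ none then
        histories t u ++ [received S G P own (histories t) u]
      else []

/-- After `T` rounds the protocol has finished, and it has constructed `H` and accomplished
multi-broadcast: from then on every station is awake and silent, knows whether it belongs to
`H`, and possesses all rumors. -/
def Accomplishes (H : Finset (Fin n)) (T : ℕ) : Prop :=
  ∀ t ≥ T, ∀ v : Fin n,
    Awake own (histories S G P own t) v ∧
    sent P own (histories S G P own t) v = none ∧
    (P.inBackbone v (own v) (histories S G P own t v) = true ↔ v ∈ H) ∧
    ∀ u, ∀ ρ ∈ own u, Holds (own v) (histories S G P own t v) ρ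

end Execution

/-- A protocol for the centralized setting with `c · ⌊log₂ n⌋` control bits per message: the
stations know the whole network and the number `k` of rumors, but not who has them. -/
abbrev CentralizedProtocol (c : ℕ) : Type 1 :=
  ∀ (n : ℕ), Network n → (k : ℕ) → (R : Type) → Protocol n R (c * Nat.log 2 n)

end SINR

/-! Time is multiplexed: in even rounds the rumors of every box of the pivotal grid become known to
the whole box, and in odd rounds the backbone floods what it holds. Only sources transmit in even
rounds; they are awake from the start and therefore agree on the time. All other stations need the
time only modulo a constant period, and every message carries that residue.

The obstacle is that the sources of a box do not know each other. If d is the least distance of two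
active sources in a common box, then the active sources are sparse at scale d: at most four lie in
any cell of side d/√2. Since α > 2, the sum of ‖z‖^(-α) over the lattice ℤ² converges, so the two
members of a closest pair hear each other as soon as a constant number of nearby stations is silent
(`exists_closest_pair_hears`). A strongly selective family over O(Δ + 1) labels (box modulo a
constant, index in the box) provides this silence within O(log (Δ + 1)) rounds, whatever the active
set is (`exists_election_schedule`).

Two passes through this schedule let every active source choose the nearest station it hears in its
box and learn whether the choice is mutual. As long as some box has two active sources, some choice
is mutual (`exists_mates`); of every mutual pair one station is eliminated, and its list is put in
front of the list of the other. There are at most k sources, so after k iterations the sources of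
each box form one linked list (`election`). A token then travels along the list, one rumor being
spoken at each turn of the color of the box. Boxes of one color do not disturb each other
(`exists_box_coloring`), so this takes O(k) rounds (`conversation_over`).

The backbone consists of a leader of each nonempty box and the ends of one edge between any two
boxes that are joined by an edge (`exists_backbone`). Once every rumor is held by a leader,
pipelining finishes the task: a rumor on its way is delayed only by other rumors, and by each of
them once (`mem_or_le_card_of_walk`), which gives O(D + k) rounds (`subset_flooded`). -/

namespace SINR

/-! ### Grids, distances and interference. -/

section Geometry

variable {n : ℕ} (S : Params) (G : Network n)

/-- The side of the boxes of the pivotal grid. -/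
noncomputable def side : ℝ := range S / √2

theorem range_pos : 0 < range S := by
  have := S.ε_pos; have := S.one_le_β; have := S.noise_pos; have := S.power_pos
  unfold range; positivity

theorem side_pos : 0 < side S := div_pos (range_pos S) (by positivity)

theorem sqrt_two_mul_side : √2 * side S = range S := by
  unfold side; field_simp

/-- The cell of `v` in the grid of side `s`. -/
noncomputable def cell (s : ℝ) (v : Fin n) : Fin 2 → ℤ := fun i => ⌊G.pos v i / s⌋

theorem box_eq_iff (v u : Fin n) : box S G v = box S G u ↔ cell G (side S) v = cell G (side S) u := by
  simp [box, cell, funext_iff, Fin.forall_fin_two, side]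

theorem abs_coord_le_dist (v u : Fin n) (i : Fin 2) :
    |G.pos v i - G.pos u i| ≤ dist (G.pos v) (G.pos u) := by
  rw [dist_eq_norm]
  simpa using PiLp.norm_apply_le (G.pos v - G.pos u) i

theorem dist_le_of_abs_coord_le {v u : Fin n} {a : ℝ} (ha : 0 ≤ a)
    (h : ∀ i, |G.pos v i - G.pos u i| ≤ a) : dist (G.pos v) (G.pos u) ≤ √2 * a := by
  rw [EuclideanSpace.dist_eq, Fin.sum_univ_two, Real.sqrt_le_left (by positivity), mul_pow,
    Real.sq_sqrt (by norm_num)]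
  have h0 := pow_le_pow_left₀ (abs_nonneg _) (h 0) 2
  have h1 := pow_le_pow_left₀ (abs_nonneg _) (h 1) 2
  simp only [Real.dist_eq]
  linarith

theorem dist_lt_of_abs_coord_lt {v u : Fin n} {a : ℝ}
    (h : ∀ i, |G.pos v i - G.pos u i| < a) : dist (G.pos v) (G.pos u) < √2 * a := by
  have h2 : (0 : ℝ) < √2 := by positivity
  set b := max |G.pos v 0 - G.pos u 0| |G.pos v 1 - G.pos u 1| with hb
  have hba : b < a := max_lt (h 0) (h 1)
  refine (dist_le_of_abs_coord_le G (le_max_of_le_left (abs_nonneg _)) fun i => ?_).trans_lt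
    (mul_lt_mul_of_pos_left hba h2)
  fin_cases i
  · exact le_max_left _ _
  · exact le_max_right _ _

theorem abs_sub_lt_of_floor {s : ℝ} (hs : 0 < s) (a b : ℝ) :
    |a - b| < s * ((|⌊a / s⌋ - ⌊b / s⌋| : ℤ) + 1) := by
  have e : |a - b| = s * |a / s - b / s| := by
    rw [← sub_div, abs_div, abs_of_pos hs]; field_simp
  rw [e]
  refine mul_lt_mul_of_pos_left ?_ hs
  push_cast
  have h1 := Int.floor_le (a / s)
  have h2 := Int.lt_floor_add_one (a / s)
  have h3 := Int.floor_le (b / s)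
  have h4 := Int.lt_floor_add_one (b / s)
  have h5 := le_abs_self ((⌊a / s⌋ : ℝ) - ⌊b / s⌋)
  have h6 := neg_abs_le ((⌊a / s⌋ : ℝ) - ⌊b / s⌋)
  rw [abs_lt]
  constructor <;> linarith

theorem floor_sub_lt {s : ℝ} (hs : 0 < s) (a b : ℝ) :
    s * ((|⌊a / s⌋ - ⌊b / s⌋| : ℤ) - 1) < |a - b| := by
  have e : |a - b| = s * |a / s - b / s| := by
    rw [← sub_div, abs_div, abs_of_pos hs]; field_simp
  rw [e]
  refine mul_lt_mul_of_pos_left ?_ hs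
  push_cast
  have h1 := Int.floor_le (a / s)
  have h2 := Int.lt_floor_add_one (a / s)
  have h3 := Int.floor_le (b / s)
  have h4 := Int.lt_floor_add_one (b / s)
  have h5 := le_abs_self (a / s - b / s)
  have h6 := neg_abs_le (a / s - b / s)
  rw [sub_lt_iff_lt_add, abs_lt]
  constructor <;> linarith

theorem abs_cell_sub_le_norm (s : ℝ) (v u : Fin n) (i : Fin 2) :
    ((|cell G s v i - cell G s u i| : ℤ) : ℝ) ≤ ‖cell G s v - cell G s u‖ := by
  have := norm_le_pi_norm (cell G s v - cell G s u) i
  rwa [Pi.sub_apply, Int.norm_eq_abs, ← Int.cast_abs] at this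

/-- Together with `norm_cell_sub_le_dist` this compares the Euclidean distance with the sup norm of
the difference of cells, so that sums over stations can be bounded by sums over the lattice. -/
theorem dist_lt_of_cell {s : ℝ} (hs : 0 < s) (v u : Fin n) :
    dist (G.pos v) (G.pos u) < √2 * (s * (‖cell G s v - cell G s u‖ + 1)) := by
  refine dist_lt_of_abs_coord_lt G fun i => (abs_sub_lt_of_floor hs _ _).trans_le ?_
  have := abs_cell_sub_le_norm G s v u i
  exact mul_le_mul_of_nonneg_left (by linarith! [this]) hs.le

theorem cell_sub_lt_dist {s : ℝ} (hs : 0 < s) (v u : Fin n) (i : Fin 2) :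
    s * ((|cell G s v i - cell G s u i| : ℤ) - 1) < dist (G.pos v) (G.pos u) :=
  (floor_sub_lt hs _ _).trans_le (abs_coord_le_dist G v u i)

theorem norm_cell_sub_le_dist {s : ℝ} (hs : 0 < s) (v u : Fin n) :
    s * (‖cell G s v - cell G s u‖ - 1) ≤ dist (G.pos v) (G.pos u) := by
  suffices h : ‖cell G s v - cell G s u‖ ≤ dist (G.pos v) (G.pos u) / s + 1 by
    rw [← sub_le_iff_le_add, le_div_iff₀ hs] at h; linarith
  rw [pi_norm_le_iff_of_nonneg (by positivity)]
  intro i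
  have h := cell_sub_lt_dist G hs v u i
  rw [Pi.sub_apply, Int.norm_eq_abs, ← Int.cast_abs, ← sub_le_iff_le_add, le_div_iff₀ hs]
  linarith

theorem dist_lt_of_cell_eq {s : ℝ} (hs : 0 < s) {v u : Fin n} (h : cell G s v = cell G s u) :
    dist (G.pos v) (G.pos u) < √2 * s := by
  simpa [h] using dist_lt_of_cell G hs v u

theorem dist_lt_of_box_eq {v u : Fin n} (h : box S G v = box S G u) :
    dist (G.pos v) (G.pos u) < range S := by
  rw [← sqrt_two_mul_side]
  exact dist_lt_of_cell_eq G (side_pos S) ((box_eq_iff S G v u).1 h)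

theorem dist_pos_of_ne {v u : Fin n} (h : v ≠ u) : 0 < dist (G.pos v) (G.pos u) :=
  dist_pos.2 fun e => h (G.pos_injective e)

/-- The noise is a definite fraction of the strength of any signal within range. -/
theorem noise_le_of_le_side {s : ℝ} (hs : 0 < s) (hss : s ≤ side S) :
    (1 + S.ε) * S.β * S.noise ≤ S.power * (√2 * s) ^ (-S.α) := by
  have hA : 0 < (1 + S.ε) * S.β * S.noise := by
    have := S.ε_pos; have := S.one_le_β; have := S.noise_pos; positivity
  have hα : 0 < S.α := by linarith [S.two_lt_α]
  have hle : √2 * s ≤ range S := by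
    rw [← sqrt_two_mul_side]; exact mul_le_mul_of_nonneg_left hss (by positivity)
  have hd : 0 < √2 * s := by positivity
  rw [range, one_div, Real.le_rpow_inv_iff_of_pos hd.le (div_pos S.power_pos hA).le hα,
    le_div_iff₀ hA] at hle
  rw [Real.rpow_neg hd.le, ← div_eq_mul_inv, le_div_iff₀ (Real.rpow_pos_of_pos hd _)]
  linarith

/-- For α > 2 the series of ‖z‖^(-α) over ℤ² converges, so by the Cauchy criterion its finite
partial sums outside a large ball are small. The condition 2 ≤ X later allows ‖z‖ - 1 to be replaced
by ‖z‖ / 2. -/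
theorem exists_interference_bound {α η : ℝ} (hα : 2 < α) (hη : 0 < η) :
    ∃ X : ℕ, 2 ≤ X ∧ ∀ Z : Finset (Fin 2 → ℤ), (∀ z ∈ Z, (X : ℝ) ≤ ‖z‖) →
      ∑ z ∈ Z, ‖z‖ ^ (-α) < η := by
  obtain ⟨F, hF⟩ := summable_iff_vanishing_norm.1
    (EisensteinSeries.summable_one_div_norm_rpow hα) η hη
  obtain ⟨B, hB⟩ := (F.image fun z => ‖z‖).bddAbove
  obtain ⟨X, hX⟩ := exists_nat_gt (max B 2)
  refine ⟨X, by exact_mod_cast (le_max_right B 2).trans hX.le, fun Z hZ => ?_⟩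
  refine (le_abs_self _).trans_lt (hF Z ?_)
  rw [Finset.disjoint_left]
  intro z hz hzF
  have h1 : ‖z‖ ≤ B := hB (by simpa using ⟨z, hzF, rfl⟩)
  exact absurd (hZ z hz) (by linarith [le_max_left B 2])

open Classical in
/-- Stations that are sparse in the grid of side `s` and far from `u` cause little
interference at `u`. -/
theorem sum_signal_le {X : ℕ} {η s : ℝ} (hX2 : 2 ≤ X)
    (hX : ∀ Z : Finset (Fin 2 → ℤ), (∀ z ∈ Z, (X : ℝ) ≤ ‖z‖) → ∑ z ∈ Z, ‖z‖ ^ (-S.α) < η)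
    (hs : 0 < s) {W : Finset (Fin n)} {u : Fin n}
    (hW : ∀ q, (W.filter fun w => cell G s w = q).card ≤ 4)
    (hfar : ∀ w ∈ W, (2 * X + 2) * s ≤ dist (G.pos w) (G.pos u)) :
    ∑ w ∈ W, signal S G w u ≤ 4 * (S.power * (s / 2) ^ (-S.α)) * η := by
  have hα : 0 < S.α := by linarith [S.two_lt_α]
  have hP := S.power_pos
  set c := S.power * (s / 2) ^ (-S.α)
  have hc : 0 ≤ c := by positivity
  have hX2' : (2 : ℝ) ≤ X := by exact_mod_cast hX2
  have hs2 : √2 ≤ 2 := by rw [Real.sqrt_le_left (by norm_num)]; norm_num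
  -- The distance is below √2 s (‖z‖ + 1) ≤ 2 s (‖z‖ + 1), so the radius (2X + 2) s forces ‖z‖ > X.
  have hbig : ∀ w ∈ W, (X : ℝ) ≤ ‖cell G s w - cell G s u‖ := by
    intro w hw
    have h1 := (hfar w hw).trans_lt (dist_lt_of_cell G hs w u)
    have h2 : √2 * (s * (‖cell G s w - cell G s u‖ + 1)) ≤
        2 * (s * (‖cell G s w - cell G s u‖ + 1)) :=
      mul_le_mul_of_nonneg_right hs2 (by positivity)
    have h3 : s * (2 * X + 2) < s * (2 * (‖cell G s w - cell G s u‖ + 1)) := by linarith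
    have := lt_of_mul_lt_mul_left h3 hs.le
    linarith
  have hsig : ∀ w ∈ W, signal S G w u ≤ c * ‖cell G s w - cell G s u‖ ^ (-S.α) := by
    intro w hw
    have hb := hbig w hw
    have h1 := norm_cell_sub_le_dist G hs w u
    have h2 : s / 2 * ‖cell G s w - cell G s u‖ ≤ dist (G.pos w) (G.pos u) := by
      refine le_trans ?_ h1; nlinarith
    have hz : 0 < ‖cell G s w - cell G s u‖ := by linarith
    rw [signal, mul_assoc, ← Real.mul_rpow (by positivity) hz.le]
    refine mul_le_mul_of_nonneg_left ?_ hP.le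
    exact Real.rpow_le_rpow_of_nonpos (by positivity) h2 (by linarith)
  set f : Fin n → (Fin 2 → ℤ) := fun w => cell G s w - cell G s u
  calc ∑ w ∈ W, signal S G w u ≤ ∑ w ∈ W, c * ‖f w‖ ^ (-S.α) := Finset.sum_le_sum hsig
    _ = ∑ z ∈ W.image f, ∑ w ∈ W with f w = z, c * ‖f w‖ ^ (-S.α) :=
        (Finset.sum_fiberwise_of_maps_to (fun w hw => Finset.mem_image_of_mem f hw) _).symm
    -- The stations with the same difference `z` lie in a single cell, hence there are at most four.
    _ ≤ ∑ z ∈ W.image f, 4 * (c * ‖z‖ ^ (-S.α)) := by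
        refine Finset.sum_le_sum fun z _ => ?_
        have e : ∀ w ∈ W.filter (fun w => f w = z), c * ‖f w‖ ^ (-S.α) ≤ c * ‖z‖ ^ (-S.α) :=
          fun w hw => by rw [(Finset.mem_filter.1 hw).2]
        refine (Finset.sum_le_card_nsmul _ _ _ e).trans ?_
        rw [nsmul_eq_mul]
        refine mul_le_mul_of_nonneg_right ?_ (by positivity)
        have : W.filter (fun w => f w = z) = W.filter fun w => cell G s w = z + cell G s u := by
          refine Finset.filter_congr fun w _ => ?_
          exact sub_eq_iff_eq_add
        rw [this]
        exact_mod_cast hW _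
    _ = 4 * c * ∑ z ∈ W.image f, ‖z‖ ^ (-S.α) := by
        rw [Finset.mul_sum]; exact Finset.sum_congr rfl fun z _ => by ring
    _ ≤ 4 * c * η := by
        refine mul_le_mul_of_nonneg_left (hX _ ?_).le (by positivity)
        intro z hz
        obtain ⟨w, hw, rfl⟩ := Finset.mem_image.1 hz
        exact hbig w hw

open Classical in
/-- A station `u` hears `v` if the transmitters are sparse in a grid whose side `s` is comparable
to the distance of `u` and `v`, and all the others are farther from `u` than `x s`. -/
theorem exists_reception_radius : ∃ x : ℕ, ∀ (n : ℕ) (G : Network n) (s : ℝ), 0 < s →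
    s ≤ side S → ∀ (T : Finset (Fin n)) (v u : Fin n), v ∈ T → u ∉ T →
      dist (G.pos v) (G.pos u) ≤ √2 * s →
      (∀ q, (T.filter fun w => cell G s w = q).card ≤ 4) →
      (∀ w ∈ T, w ≠ v → x * s ≤ dist (G.pos w) (G.pos u)) → Receives S G T v u := by
  have hα := S.two_lt_α
  have hε := S.ε_pos
  have hβ : 0 < S.β := by linarith [S.one_le_β]
  have hN := S.noise_pos
  have hP := S.power_pos
  set b : ℝ := (2 * √2) ^ S.α with hb
  have hb0 : 0 < b := by positivity
  -- Let σ be the least possible strength of the signal at distance √2 s. The noise is at most σ /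
  -- ((1 + ε) β), and `η` is chosen so that the interference is at most ε σ / ((1 + ε) β); together
  -- this is σ / β. The divisor 4 b undoes the four stations per cell and the passage from √2 s to s
  -- / 2.
  obtain ⟨X, hX2, hX⟩ := exists_interference_bound (η := S.ε / ((1 + S.ε) * S.β) / (4 * b)) hα
    (by positivity)
  refine ⟨2 * X + 2, fun n G s hs hss T v u hv hu hd hcell hfar => ?_⟩
  have hne : v ≠ u := fun h => hu (h ▸ hv)
  set σ := S.power * (√2 * s) ^ (-S.α) with hσ
  have hσ0 : 0 < σ := by positivity
  have hsig : σ ≤ signal S G v u :=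
    mul_le_mul_of_nonneg_left
      (Real.rpow_le_rpow_of_nonpos (dist_pos_of_ne G hne) hd (by linarith)) hP.le
  have hnoise : (1 + S.ε) * S.β * S.noise ≤ σ := noise_le_of_le_side S hs hss
  have hI := sum_signal_le S G (W := T.erase v) (u := u) hX2 hX hs
    (fun q => (Finset.card_le_card (Finset.filter_subset_filter _ (Finset.erase_subset _ _))).trans
      (hcell q))
    (fun w hw => by
      have := hfar w (Finset.mem_of_mem_erase hw) (Finset.ne_of_mem_erase hw)
      push_cast at this; exact this)
  have e : S.power * (s / 2) ^ (-S.α) = b * σ := by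
    have : (√2 * s) = (2 * √2) * (s / 2) := by ring
    rw [hσ, this, Real.mul_rpow (by positivity) (by positivity), hb,
      Real.rpow_neg (x := 2 * √2) (by positivity)]
    field_simp
  rw [e] at hI
  have e2 : 4 * (b * σ) * (S.ε / ((1 + S.ε) * S.β) / (4 * b)) = S.ε / ((1 + S.ε) * S.β) * σ := by
    field_simp
  rw [e2] at hI
  have hn' : S.noise ≤ 1 / ((1 + S.ε) * S.β) * σ := by
    rw [one_div, ← div_eq_inv_mul, le_div_iff₀ (by positivity)]; linarith
  have hI0 : 0 ≤ ∑ w ∈ T.erase v, signal S G w u :=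
    Finset.sum_nonneg fun w _ => signal_nonneg S G w u
  refine ⟨hv, hu, hnoise.trans hsig, ?_⟩
  rw [sinr, le_div_iff₀ (by linarith)]
  have e3 : 1 / ((1 + S.ε) * S.β) * σ + S.ε / ((1 + S.ε) * S.β) * σ = σ / S.β := by
    field_simp
  calc S.β * (S.noise + ∑ w ∈ T.erase v, signal S G w u) ≤ S.β * (σ / S.β) :=
        mul_le_mul_of_nonneg_left (by linarith) hβ.le
    _ = σ := by field_simp
    _ ≤ _ := hsig

end Geometry

/-! ### Strongly selective families by greedy covering. -/

section Selective

-- Double counting of pairs (choice, satisfied requirement): a uniformly random choice satisfies, in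
-- expectation, at least the fraction 1 / q of `U`.
open Classical in
theorem exists_many_satisfied {Req Ω : Type*} [Fintype Ω] [Nonempty Ω] (sat : Ω → Req → Prop)
    (q : ℕ) (U : Finset Req)
    (h : ∀ r ∈ U, Fintype.card Ω ≤ q * (Finset.univ.filter fun ω => sat ω r).card) :
    ∃ ω, U.card ≤ q * (U.filter fun r => sat ω r).card := by
  by_contra! hcon
  have h1 : ∑ ω : Ω, q * (U.filter fun r => sat ω r).card < ∑ _ω : Ω, U.card :=
    Finset.sum_lt_sum_of_nonempty Finset.univ_nonempty fun ω _ => hcon ω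
  have h2 : ∑ ω : Ω, (U.filter fun r => sat ω r).card =
      ∑ r ∈ U, (Finset.univ.filter fun ω => sat ω r).card := by
    simp only [Finset.card_filter]
    exact Finset.sum_comm
  have h3 : ∑ _r ∈ U, Fintype.card Ω ≤
      ∑ r ∈ U, q * (Finset.univ.filter fun ω => sat ω r).card := Finset.sum_le_sum h
  rw [← Finset.mul_sum, h2] at h1
  rw [← Finset.mul_sum] at h3
  simp only [Finset.sum_const, smul_eq_mul, Finset.card_univ] at h1 h3
  rw [mul_comm U.card] at h3
  omega

open Classical in
/-- Greedy covering: if every requirement is satisfied by a fraction `1 / q` of all choices, then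
some `L` choices leave only a fraction `(1 - 1 / q) ^ L` of the requirements unsatisfied. -/
theorem exists_greedy_choices {Req Ω : Type*} [Fintype Ω] [Nonempty Ω] (sat : Ω → Req → Prop)
    (q : ℕ) (U : Finset Req)
    (h : ∀ r ∈ U, Fintype.card Ω ≤ q * (Finset.univ.filter fun ω => sat ω r).card) (L : ℕ) :
    ∃ F : ℕ → Ω, q ^ L * (U.filter fun r => ∀ j < L, ¬ sat (F j) r).card ≤
      (q - 1) ^ L * U.card := by
  induction L with
  | zero => exact ⟨fun _ => Classical.arbitrary Ω, by simp⟩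
  | succ L ih =>
    obtain ⟨F, hF⟩ := ih
    set V := U.filter fun r => ∀ j < L, ¬ sat (F j) r with hV
    obtain ⟨ω, hω⟩ := exists_many_satisfied sat q V fun r hr => h r (Finset.mem_filter.1 hr).1
    refine ⟨Function.update F L ω, ?_⟩
    have e : (U.filter fun r => ∀ j < L + 1, ¬ sat (Function.update F L ω j) r) =
        V.filter fun r => ¬ sat ω r := by
      ext r
      simp only [hV, Finset.mem_filter, and_assoc, Nat.lt_succ_iff_lt_or_eq]
      refine and_congr_right fun _ => ⟨fun H => ⟨fun j hj => ?_, ?_⟩, ?_⟩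
      · simpa [Function.update_of_ne hj.ne] using H j (Or.inl hj)
      · simpa using H L (Or.inr rfl)
      · rintro ⟨H1, H2⟩ j (hj | rfl)
        · simpa [Function.update_of_ne hj.ne] using H1 j hj
        · simpa using H2
    rw [e]
    have hsum := Finset.card_filter_add_card_filter_not (s := V) (fun r => sat ω r)
    set a := (V.filter fun r => sat ω r).card
    set b := (V.filter fun r => ¬ sat ω r).card
    have hqb : q * b ≤ (q - 1) * V.card := by
      rw [Nat.sub_mul, one_mul]
      have : q * (a + b) = q * V.card := by rw [hsum]
      rw [mul_add] at this
      omega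
    calc q ^ (L + 1) * b = q ^ L * (q * b) := by ring
      _ ≤ q ^ L * ((q - 1) * V.card) := Nat.mul_le_mul_left _ hqb
      _ = (q - 1) * (q ^ L * V.card) := by ring
      _ ≤ (q - 1) * ((q - 1) ^ L * U.card) := Nat.mul_le_mul_left _ hF
      _ = _ := by ring

/-- For constant `K` there are strongly selective families of logarithmic length: every element
`v` is selected from every set of `K` other elements. -/
theorem exists_selective_family (K : ℕ) : ∃ c : ℕ, ∀ (Λ : Type) [Fintype Λ] [Nonempty Λ],
    ∃ (L : ℕ) (F : ℕ → Finset Λ), (L : ℝ) ≤ c * (Real.log (Fintype.card Λ) + 1) ∧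
      ∀ (v : Λ) (B : Finset Λ), v ∉ B → B.card ≤ K → ∃ j < L, v ∈ F j ∧ Disjoint B (F j) := by
  classical
  set q := 2 ^ (K + 1) with hq
  refine ⟨q * (K + 1) + 1, fun Λ _ _ => ?_⟩
  -- A uniformly random subset of Λ contains v and avoids B with probability 2^(-(|B| + 1)) ≥ 1 / q.
  set M := Fintype.card Λ with hM
  have hM1 : 1 ≤ M := Fintype.card_pos
  have hM1' : (1 : ℝ) ≤ M := by exact_mod_cast hM1
  have hq1 : (1 : ℝ) ≤ q := by rw [hq]; push_cast; exact one_le_pow₀ (by norm_num)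
  have hlog : 0 ≤ Real.log M := Real.log_nonneg hM1'
  -- There are M^(K + 1) requirements, and this length makes (1 - 1 / q)^L M^(K + 1) less than 1, so
  -- that none of them is left.
  set L := ⌊(q * (K + 1) * Real.log M : ℝ)⌋₊ + 1 with hL
  have hL1 : (L : ℝ) ≤ q * (K + 1) * Real.log M + 1 := by
    rw [hL]; push_cast
    linarith [Nat.floor_le (a := (q * (K + 1) * Real.log M : ℝ)) (by positivity)]
  have hL2 : q * (K + 1) * Real.log M < (L : ℝ) := by
    rw [hL]; push_cast; exact Nat.lt_floor_add_one _
  -- A requirement is a pair (v, g), where g lists the elements of B; repetitions and the value v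
  -- are allowed, since v is erased from the image.
  have hsat : ∀ r ∈ (Finset.univ : Finset (Λ × (Fin K → Λ))), Fintype.card (Finset Λ) ≤
      q * (Finset.univ.filter fun ω : Finset Λ => r.1 ∈ ω ∧
        Disjoint ((Finset.univ.image r.2).erase r.1) ω).card := by
    rintro ⟨v, g⟩ -
    set B := (Finset.univ.image g).erase v with hB
    have hvB : v ∉ B := Finset.notMem_erase _ _
    have hBc : B.card ≤ K := (Finset.card_erase_le.trans Finset.card_image_le).trans (by simp)
    have hsub : ({v} : Finset Λ) ⊆ Bᶜ := by simpa using hvB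
    have : (Finset.univ.filter fun ω : Finset Λ => v ∈ ω ∧ Disjoint B ω) =
        Finset.Icc {v} Bᶜ := by
      ext ω
      simp only [Finset.mem_filter, Finset.mem_univ, true_and, Finset.mem_Icc,
        Finset.singleton_subset_iff, Finset.subset_compl_iff_disjoint_left]
    change _ ≤ q * (Finset.univ.filter fun ω : Finset Λ => v ∈ ω ∧ Disjoint B ω).card
    rw [this, Finset.card_Icc_finset hsub, Fintype.card_finset, hq, ← pow_add,
      Finset.card_compl, Finset.card_singleton]
    exact Nat.pow_le_pow_right (by norm_num) (by omega)
  obtain ⟨F, hF⟩ := exists_greedy_choices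
    (fun (ω : Finset Λ) (r : Λ × (Fin K → Λ)) => r.1 ∈ ω ∧
      Disjoint ((Finset.univ.image r.2).erase r.1) ω) q Finset.univ
    (fun r hr => by convert hsat r hr) L
  refine ⟨L, F, ?_, ?_⟩
  · push_cast
    nlinarith
  have hcard : ((Finset.univ : Finset (Λ × (Fin K → Λ))).card : ℝ) = (M : ℝ) ^ (K + 1) := by
    simp [hM]; ring
  have hnone : (Finset.univ.filter fun r : Λ × (Fin K → Λ) => ∀ j < L, ¬ (r.1 ∈ F j ∧
      Disjoint ((Finset.univ.image r.2).erase r.1) (F j))) = ∅ := by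
    rw [← Finset.card_eq_zero]
    by_contra hne
    set a := (Finset.univ.filter fun r : Λ × (Fin K → Λ) => ∀ j < L, ¬ (r.1 ∈ F j ∧
      Disjoint ((Finset.univ.image r.2).erase r.1) (F j))).card
    have h1 : (1 : ℝ) ≤ a := by exact_mod_cast Nat.one_le_iff_ne_zero.2 hne
    have h2 : (q : ℝ) ^ L * a ≤ ((q : ℝ) - 1) ^ L * (M : ℝ) ^ (K + 1) := by
      rw [← hcard]
      have hc : ((q - 1 : ℕ) : ℝ) = (q : ℝ) - 1 := by
        rw [Nat.cast_sub (by exact_mod_cast hq1)]; simp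
      have hF' : q ^ L * a ≤ (q - 1) ^ L *
          (Finset.univ : Finset (Λ × (Fin K → Λ))).card := by convert hF
      rw [← hc]
      exact_mod_cast hF'
    have h3 : ((q : ℝ) - 1) ≤ q * Real.exp (-(1 / q)) := by
      have := Real.add_one_le_exp (-(1 / q : ℝ))
      have h4 : (q : ℝ) * (-(1 / q) + 1) ≤ q * Real.exp (-(1 / q)) :=
        mul_le_mul_of_nonneg_left this (by positivity)
      have h5 : (q : ℝ) * (-(1 / q) + 1) = q - 1 := by field_simp; ring
      linarith
    have h4 : ((q : ℝ) - 1) ^ L ≤ (q : ℝ) ^ L * Real.exp (-(L / q)) := by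
      refine (pow_le_pow_left₀ (by linarith) h3 L).trans_eq ?_
      rw [mul_pow, ← Real.exp_nat_mul]
      congr 2
      ring
    have h5 : (M : ℝ) ^ (K + 1) = Real.exp ((K + 1) * Real.log M) := by
      rw [← Real.rpow_natCast, Real.rpow_def_of_pos (by linarith)]
      push_cast; ring_nf
    have h6 : Real.exp (-(L / q)) * (M : ℝ) ^ (K + 1) < 1 := by
      rw [h5, ← Real.exp_add, Real.exp_lt_one_iff]
      have : (K + 1) * Real.log M < L / q := by
        rw [lt_div_iff₀ (by linarith)]; linarith
      linarith
    have hqL : (0 : ℝ) < (q : ℝ) ^ L := by positivity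
    have h7 : (q : ℝ) ^ L * a ≤ (q : ℝ) ^ L * (Real.exp (-(L / q)) * (M : ℝ) ^ (K + 1)) := by
      refine h2.trans ?_
      rw [← mul_assoc]
      exact mul_le_mul_of_nonneg_right h4 (by positivity)
    have := le_of_mul_le_mul_left h7 hqL
    linarith
  intro v B hv hB
  have hg : ∃ g : Fin K → Λ, B ⊆ (Finset.univ.image g).erase v := by
    -- If B has fewer than K elements, the list is padded with `v`, which the erasure removes.
    refine ⟨fun i => if h : (i : ℕ) < B.card then B.equivFin.symm ⟨i, h⟩ else v, ?_⟩
    intro w hw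
    refine Finset.mem_erase.2 ⟨fun h => hv (h ▸ hw), Finset.mem_image.2 ?_⟩
    refine ⟨⟨B.equivFin ⟨w, hw⟩, (B.equivFin ⟨w, hw⟩).2.trans_le hB⟩, Finset.mem_univ _, ?_⟩
    simp
  obtain ⟨g, hg⟩ := hg
  by_contra! hcon
  have : (v, g) ∈ (∅ : Finset (Λ × (Fin K → Λ))) := by
    rw [← hnone]
    refine Finset.mem_filter.2 ⟨Finset.mem_univ _, fun j hj ⟨h1, h2⟩ => ?_⟩
    exact hcon j hj h1 (Finset.disjoint_of_subset_left hg h2)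
  simp at this

end Selective

/-! ### Colorings of the boxes and the election schedule. -/

section Schedules

variable {n : ℕ} (S : Params) (G : Network n)

/-- The residues modulo `m` of the coordinates of the box of `v`. -/
noncomputable def boxColor (m : ℕ) (v : Fin n) : ZMod m × ZMod m :=
  ((box S G v).1, (box S G v).2)

/-- Some coordinate of the two boxes differs by a nonzero multiple of `m`, hence by at least `m`,
and one side is lost to the positions within the boxes. -/
theorem mul_side_le_dist_of_boxColor_eq {m : ℕ} {v w : Fin n}
    (hc : boxColor S G m v = boxColor S G m w) (hb : box S G v ≠ box S G w) :
    ((m : ℝ) - 1) * side S ≤ dist (G.pos v) (G.pos w) := by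
  have hdvd : ∀ i, (m : ℤ) ∣ cell G (side S) v i - cell G (side S) w i := by
    simp only [boxColor, Prod.mk.injEq] at hc
    intro i
    have h0 := (ZMod.intCast_eq_intCast_iff_dvd_sub _ _ _).1 hc.1
    have h1 := (ZMod.intCast_eq_intCast_iff_dvd_sub _ _ _).1 hc.2
    fin_cases i
    · exact dvd_sub_comm.1 h0
    · exact dvd_sub_comm.1 h1
  obtain ⟨i, hi⟩ : ∃ i, cell G (side S) v i ≠ cell G (side S) w i := by
    by_contra! h
    exact hb ((box_eq_iff S G v w).2 (funext h))
  have h1 : (m : ℤ) ≤ |cell G (side S) v i - cell G (side S) w i| :=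
    Int.le_of_dvd (abs_pos.2 (sub_ne_zero.2 hi)) ((dvd_abs _ _).2 (hdvd i))
  have h2 := cell_sub_lt_dist G (side_pos S) v w i
  have h3 : (m : ℝ) ≤ (|cell G (side S) v i - cell G (side S) w i| : ℤ) := by exact_mod_cast h1
  have := side_pos S
  nlinarith

open Classical in
/-- The boxes can be colored with a constant number of colors so that stations of different boxes
of the same color are heard simultaneously in their whole range. -/
theorem exists_box_coloring : ∃ C : ℕ, 0 < C ∧ ∀ (n : ℕ) (G : Network n),
    ∃ col : Fin n → Fin C, (∀ v w, box S G v = box S G w → col v = col w) ∧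
      (∀ v w, col v = col w → box S G v ≠ box S G w →
        range S < dist (G.pos v) (G.pos w)) ∧
      ∀ (T : Finset (Fin n)) (v u : Fin n), v ∈ T → u ∉ T →
      dist (G.pos v) (G.pos u) ≤ range S →
      (∀ w ∈ T, ∀ w' ∈ T, w ≠ w' → col w = col w' ∧ box S G w ≠ box S G w') →
      Receives S G T v u := by
  obtain ⟨x, hx⟩ := exists_reception_radius S
  -- Another transmitter of the color is at least (x + 2) sides away from `v`, and the listener is
  -- less than 2 sides away from `v`; this leaves the x sides that the reception radius demands.
  set m := x + 3 with hm
  have : NeZero m := ⟨by omega⟩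
  have hcard : Fintype.card (ZMod m × ZMod m) = m * m := by simp [ZMod.card]
  refine ⟨m * m, by positivity, fun n G =>
    ⟨fun v => Fintype.equivFinOfCardEq hcard (boxColor S G m v),
      fun v w h => by simp only [boxColor, h], ?_, ?_⟩⟩
  all_goals
    have hsp := side_pos S
    have h5 : range S < 2 * side S := by
      rw [← sqrt_two_mul_side]
      refine mul_lt_mul_of_pos_right ?_ hsp
      rw [Real.sqrt_lt' (by norm_num)]; norm_num
  · intro v w h1 h2
    have h3 := mul_side_le_dist_of_boxColor_eq S G ((Equiv.injective _) h1) h2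
    rw [hm] at h3
    push_cast at h3
    nlinarith
  intro T v u hv hu hd hT
  refine hx n G (side S) hsp le_rfl T v u hv hu (by rwa [sqrt_two_mul_side]) ?_ ?_
  · intro q
    refine (Finset.card_le_one.2 ?_).trans (by norm_num)
    intro a ha b hb
    simp only [Finset.mem_filter] at ha hb
    by_contra hab
    exact (hT a ha.1 b hb.1 hab).2 ((box_eq_iff S G a b).2 (ha.2.trans hb.2.symm))
  · intro w hw hwv
    obtain ⟨h1, h2⟩ := hT w hw v hv hwv
    have h3 := mul_side_le_dist_of_boxColor_eq S G ((Equiv.injective _) h1) h2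
    have h4 := dist_triangle (G.pos w) (G.pos u) (G.pos v)
    rw [dist_comm (G.pos u)] at h4
    rw [hm] at h3
    push_cast at h3
    linarith

/-- An injective numbering of the members of `X` inside each class of `b`. -/
theorem exists_index_in_class {β : Type*} (b : Fin n → β) (X : Finset (Fin n)) (c : ℕ)
    (hc : 0 < c) (h : ∀ q, (open Classical in (X.filter fun v => b v = q).card) ≤ c) :
    ∃ idx : Fin n → Fin c, ∀ v ∈ X, ∀ w ∈ X, b v = b w → idx v = idx w → v = w := by
  classical
  -- The index of a station is its rank in its class.
  have hlt : ∀ v ∈ X, (X.filter fun w => b w = b v ∧ w < v).card < c := by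
    intro v hv
    refine (Finset.card_lt_card ?_).trans_le (h (b v))
    refine Finset.ssubset_iff_of_subset
      (fun w hw => by simp only [Finset.mem_filter] at hw ⊢; exact ⟨hw.1, hw.2.1⟩) |>.2 ?_
    exact ⟨v, by simp [hv], by simp⟩
  refine ⟨fun v => if hv : v ∈ X then ⟨_, hlt v hv⟩ else ⟨0, hc⟩, ?_⟩
  have key : ∀ v ∈ X, ∀ w ∈ X, b v = b w → v < w →
      (X.filter fun z => b z = b v ∧ z < v).card < (X.filter fun z => b z = b w ∧ z < w).card := by
    intro v hv w hw hb hvw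
    refine Finset.card_lt_card (Finset.ssubset_iff_of_subset ?_ |>.2 ⟨v, ?_, ?_⟩)
    · intro z hz
      simp only [Finset.mem_filter] at hz ⊢
      exact ⟨hz.1, hz.2.1.trans hb, hz.2.2.trans hvw⟩
    · simp [hv, hb, hvw]
    · simp
  intro v hv w hw hb he
  simp only [hv, hw, dif_pos, Fin.mk.injEq] at he
  rcases lt_trichotomy v w with hvw | hvw | hvw
  · exact absurd he (key v hv w hw hb hvw).ne
  · exact hvw
  · exact absurd he (key w hw v hv hb.symm hvw).ne'

-- A box has diameter less than the range, so its stations form a clique.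
open Classical in
theorem card_box_le_maxDeg (q : ℤ × ℤ) :
    ((Finset.univ : Finset (Fin n)).filter fun v => box S G v = q).card ≤ maxDeg S G + 1 := by
  by_cases hq : ∃ v, box S G v = q
  · obtain ⟨v, rfl⟩ := hq
    have hsub : ((Finset.univ : Finset (Fin n)).filter fun w => box S G w = box S G v) ⊆
        insert v ((commGraph S G).neighborFinset v) := by
      intro w hw
      rw [Finset.mem_insert, SimpleGraph.mem_neighborFinset]
      by_cases hwv : w = v
      · exact Or.inl hwv
      · exact Or.inr ⟨Ne.symm hwv,
          (dist_lt_of_box_eq S G (Finset.mem_filter.1 hw).2.symm).le⟩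
    refine (Finset.card_le_card hsub).trans ((Finset.card_insert_le _ _).trans ?_)
    rw [SimpleGraph.card_neighborFinset_eq_degree]
    exact Nat.succ_le_succ (SimpleGraph.degree_le_maxDegree _ v)
  · push Not at hq
    rw [Finset.filter_false_of_mem (fun v _ => hq v)]
    simp

/-- `v` and `u` are two different stations of `A` in the same box, and no two stations of `A` in a
common box are closer to each other. -/
structure ClosestPair (A : Finset (Fin n)) (v u : Fin n) : Prop where
  left_mem : v ∈ A
  right_mem : u ∈ A
  ne : v ≠ u
  box_eq : box S G v = box S G u
  le : ∀ a ∈ A, ∀ b ∈ A, a ≠ b → box S G a = box S G b →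
    dist (G.pos v) (G.pos u) ≤ dist (G.pos a) (G.pos b)

-- Stations in one cell of side `s` are less than √2 s apart, so they lie in different boxes. As s ≤
-- `side S`, the cell meets boxes whose coordinates differ by at most one; their parities
-- distinguish them, and there are four.
open Classical in
theorem card_cell_le_four {s : ℝ} (hs : 0 < s) (hss : s ≤ side S) {A : Finset (Fin n)}
    (hA : ∀ a ∈ A, ∀ b ∈ A, a ≠ b → box S G a = box S G b →
      √2 * s ≤ dist (G.pos a) (G.pos b)) (q : Fin 2 → ℤ) :
    (A.filter fun w => cell G s w = q).card ≤ 4 := by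
  have hclose : ∀ a b : Fin n, cell G s a = cell G s b → ∀ i,
      |cell G (side S) a i - cell G (side S) b i| ≤ 1 := by
    intro a b hab i
    have h1 := floor_sub_lt (side_pos S) (G.pos a i) (G.pos b i)
    have h2 := abs_sub_lt_of_floor hs (G.pos a i) (G.pos b i)
    have h3 : ⌊G.pos a i / s⌋ = ⌊G.pos b i / s⌋ := congrFun hab i
    rw [h3] at h2
    simp only [sub_self, abs_zero, Int.cast_zero, zero_add, mul_one] at h2
    have h4 : side S * (((|⌊G.pos a i / side S⌋ - ⌊G.pos b i / side S⌋| : ℤ) : ℝ) - 1) <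
        side S * 1 := by linarith
    have h5 := lt_of_mul_lt_mul_left h4 (side_pos S).le
    have h6 : (|⌊G.pos a i / side S⌋ - ⌊G.pos b i / side S⌋| : ℤ) < 2 := by
      have : ((|⌊G.pos a i / side S⌋ - ⌊G.pos b i / side S⌋| : ℤ) : ℝ) < 2 := by linarith
      exact_mod_cast this
    exact Int.le_of_lt_add_one h6
  have : ((Finset.Icc (0 : ℤ) 1) ×ˢ (Finset.Icc (0 : ℤ) 1)).card = 4 := by simp
  rw [← this]
  refine Finset.card_le_card_of_injOn
    (fun w => (cell G (side S) w 0 % 2, cell G (side S) w 1 % 2)) ?_ ?_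
  · intro w _
    simp only [Finset.coe_product, Set.mem_prod, Finset.mem_coe, Finset.mem_Icc]
    omega
  · intro a ha b hb hab
    simp only [Finset.coe_filter, Set.mem_ofPred_eq] at ha hb
    by_contra hne
    have hc : cell G s a = cell G s b := ha.2.trans hb.2.symm
    have hbox : box S G a = box S G b := by
      rw [box_eq_iff]
      simp only [Prod.mk.injEq] at hab
      have h0 := abs_le.1 (hclose a b hc 0)
      have h1 := abs_le.1 (hclose a b hc 1)
      funext i
      fin_cases i
      · change cell G (side S) a 0 = cell G (side S) b 0
        omega
      · change cell G (side S) a 1 = cell G (side S) b 1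
        omega
    exact absurd (hA a ha.1 b hb.1 hne hbox) (not_le.2 (dist_lt_of_cell_eq G hs hc))

open Classical in
/-- A member of a closest pair hears the other one as soon as a constant number of stations, all of
which are near, are silent. -/
theorem exists_closest_pair_hears : ∃ K x : ℕ, ∀ (n : ℕ) (G : Network n) (A : Finset (Fin n))
    (v u : Fin n), ClosestPair S G A v u → ∃ B : Finset (Fin n), v ∉ B ∧ B.card ≤ K ∧
      (∀ w ∈ B, dist (G.pos w) (G.pos v) < (x + 1) * side S) ∧
      ∀ T ⊆ A, v ∈ T → Disjoint B T → Receives S G T v u := by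
  obtain ⟨x, hx⟩ := exists_reception_radius S
  -- The silenced stations occupy cells that differ from that of `u` by at most x + 2 in each
  -- coordinate, with at most four stations in each.
  refine ⟨4 * (2 * x + 5) ^ 2, x + 2, fun n G A v u h => ?_⟩
  set d := dist (G.pos v) (G.pos u) with hd
  have hd0 : 0 < d := dist_pos_of_ne G h.ne
  have h2 : (0 : ℝ) < √2 := by positivity
  have hs2 : √2 ≤ 2 := by rw [Real.sqrt_le_left (by norm_num)]; norm_num
  -- With this side the cells have diameter d, and `card_cell_le_four` applies.
  set s := d / √2 with hs
  have hds : √2 * s = d := by rw [hs]; field_simp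
  have hs0 : 0 < s := by positivity
  have hss : s ≤ side S := by
    have := dist_lt_of_box_eq S G h.box_eq
    rw [← hd, ← hds, ← sqrt_two_mul_side] at this
    exact (lt_of_mul_lt_mul_left this h2.le).le
  have hcell := card_cell_le_four S G hs0 hss (A := A)
    (fun a ha b hb hab hbox => by rw [hds]; exact h.le a ha b hb hab hbox)
  -- The radius is (x + 1) s and not x s so that it is positive even for x = 0; the set then
  -- contains `u` itself, which has to listen.
  refine ⟨A.filter fun w => w ≠ v ∧ dist (G.pos w) (G.pos u) < (x + 1) * s, ?_, ?_, ?_, ?_⟩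
  · simp
  · set B := A.filter fun w => w ≠ v ∧ dist (G.pos w) (G.pos u) < (x + 1) * s
    have hBA : B ⊆ A := Finset.filter_subset _ _
    refine (Finset.card_le_mul_card_image (f := cell G s) B 4 fun q _ =>
      (Finset.card_le_card (Finset.filter_subset_filter _ hBA)).trans (hcell q)).trans ?_
    refine Nat.mul_le_mul_left _ ?_
    have hsub : B.image (cell G s) ⊆ Finset.Icc (fun i => cell G s u i - (x + 2))
        (fun i => cell G s u i + (x + 2)) := by
      intro z hz
      obtain ⟨w, hw, rfl⟩ := Finset.mem_image.1 hz
      have hwd := (Finset.mem_filter.1 hw).2.2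
      have hi : ∀ i, |cell G s w i - cell G s u i| ≤ x + 2 := by
        intro i
        have h3 := (cell_sub_lt_dist G hs0 w u i).trans hwd
        rw [mul_comm] at h3
        have h4 := lt_of_mul_lt_mul_right h3 hs0.le
        have : ((|cell G s w i - cell G s u i| : ℤ) : ℝ) < ((x + 2 : ℤ) : ℝ) := by
          push_cast at h4 ⊢; linarith
        exact (Int.cast_lt.1 this).le
      rw [Finset.mem_Icc]
      constructor <;> intro i <;> have := abs_le.1 (hi i) <;> simp only <;> omega
    refine (Finset.card_le_card hsub).trans ?_
    rw [Pi.card_Icc, Fin.prod_univ_two]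
    simp only [Int.card_Icc]
    have : ∀ z : ℤ, (z + (x + 2) + 1 - (z - (x + 2))).toNat = 2 * x + 5 := by intro z; omega
    rw [this, this, sq]
  · intro w hw
    have hwd := (Finset.mem_filter.1 hw).2.2
    have h3 := dist_triangle (G.pos w) (G.pos u) (G.pos v)
    rw [dist_comm (G.pos u), ← hd, ← hds] at h3
    have h4 : √2 * s ≤ 2 * s := mul_le_mul_of_nonneg_right hs2 hs0.le
    have h5 : ((x : ℝ) + 3) * s ≤ (x + 3) * side S :=
      mul_le_mul_of_nonneg_left hss (by positivity)
    push_cast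
    linarith
  · intro T hTA hvT hdisj
    have hnear : ∀ w ∈ T, w ≠ v → (x + 1) * s ≤ dist (G.pos w) (G.pos u) := by
      intro w hw hwv
      by_contra! hlt
      exact Finset.disjoint_left.1 hdisj (Finset.mem_filter.2 ⟨hTA hw, hwv, hlt⟩) hw
    refine hx n G s hs0 hss T v u hvT ?_ hds.ge ?_ ?_
    · intro huT
      have := hnear u huT h.ne.symm
      rw [dist_self] at this
      have : 0 < ((x : ℝ) + 1) * s := by positivity
      linarith
    · exact fun q => (Finset.card_le_card (Finset.filter_subset_filter _ hTA)).trans (hcell q)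
    · intro w hw hwv
      have := hnear w hw hwv
      linarith

open Classical in
/-- A schedule of `O(log (Δ + 1))` rounds in which, whatever set `A` of stations takes part, the
members of every closest pair of `A` hear each other. -/
theorem exists_election_schedule : ∃ c : ℕ, ∀ (n : ℕ) (G : Network n), 1 ≤ maxDeg S G →
    ∃ (L : ℕ) (sel : ℕ → Finset (Fin n)), (L : ℝ) ≤ c * Real.log (maxDeg S G + 1) ∧
      ∀ (A : Finset (Fin n)) (v u : Fin n), ClosestPair S G A v u →
        ∃ j < L, Receives S G (A ∩ sel j) v u := by
  obtain ⟨K, x, hK⟩ := exists_closest_pair_hears S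
  obtain ⟨c, hc⟩ := exists_selective_family K
  set m := x + 2 with hm
  have : NeZero m := ⟨by omega⟩
  refine ⟨c * (2 * (m * m) + 3), fun n G hΔ => ?_⟩
  obtain ⟨idx, hidx⟩ := exists_index_in_class (box S G) Finset.univ (maxDeg S G + 1)
    (Nat.succ_pos _) (fun q => by convert card_box_le_maxDeg S G q)
  obtain ⟨L, F, hL, hF⟩ := hc ((ZMod m × ZMod m) × Fin (maxDeg S G + 1))
  -- Labels need to be different only from those of nearby stations: stations of one box differ in
  -- the index, and stations of different boxes of one color are at least m - 1 = x + 1 sides apart.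
  -- Hence the logarithm of the number of labels is O(log (Δ + 1)).
  let lab : Fin n → (ZMod m × ZMod m) × Fin (maxDeg S G + 1) :=
    fun v => (boxColor S G m v, idx v)
  refine ⟨L, fun j => Finset.univ.filter fun v => lab v ∈ F j, hL.trans ?_, ?_⟩
  · have hcard : Fintype.card ((ZMod m × ZMod m) × Fin (maxDeg S G + 1)) =
        (m * m) * (maxDeg S G + 1) := by simp [ZMod.card]
    have hm1 : (1 : ℝ) ≤ m * m := by
      have : 1 ≤ m * m := Nat.one_le_iff_ne_zero.2 (by positivity)
      exact_mod_cast this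
    have hΔ' : (2 : ℝ) ≤ (maxDeg S G : ℝ) + 1 := by
      have : (1 : ℝ) ≤ maxDeg S G := by exact_mod_cast hΔ
      linarith
    -- As Δ ≥ 1, additive constants are absorbed by multiples of log (Δ + 1).
    have hlog2 : (1 : ℝ) / 2 ≤ Real.log (maxDeg S G + 1) := by
      have h1 := Real.log_le_log (by norm_num) hΔ'
      have h2 := Real.log_two_gt_d9
      linarith
    rw [hcard]
    push_cast
    rw [Real.log_mul (by positivity) (by positivity), mul_assoc]
    refine mul_le_mul_of_nonneg_left ?_ (Nat.cast_nonneg _)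
    have h3 := Real.log_le_sub_one_of_pos (lt_of_lt_of_le one_pos hm1)
    nlinarith
  · intro A v u h
    obtain ⟨B, hvB, hBK, hnear, hT⟩ := hK n G A v u h
    have hlab : ∀ w ∈ B, lab w ≠ lab v := by
      intro w hw he
      simp only [lab, Prod.mk.injEq] at he
      by_cases hb : box S G w = box S G v
      · exact hvB (hidx w (Finset.mem_univ _) v (Finset.mem_univ _) hb he.2 ▸ hw)
      · have h1 := mul_side_le_dist_of_boxColor_eq S G he.1 hb
        have h2 := hnear w hw
        rw [hm] at h1
        push_cast at h1
        linarith
    obtain ⟨j, hj, hvj, hdis⟩ := hF (lab v) (B.image lab)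
      (fun hmem => by
        obtain ⟨w, hw, he⟩ := Finset.mem_image.1 hmem
        exact hlab w hw he)
      (Finset.card_image_le.trans hBK)
    refine ⟨j, hj, hT _ Finset.inter_subset_left ?_ ?_⟩
    · exact Finset.mem_inter.2 ⟨h.left_mem, by simpa using hvj⟩
    · rw [Finset.disjoint_left]
      intro w hw hw'
      refine Finset.disjoint_left.1 hdis (Finset.mem_image_of_mem lab hw) ?_
      simpa using (Finset.mem_inter.1 hw').2

end Schedules

/-! ### Construction of the backbone. -/

section Backbone

variable {n : ℕ} (S : Params) (G : Network n)

/-- Some station of the box `q` is adjacent to some station of the box `q'`. -/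
def BoxAdj (q q' : ℤ × ℤ) : Prop :=
  ∃ e : Fin n × Fin n, (commGraph S G).Adj e.1 e.2 ∧ box S G e.1 = q ∧ box S G e.2 = q'

/-- The range is √2 sides, so the box coordinates of adjacent stations differ by less than √2 + 1 <
3. -/
theorem BoxAdj.mem_Icc {q q' : ℤ × ℤ} (h : BoxAdj S G q q') :
    q' ∈ Finset.Icc (q.1 - 2) (q.1 + 2) ×ˢ Finset.Icc (q.2 - 2) (q.2 + 2) := by
  obtain ⟨⟨v, w⟩, hvw, rfl, rfl⟩ := h
  have key : ∀ i, |cell G (side S) v i - cell G (side S) w i| ≤ 2 := by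
    intro i
    have h1 := (cell_sub_lt_dist G (side_pos S) v w i).trans_le hvw.2
    rw [← sqrt_two_mul_side, mul_comm] at h1
    have h2 := lt_of_mul_lt_mul_right h1 (side_pos S).le
    have h3 : √2 < 2 := by rw [Real.sqrt_lt' (by norm_num)]; norm_num
    have : ((|cell G (side S) v i - cell G (side S) w i| : ℤ) : ℝ) < ((2 + 1 : ℤ) : ℝ) := by
      push_cast at h2 ⊢; linarith
    exact Int.le_of_lt_add_one (Int.cast_lt.1 this)
  have h0 := abs_le.1 (key 0)
  have h1 := abs_le.1 (key 1)
  simp only [cell, side] at h0 h1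
  simp only [box, Finset.mem_product, Finset.mem_Icc]
  omega

theorem BoxAdj.symm {q q' : ℤ × ℤ} (h : BoxAdj S G q q') : BoxAdj S G q' q := by
  obtain ⟨e, h1, h2, h3⟩ := h
  exact ⟨(e.2, e.1), h1.symm, h3, h2⟩

open Classical in
/-- A leader of every nonempty box, and the end points of one edge between any two boxes that are
joined by an edge. -/
theorem exists_leaders_and_connectors : ∃ H : Finset (Fin n),
    (∀ v, ∃ u ∈ H, box S G u = box S G v) ∧
    (∀ v w, (commGraph S G).Adj v w → ∃ a ∈ H, ∃ b ∈ H, (commGraph S G).Adj a b ∧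
      box S G a = box S G v ∧ box S G b = box S G w) ∧
    ∀ q, (H.filter fun v => box S G v = q).card ≤ 51 := by
  let ld : ℤ × ℤ → Option (Fin n) := fun q =>
    if h : ∃ u, box S G u = q then some h.choose else none
  -- `fr` and `en` return the two ends of the same chosen edge.
  let fr : ℤ × ℤ → ℤ × ℤ → Option (Fin n) := fun q q' =>
    if h : BoxAdj S G q q' then some h.choose.1 else none
  let en : ℤ × ℤ → ℤ × ℤ → Option (Fin n) := fun q q' =>
    if h : BoxAdj S G q q' then some h.choose.2 else none
  refine ⟨Finset.univ.filter fun v => ld (box S G v) = some v ∨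
    (∃ q, fr (box S G v) q = some v) ∨ ∃ q, en q (box S G v) = some v, ?_, ?_, ?_⟩
  · intro v
    have h : ∃ u, box S G u = box S G v := ⟨v, rfl⟩
    refine ⟨h.choose, ?_, h.choose_spec⟩
    simp only [Finset.mem_filter, Finset.mem_univ, true_and]
    left
    rw [h.choose_spec]
    exact dif_pos h
  · intro v w hvw
    have h : BoxAdj S G (box S G v) (box S G w) := ⟨(v, w), hvw, rfl, rfl⟩
    obtain ⟨h1, h2, h3⟩ := h.choose_spec
    refine ⟨h.choose.1, ?_, h.choose.2, ?_, h1, h2, h3⟩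
    · simp only [Finset.mem_filter, Finset.mem_univ, true_and]
      right; left
      rw [h2]
      exact ⟨_, dif_pos h⟩
    · simp only [Finset.mem_filter, Finset.mem_univ, true_and]
      right; right
      rw [h3]
      exact ⟨_, dif_pos h⟩
  · intro q
    set N := Finset.Icc (q.1 - 2) (q.1 + 2) ×ˢ Finset.Icc (q.2 - 2) (q.2 + 2) with hN
    have hNc : N.card = 25 := by
      rw [hN, Finset.card_product, Int.card_Icc, Int.card_Icc]
      have : ∀ z : ℤ, (z + 2 + 1 - (z - 2)).toNat = 5 := by intro z; omega
      rw [this, this]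
    -- The members in `q` are its leader and the ends in `q` of the chosen edges from or to the 25
    -- boxes around it: 51 = 1 + 25 + 25.
    have hsub : ((Finset.univ.filter fun v => ld (box S G v) = some v ∨
        (∃ q, fr (box S G v) q = some v) ∨ ∃ q, en q (box S G v) = some v).filter
          fun v => box S G v = q).image some ⊆
        {ld q} ∪ (N.image (fr q) ∪ N.image fun z => en z q) := by
      intro o ho
      obtain ⟨v, hv, rfl⟩ := Finset.mem_image.1 ho
      simp only [Finset.mem_filter, Finset.mem_univ, true_and] at hv
      obtain ⟨hv, rfl⟩ := hv
      rcases hv with hv | ⟨z, hv⟩ | ⟨z, hv⟩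
      · exact Finset.mem_union_left _ (Finset.mem_singleton.2 hv.symm)
      · refine Finset.mem_union_right _ (Finset.mem_union_left _ (Finset.mem_image.2 ⟨z, ?_, hv⟩))
        by_cases h : BoxAdj S G (box S G v) z
        · exact h.mem_Icc
        · simp [fr, h] at hv
      · refine Finset.mem_union_right _ (Finset.mem_union_right _ (Finset.mem_image.2 ⟨z, ?_, hv⟩))
        by_cases h : BoxAdj S G z (box S G v)
        · exact (BoxAdj.symm S G h).mem_Icc
        · simp [en, h] at hv
    rw [← Finset.card_image_of_injective _ (Option.some_injective (Fin n))]
    refine (Finset.card_le_card hsub).trans ((Finset.card_union_le _ _).trans ?_)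
    have h1 := Finset.card_union_le (N.image (fr q)) (N.image fun z => en z q)
    have h2 := Finset.card_image_le (s := N) (f := fr q)
    have h3 := Finset.card_image_le (s := N) (f := fun z => en z q)
    rw [Finset.card_singleton]
    omega

/-- The walk is imitated box by box. For every edge, one step inside the box reaches the end of the
chosen edge between the two boxes, which is then crossed; a last step inside the final box reaches
`y`. -/
theorem exists_walk_in_backbone {H : Finset (Fin n)}
    (hH : ∀ v w, (commGraph S G).Adj v w → ∃ a ∈ H, ∃ b ∈ H, (commGraph S G).Adj a b ∧
      box S G a = box S G v ∧ box S G b = box S G w)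
    {v w : Fin n} (p : (commGraph S G).Walk v w) :
    ∀ x y : (H : Set (Fin n)), box S G x = box S G v → box S G y = box S G w →
      ∃ q : ((commGraph S G).induce (H : Set (Fin n))).Walk x y, q.length ≤ 3 * p.length + 1 := by
  have hsame : ∀ x y : (H : Set (Fin n)), box S G x = box S G y →
      ∃ q : ((commGraph S G).induce (H : Set (Fin n))).Walk x y, q.length ≤ 1 := by
    intro x y h
    by_cases hxy : x = y
    · subst hxy
      exact ⟨.nil, by simp⟩
    · have hadj : ((commGraph S G).induce (H : Set (Fin n))).Adj x y :=
        ⟨fun e => hxy (Subtype.ext e), (dist_lt_of_box_eq S G h).le⟩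
      exact ⟨.cons hadj .nil, by simp⟩
  induction p with
  | nil =>
    intro x y hx hy
    obtain ⟨q, hq⟩ := hsame x y (hx.trans hy.symm)
    exact ⟨q, by simpa using hq⟩
  | cons hadj p ih =>
    intro x y hx hy
    obtain ⟨a, ha, b, hb, hab, hav, hbw⟩ := hH _ _ hadj
    obtain ⟨q1, hq1⟩ := hsame x ⟨a, ha⟩ (hx.trans hav.symm)
    obtain ⟨q2, hq2⟩ := ih ⟨b, hb⟩ y hbw hy
    have hab' : ((commGraph S G).induce (H : Set (Fin n))).Adj ⟨a, ha⟩ ⟨b, hb⟩ := hab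
    refine ⟨q1.append (.cons hab' q2), ?_⟩
    simp only [SimpleGraph.Walk.length_append, SimpleGraph.Walk.length_cons]
    omega

/-- The slot of a member is the color of its box together with its index among the at most 51
members there. Members with a common slot thus lie in different boxes of one color. -/
theorem exists_backbone : ∃ c : ℕ, 0 < c ∧ ∀ (n : ℕ) (G : Network n),
    (commGraph S G).Connected → ∃ H, IsBackbone S G c H := by
  classical
  obtain ⟨C, hC0, hC⟩ := exists_box_coloring S
  refine ⟨C * 51, by positivity, fun n G hconn => ?_⟩
  obtain ⟨H, hlead, hedge, hcard⟩ := exists_leaders_and_connectors S G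
  obtain ⟨col, -, hcol, hrec⟩ := hC n G
  obtain ⟨idx, hidx⟩ := exists_index_in_class (box S G) H 51 (by norm_num)
    (fun q => by convert hcard q)
  have hn := hconn.nonempty
  have hwalk := fun (x y : (H : Set (Fin n))) =>
    exists_walk_in_backbone S G hedge (hconn.exists_walk_length_eq_dist x y).choose x y rfl rfl
  have hHne : Nonempty (H : Set (Fin n)) := by
    obtain ⟨u, hu, -⟩ := hlead (Classical.arbitrary _)
    exact ⟨⟨u, hu⟩⟩
  refine ⟨H, ?_, ?_, ?_, hlead, fun q => (by convert hcard q : _ ≤ 51).trans (by omega), ?_⟩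
  · intro v
    obtain ⟨u, hu, hb⟩ := hlead v
    by_cases huv : u = v
    · exact Or.inl (huv ▸ hu)
    · exact Or.inr ⟨u, hu, huv, (dist_lt_of_box_eq S G hb).le⟩
  · exact { preconnected := fun x y => (hwalk x y).choose.reachable, nonempty := hHne }
  · obtain ⟨x, y, hxy⟩ :=
      ((commGraph S G).induce (H : Set (Fin n))).exists_dist_eq_diam
    rw [← hxy]
    have htop : (commGraph S G).ediam ≠ ⊤ := SimpleGraph.connected_iff_ediam_ne_top.1 hconn
    obtain ⟨q, hq⟩ := hwalk x y
    rw [(hconn.exists_walk_length_eq_dist x y).choose_spec] at hq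
    have h1 := SimpleGraph.dist_le q
    have h2 := SimpleGraph.dist_le_diam htop (u := (x : Fin n)) (v := y)
    -- The bound 3 D + 1 is a multiple of D only if D > 0; diameter 0 means a single station.
    rcases Nat.eq_zero_or_pos (commGraph S G).diam with h0 | h0
    · have hsub : Subsingleton (Fin n) :=
        (SimpleGraph.diam_eq_zero.1 h0).resolve_left htop
      have : x = y := Subtype.ext (Subsingleton.elim _ _)
      simp [this]
    · nlinarith
  · refine ⟨fun v => finProdFinEquiv (col v, idx v), ?_⟩
    intro T hT hslot v hv u hadj
    have hsl : ∀ a ∈ T, ∀ b ∈ T, a ≠ b → col a = col b ∧ box S G a ≠ box S G b := by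
      intro a ha b hb hab
      have h := Prod.mk.inj (finProdFinEquiv.injective (hslot a ha b hb))
      exact ⟨h.1, fun hbox => hab (hidx a (hT ha) b (hT hb) hbox h.2)⟩
    refine hrec T v u hv ?_ hadj.2 hsl
    -- A neighbor of `v` does not transmit itself: transmitters in different boxes of one color are
    -- farther apart than the range.
    intro hu
    obtain ⟨h1, h2⟩ := hsl v hv u hu hadj.1
    exact absurd (hcol v u h1 h2) (not_lt.2 hadj.2)

theorem IsBackbone.mono {c c' : ℕ} {H : Finset (Fin n)} (h : IsBackbone S G c H) (hc : c ≤ c') :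
    IsBackbone S G c' H where
  dominating := h.dominating
  connected := h.connected
  diam_le := h.diam_le.trans (Nat.mul_le_mul_right _ hc)
  leader := h.leader
  card_box_le q := (h.card_box_le q).trans hc
  schedule := by
    obtain ⟨slot, hs⟩ := h.schedule
    refine ⟨fun v => Fin.castLE hc (slot v), fun T hT he => hs T hT fun v hv w hw => ?_⟩
    exact Fin.castLE_injective hc (he v hv w hw)

end Backbone

/-! ### The protocol as a state machine. -/

/-- The control information of a message: its sender, the time modulo `Q`, an addressee, and the
first station of the sender's list. -/
abbrev Payload (n Q : ℕ) : Type := Fin n × Fin Q × Option (Fin n) × Fin n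

/-- The data shared by the stations of a network: a schedule `sel` of `L` rounds for elections,
a coloring `col` of the boxes, a backbone `H` with its transmission slots, the number `k` of
rumors, and a binary encoding of the control information. -/
structure Plan (n b : ℕ) where
  L : ℕ
  sel : ℕ → Finset (Fin n)
  C : ℕ
  col : Fin n → Fin C
  H : Finset (Fin n)
  c : ℕ
  slot : Fin n → Fin c
  k : ℕ
  enc : Payload n (2 * c) → Fin b → Bool
  dec : (Fin b → Bool) → Payload n (2 * c)
  dec_enc : ∀ p, dec (enc p) = p

/-- The state of a station in the collection of the rumors of each box. Sources that have been
eliminated point to the `next` station of a list; an `active` source is the last station of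
its list, whose `first` station it knows. -/
structure GState (n : ℕ) where
  active : Bool
  heard : Finset (Fin n)
  mate : Option (Fin n × Fin n)
  first : Fin n
  next : Option (Fin n)
  token : Bool
  spoken : ℕ

/-- The state of a station. -/
structure State (n : ℕ) (R : Type) where
  clock : Option ℕ
  held : Finset R
  flooded : Finset R
  g : GState n

noncomputable section Machine

open scoped Classical

variable {n b : ℕ} {R : Type} (S : Params) (G : Network n) (π : Plan n b)

/-- The number of rounds of an iteration of the election. -/
def Plan.len : ℕ := 2 * π.L + 1

/-- The number of rounds of the election. -/
def Plan.electionEnd : ℕ := π.k * π.len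

/-- The station of `X` nearest to `v`, ties being broken by the index. -/
def best (v : Fin n) (X : Finset (Fin n)) : Option (Fin n) :=
  if h : X.Nonempty then
    some (Finset.exists_min_image X
      (fun w => toLex (dist (G.pos v) (G.pos w), w)) h).choose
  else none

/-- The initial state of the collection. -/
def ginit (v : Fin n) (own : Finset R) : GState n where
  active := decide own.Nonempty
  heard := ∅
  mate := none
  first := v
  next := none
  token := false
  spoken := 0

/-- The end of an iteration of the election: of two mates, the one with the greater index is
eliminated, and its list is put in front of the list of the other one. -/
def settle (v : Fin n) (g : GState n) : GState n :=
  match g.mate with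
  | none => { g with heard := ∅, mate := none }
  | some (w, f) =>
    if w < v then { g with active := false, next := some f, heard := ∅, mate := none }
    else { g with first := f, heard := ∅, mate := none }

/-- What a station transmits in round `τ` of the collection: an addressee, a station, and possibly
a rumor. -/
def gout (v : Fin n) (own : Finset R) (τ : ℕ) (g : GState n) :
    Option ((Option (Fin n) × Fin n) × Option R) :=
  if ¬ own.Nonempty then none
  else if τ < π.electionEnd then
    -- An iteration runs the schedule twice, to be heard and then to announce the choice. Its last
    -- round, of residue 2 L, is silent and serves for `settle`.
    if τ % π.len < 2 * π.L ∧ g.active = true ∧ v ∈ π.sel (τ % π.len % π.L) then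
      some ((if τ % π.len < π.L then none else best G v g.heard, g.first), none)
    else none
  else if (τ - π.electionEnd) % π.C = π.col v then
    -- In the first C rounds after the election the last station of each list hands the token to the
    -- first one. Later the owner of the token speaks, and names its successor along with its last
    -- rumor.
    if τ - π.electionEnd < π.C then
      if g.active = true then some ((some g.first, v), none) else none
    else if g.token = true then
      some ((if g.spoken + 1 < own.card then none else g.next, v), own.toList[g.spoken]?)
    else none
  else none

/-- The change of state in round `τ` of the collection. -/
def gstep (v : Fin n) (own : Finset R) (τ : ℕ) (g : GState n)
    (m : Option (Fin n × Option (Fin n) × Fin n)) : GState n :=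
  if τ < π.electionEnd then
    if τ % π.len = 2 * π.L then settle v g
    else match m with
      | none => g
      | some (w, tgt, f) =>
        if g.active = true ∧ box S G w = box S G v then
          if τ % π.len < π.L then { g with heard := insert w g.heard }
          else if tgt = some v ∧ best G v g.heard = some w then { g with mate := some (w, f) }
          else g
        else g
  else match m with
    | some (w, tgt, _) =>
      if tgt = some v ∧ box S G w = box S G v then { g with token := true } else g
    -- A transmitter receives nothing, so here a station accounts for its own transmission; for a
    -- source, the tests below hold exactly if it has transmitted.
    | none =>
      if (τ - π.electionEnd) % π.C = π.col v then
        if τ - π.electionEnd < π.C then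
          if g.active = true then { g with token := decide (g.first = v) } else g
        else if g.token = true then
          { g with spoken := g.spoken + 1, token := decide (g.spoken + 1 < own.card) }
        else g
      else g

variable (own : Fin n → Finset R)

/-- The stations that transmit in round `τ` of the collection. -/
def gtrans (τ : ℕ) (x : Fin n → GState n) : Finset (Fin n) :=
  Finset.univ.filter fun v => gout G π v (own v) τ (x v) ≠ none

/-- The control information received in round `τ` of the collection. -/
def grecv (τ : ℕ) (x : Fin n → GState n) (u : Fin n) : Option (Fin n × Option (Fin n) × Fin n) :=
  if h : ∃ v, Receives S G (gtrans G π own τ x) v u then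
    (gout G π h.choose (own h.choose) τ (x h.choose)).map fun o => (h.choose, o.1)
  else none

/-- The execution of the collection. -/
def gstate : ℕ → Fin n → GState n
  | 0 => fun v => ginit v (own v)
  | τ + 1 => fun u => gstep S G π u (own u) τ (gstate τ u) (grecv S G π own τ (gstate τ) u)

/-- A rumor that is held and has not been flooded yet. -/
def pick (s : State n R) : Option R :=
  if h : (s.held \ s.flooded).Nonempty then some h.choose else none

/-- The time modulo the period. -/
def Plan.tag (v : Fin n) (t : ℕ) : Fin (2 * π.c) :=
  ⟨t % (2 * π.c), Nat.mod_lt _ (by have := (π.slot v).pos; omega)⟩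

/-- The initial state of a station. -/
def sinit (v : Fin n) (own : Finset R) : State n R where
  clock := if own.Nonempty then some 0 else none
  held := own
  flooded := ∅
  g := ginit v own

/-- What a station transmits. Even rounds belong to the collection, and in odd rounds the
backbone floods the rumors. -/
def out (v : Fin n) (own : Finset R) (s : State n R) :
    Option (Payload n (2 * π.c) × Option R) :=
  match s.clock with
  | none => none
  | some t =>
    if t % 2 = 0 then
      (gout G π v own (t / 2) s.g).map fun o => ((v, π.tag v t, o.1), o.2)
    else if v ∈ π.H ∧ t % (2 * π.c) = 2 * π.slot v + 1 then
      (pick s).map fun ρ => ((v, π.tag v t, none, v), some ρ)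
    else none

/-- The rumor contained in a message. -/
def rumorOf {X : Type} (m : Option (X × Option R)) : Finset R := (m.bind Prod.snd).toFinset

/-- The change of state of a station in a round. -/
def step (v : Fin n) (own : Finset R) (s : State n R)
    (m : Option (Payload n (2 * π.c) × Option R)) : State n R :=
  match s.clock with
  | none =>
    match m with
    | none => s
    -- The station that wakes up learns the time only modulo the period.
    | some p => { s with clock := some (p.1.2.1 + 1), held := s.held ∪ rumorOf (some p) }
  | some t =>
    { clock := some (t + 1)
      held := s.held ∪ rumorOf m
      -- Rumors spoken in even rounds do not count as flooded, since such messages need not reach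
      -- all neighbors.
      flooded := if t % 2 = 1 then s.flooded ∪ rumorOf (out G π v own s) else s.flooded
      g := if t % 2 = 0 then gstep S G π v own (t / 2) s.g (m.map fun p => (p.1.1, p.1.2.2))
        else s.g }

/-- The stations that transmit when the states are `x`. -/
def ctrans (x : Fin n → State n R) : Finset (Fin n) :=
  Finset.univ.filter fun v => out G π v (own v) (x v) ≠ none

/-- What is received when the states are `x`. -/
def crecv (x : Fin n → State n R) (u : Fin n) : Option (Payload n (2 * π.c) × Option R) :=
  if h : ∃ v, Receives S G (ctrans G π own x) v u then
    out G π h.choose (own h.choose) (x h.choose)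
  else none

/-- The states of the stations after `t` rounds. -/
def conf : ℕ → Fin n → State n R
  | 0 => fun v => sinit v (own v)
  | t + 1 => fun u => step S G π u (own u) (conf t u) (crecv S G π own (conf t) u)

/-- The message that carries given control information and a given rumor. -/
def encode (p : Payload n (2 * π.c) × Option R) : Message R b := ⟨p.2, π.enc p.1⟩

/-- The contents of a message. -/
def decode (m : Message R b) : Payload n (2 * π.c) × Option R := (π.dec m.control, m.rumor)

theorem decode_encode (p : Payload n (2 * π.c) × Option R) : decode π (encode π p) = p := by
  simp [decode, encode, π.dec_enc]

/-- The state of a station with given observations. -/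
def localState (v : Fin n) (own : Finset R) (h : History R b) : State n R :=
  h.foldl (fun s m => step S G π v own s (m.map (decode π))) (sinit v own)

theorem localState_append (v : Fin n) (own : Finset R) (h : History R b)
    (m : Option (Message R b)) : localState S G π v own (h ++ [m]) =
      step S G π v own (localState S G π v own h) (m.map (decode π)) := by
  simp [localState]

theorem mem_rumorOf {X : Type} {m : Option (X × Option R)} {ρ : R} :
    ρ ∈ rumorOf m ↔ ∃ p, m = some p ∧ p.2 = some ρ := by
  simp [rumorOf, Option.bind_eq_some_iff]

theorem held_step (v : Fin n) (own : Finset R) (s : State n R)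
    (m : Option (Payload n (2 * π.c) × Option R)) :
    (step S G π v own s m).held = s.held ∪ rumorOf m := by
  unfold step
  rcases s.clock with _ | t
  · cases m <;> simp [rumorOf]
  · rfl

theorem holds_of_mem_held (v : Fin n) (own : Finset R) (h : History R b) {ρ : R}
    (hρ : ρ ∈ (localState S G π v own h).held) : Holds own h ρ := by
  induction h using List.reverseRecOn with
  | nil => exact Or.inl hρ
  | append_singleton h m ih =>
    rw [localState_append, held_step, Finset.mem_union] at hρ
    rcases hρ with hρ | hρ
    · rcases ih hρ with h1 | ⟨m', hm', h1⟩
      · exact Or.inl h1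
      · exact Or.inr ⟨m', List.mem_append_left _ hm', h1⟩
    · obtain ⟨p, hp, h1⟩ := mem_rumorOf.1 hρ
      obtain ⟨m', rfl, rfl⟩ := Option.map_eq_some_iff.1 hp
      exact Or.inr ⟨m', by simp, h1⟩

theorem mem_of_gout {v : Fin n} {own : Finset R} {τ : ℕ} {g : GState n}
    {o : (Option (Fin n) × Fin n) × Option R} {ρ : R} (h : gout G π v own τ g = some o)
    (hρ : o.2 = some ρ) : ρ ∈ own := by
  unfold gout at h
  split_ifs at h <;> simp only [Option.some.injEq] at h <;> subst h <;> simp only at hρ <;>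
    first
    | exact Finset.mem_toList.1 (List.mem_of_getElem? hρ)
    | exact absurd hρ (by simp)

theorem mem_of_pick {s : State n R} {ρ : R} (h : pick s = some ρ) : ρ ∈ s.held \ s.flooded := by
  unfold pick at h
  split_ifs at h with hne
  rw [← Option.some.inj h]
  exact hne.choose_spec

theorem mem_of_out {v : Fin n} {own : Finset R} {s : State n R}
    {p : Payload n (2 * π.c) × Option R} {ρ : R} (h : out G π v own s = some p)
    (hρ : p.2 = some ρ) : ρ ∈ own ∪ s.held := by
  unfold out at h
  rcases hs : s.clock with _ | t
  · simp [hs] at h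
  · rw [hs] at h
    simp only at h
    split_ifs at h
    · obtain ⟨o, ho, rfl⟩ := Option.map_eq_some_iff.1 h
      exact Finset.mem_union_left _ (mem_of_gout G π ho hρ)
    · obtain ⟨ρ', hp, rfl⟩ := Option.map_eq_some_iff.1 h
      obtain rfl : ρ' = ρ := Option.some.inj hρ
      exact Finset.mem_union_right _ (Finset.mem_sdiff.1 (mem_of_pick hp)).1

/-- The protocol that carries out a plan. -/
def planProtocol (R : Type) : Protocol n R b where
  transmit v own h := (out G π v own (localState S G π v own h)).map (encode π)
  transmit_holds := by
    intro v own h m ρ hm hρ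
    obtain ⟨p, hp, rfl⟩ := Option.map_eq_some_iff.1 hm
    rcases Finset.mem_union.1 (mem_of_out G π hp hρ) with h1 | h1
    · exact Or.inl h1
    · exact holds_of_mem_held S G π v own h h1
  inBackbone v _ _ := decide (v ∈ π.H)

theorem out_eq_none_of_clock {v : Fin n} {own : Finset R} {s : State n R} (h : s.clock = none) :
    out G π v own s = none := by
  simp [out, h]

/-- This transfers statements about the state machine to the model. `decode` undoes `encode`, so a
station can recompute its state from its history, and a sleeping station stays in its initial state
while its history is empty. -/
theorem histories_eq_conf (t : ℕ) (v : Fin n) :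
    localState S G π v (own v) (histories S G (planProtocol S G π R) own t v) =
      conf S G π own t v ∧
    (Awake own (histories S G (planProtocol S G π R) own t) v ↔
      (conf S G π own t v).clock ≠ none) := by
  induction t generalizing v with
  | zero =>
    refine ⟨rfl, ?_⟩
    simp only [Awake, histories, conf, sinit]
    split_ifs with h <;> simp [h]
  | succ t ih =>
    set h := histories S G (planProtocol S G π R) own t with hh
    have hsent : ∀ w, sent (planProtocol S G π R) own h w =
        (out G π w (own w) (conf S G π own t w)).map (encode π) := by
      intro w
      unfold sent
      split_ifs with ha
      · simp only [planProtocol, (ih w).1]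
      · have : (conf S G π own t w).clock = none := by
          by_contra hc
          exact ha ((ih w).2.2 hc)
        rw [out_eq_none_of_clock G π this]; rfl
    have htr : transmitters (planProtocol S G π R) own h =
        ctrans G π own (conf S G π own t) := by
      ext w
      simp [transmitters, ctrans, hsent]
    have hrc : received S G (planProtocol S G π R) own h v =
        (crecv S G π own (conf S G π own t) v).map (encode π) := by
      unfold received crecv
      rw [htr]
      split_ifs
      · rw [hsent]
      · rfl
    have hdec : ((crecv S G π own (conf S G π own t) v).map (encode π)).map (decode π) =
        crecv S G π own (conf S G π own t) v := by
      rw [Option.map_map]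
      convert Option.map_id' using 2
      exact funext fun p => decode_encode π p
    have hstep : histories S G (planProtocol S G π R) own (t + 1) v =
        if Awake own h v ∨ received S G (planProtocol S G π R) own h v ≠ none then
          h v ++ [received S G (planProtocol S G π R) own h v] else [] := rfl
    have hconf : conf S G π own (t + 1) v = step S G π v (own v) (conf S G π own t v)
        (crecv S G π own (conf S G π own t) v) := rfl
    unfold Awake
    rw [hstep, hconf]
    by_cases hc : Awake own h v ∨ received S G (planProtocol S G π R) own h v ≠ none
    · rw [if_pos hc, localState_append, (ih v).1, hrc, hdec]
      refine ⟨rfl, iff_of_true (Or.inr (by simp)) ?_⟩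
      rw [(ih v).2, hrc] at hc
      unfold step
      rcases hs : (conf S G π own t v).clock with _ | t'
      · rcases hr : crecv S G π own (conf S G π own t) v with _ | p
        · simp [hs, hr] at hc
        · simp
      · simp
    · rw [if_neg hc]
      rw [not_or, not_not] at hc
      have hnil : ¬ (own v).Nonempty ∧ h v = [] := by
        have := hc.1
        unfold Awake at this
        rw [not_or, not_not] at this
        exact this
      have hcl : (conf S G π own t v).clock = none := by
        by_contra hcl
        exact hc.1 ((ih v).2.2 hcl)
      have hr : crecv S G π own (conf S G π own t) v = none := by
        rw [hrc] at hc
        exact Option.map_eq_none_iff.1 hc.2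
      have hst : step S G π v (own v) (conf S G π own t v)
          (crecv S G π own (conf S G π own t) v) = conf S G π own t v := by
        rw [hr]
        simp [step, hcl]
      rw [hst, ← (ih v).1, hnil.2]
      refine ⟨rfl, iff_of_false (by simp [hnil.1]) ?_⟩
      rw [not_not]
      have := (ih v).1
      rw [hnil.2] at this
      rw [this]
      exact hcl

/-- A plan accomplishes multi-broadcast as soon as, from some time on, nobody transmits and
everybody holds all rumors. -/
theorem accomplishes_of_conf {T : ℕ} (hne : ∃ v, (own v).Nonempty)
    (h : ∀ t ≥ T, ∀ v, out G π v (own v) (conf S G π own t v) = none ∧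
      ∀ u, own u ⊆ (conf S G π own t v).held) :
    Accomplishes S G (planProtocol S G π R) own π.H T := by
  intro t ht v
  obtain ⟨h1, h2⟩ := h t ht v
  obtain ⟨h3, -⟩ := histories_eq_conf S G π own t v
  have hholds : ∀ u, ∀ ρ ∈ own u,
      Holds (own v) (histories S G (planProtocol S G π R) own t v) ρ := fun u ρ hρ =>
    holds_of_mem_held S G π v (own v) _ (h3 ▸ h2 u hρ)
  refine ⟨?_, ?_, by simp [planProtocol], hholds⟩
  -- Being awake follows from holding some rumor: either it was there in the beginning or a message
  -- has brought it.
  · obtain ⟨u, ρ, hρ⟩ := hne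
    rcases hholds u ρ hρ with h4 | ⟨m, hm, -⟩
    · exact Or.inl ⟨ρ, h4⟩
    · exact Or.inr (List.ne_nil_of_mem hm)
  · unfold sent
    split_ifs
    · change (out G π v (own v) (localState S G π v (own v)
        (histories S G (planProtocol S G π R) own t v))).map (encode π) = none
      rw [h3, h1]; rfl
    · rfl

end Machine

/-! ### Pipelining along a walk. -/

section Flooding

variable {V R : Type*}

/-- If every station that holds rumors it has not sent yet sends one of them to its neighbors in
every period, then `ρ` or `l` other rumors have been sent by a station at distance `d` from
the origin of `ρ` after `d + l` periods. -/
theorem mem_or_le_card_of_walk (Γ : SimpleGraph V) (F D : ℕ → V → Finset R)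
    (hD : ∀ i v, D i v ⊆ D (i + 1) v) (hF : ∀ i v, F i v ⊆ F (i + 1) v)
    (hadj : ∀ i u v, Γ.Adj v u → F i u ⊆ D i v)
    (hstep : ∀ i v, ¬ D i v ⊆ F i v → (F i v).card < (F (i + 1) v).card)
    {ρ : R} {v o : V} (p : Γ.Walk v o) (ho : ρ ∈ D 0 o) (l : ℕ) :
    ρ ∈ F (p.length + l) v ∨ l ≤ (F (p.length + l) v).card := by
  induction p generalizing l with
  | @nil o =>
    have hDl : ∀ i, ρ ∈ D i o := by
      intro i
      induction i with
      | zero => exact ho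
      | succ i ih => exact hD i o ih
    simp only [SimpleGraph.Walk.length_nil, Nat.zero_add]
    induction l with
    | zero => exact Or.inr (Nat.zero_le _)
    | succ l ih =>
      by_cases h : ρ ∈ F l o
      · exact Or.inl (hF l o h)
      · have := hstep l o fun hs => h (hs (hDl l))
        have := ih.resolve_left h
        exact Or.inr (by omega)
  | @cons v u o hvu p ih =>
    simp only [SimpleGraph.Walk.length_cons]
    induction l with
    | zero => exact Or.inr (Nat.zero_le _)
    | succ l ih2 =>
      -- `u` is one step closer to the origin, so the claim for `u` with l + 1 refers to the same
      -- period as the claim for `v` with l.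
      have ih1 := ih ho (l + 1)
      rw [show p.length + 1 + (l + 1) = p.length + 1 + l + 1 by omega]
      rw [show p.length + (l + 1) = p.length + 1 + l by omega] at ih1
      set i := p.length + 1 + l
      by_cases h : ρ ∈ F i v
      · exact Or.inl (hF i v h)
      · have hl := ih2.resolve_left h
        by_cases hc : l + 1 ≤ (F i v).card
        · exact Or.inr (hc.trans (Finset.card_le_card (hF i v)))
        · have := hstep i v fun hs => by
            rcases ih1 with h1 | h1
            · exact h (hs (hadj i u v hvu h1))
            · exact hc (h1.trans (Finset.card_le_card ((hadj i u v hvu).trans hs)))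
          exact Or.inr (by omega)

end Flooding

/-! ### Separation of the odd and the even rounds. -/

section Rounds

open scoped Classical

variable {n b : ℕ} {R : Type} (S : Params) (G : Network n) (π : Plan n b) (own : Fin n → Finset R)

theorem conf_succ (t : ℕ) (u : Fin n) : conf S G π own (t + 1) u =
    step S G π u (own u) (conf S G π own t u) (crecv S G π own (conf S G π own t) u) := rfl

theorem gstate_succ (τ : ℕ) (u : Fin n) : gstate S G π own (τ + 1) u =
    gstep S G π u (own u) τ (gstate S G π own τ u)
      (grecv S G π own τ (gstate S G π own τ) u) := rfl

theorem mem_ctrans {x : Fin n → State n R} {v : Fin n} :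
    v ∈ ctrans G π own x ↔ out G π v (own v) (x v) ≠ none := by
  simp [ctrans]

theorem crecv_eq {x : Fin n → State n R} {v u : Fin n}
    (h : Receives S G (ctrans G π own x) v u) :
    crecv S G π own x u = out G π v (own v) (x v) := by
  have hex : ∃ v, Receives S G (ctrans G π own x) v u := ⟨v, h⟩
  rw [crecv, dif_pos hex, Receives.unique S G hex.choose_spec h]

theorem exists_out_of_crecv {x : Fin n → State n R} {u : Fin n}
    {p : Payload n (2 * π.c) × Option R} (h : crecv S G π own x u = some p) :
    ∃ v, out G π v (own v) (x v) = some p := by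
  unfold crecv at h
  split_ifs at h
  exact ⟨_, h⟩

theorem tag_of_out {v : Fin n} {own : Finset R} {s : State n R}
    {p : Payload n (2 * π.c) × Option R} (h : out G π v own s = some p) :
    ∃ t, s.clock = some t ∧ (p.1.2.1 : ℕ) = t % (2 * π.c) := by
  unfold out at h
  rcases hs : s.clock with _ | t
  · simp [hs] at h
  · rw [hs] at h
    refine ⟨t, rfl, ?_⟩
    simp only at h
    split_ifs at h
    · obtain ⟨o, -, rfl⟩ := Option.map_eq_some_iff.1 h
      rfl
    · obtain ⟨o, -, rfl⟩ := Option.map_eq_some_iff.1 h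
      rfl

/-- Sources start simultaneously, and this makes the collection synchronous without a global clock.
-/
theorem clock_of_nonempty (t : ℕ) {v : Fin n} (hv : (own v).Nonempty) :
    (conf S G π own t v).clock = some t := by
  induction t with
  | zero => simp [conf, sinit, hv]
  | succ t ih => rw [conf_succ]; unfold step; simp [ih]

/-- The tag of the message that wakes a station is the sender's time modulo the period, which is
correct by induction. This suffices for parity and slots. -/
theorem clock_modEq (t : ℕ) {v : Fin n} {t' : ℕ} (h : (conf S G π own t v).clock = some t') :
    t' ≡ t [MOD 2 * π.c] := by
  induction t generalizing v t' with
  | zero =>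
    simp only [conf, sinit] at h
    split_ifs at h
    rw [← Option.some.inj h]
  | succ t ih =>
    rw [conf_succ] at h
    unfold step at h
    rcases hs : (conf S G π own t v).clock with _ | t''
    · rcases hr : crecv S G π own (conf S G π own t) v with _ | p
      · simp [hs, hr] at h
      · simp only [hs, hr, Option.some.injEq] at h
        obtain ⟨w, hw⟩ := exists_out_of_crecv S G π own hr
        obtain ⟨t1, h1, h2⟩ := tag_of_out G π hw
        rw [← h, h2]
        exact Nat.ModEq.add_right 1 ((Nat.mod_modEq _ _).trans (ih h1))
    · simp only [hs, Option.some.injEq] at h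
      rw [← h]
      exact Nat.ModEq.add_right 1 (ih hs)

theorem clock_mod_two (t : ℕ) {v : Fin n} {t' : ℕ} (h : (conf S G π own t v).clock = some t') :
    t' % 2 = t % 2 :=
  (clock_modEq S G π own t h).of_mul_right π.c

/-- Used to see that a station with something left to flood is awake. -/
theorem held_eq_empty_of_clock (t : ℕ) {v : Fin n} (h : (conf S G π own t v).clock = none) :
    (conf S G π own t v).held = ∅ := by
  induction t with
  | zero =>
    simp only [conf, sinit] at h ⊢
    split_ifs at h with hv
    exact Finset.not_nonempty_iff_eq_empty.1 hv
  | succ t ih =>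
    rw [conf_succ] at h ⊢
    unfold step at h ⊢
    rcases hs : (conf S G π own t v).clock with _ | t''
    · rcases hr : crecv S G π own (conf S G π own t) v with _ | p
      · exact ih hs
      · simp [hs, hr] at h
    · simp [hs] at h

theorem held_succ (t : ℕ) (v : Fin n) : (conf S G π own (t + 1) v).held =
    (conf S G π own t v).held ∪ rumorOf (crecv S G π own (conf S G π own t) v) := by
  rw [conf_succ, held_step]

theorem flooded_succ (t : ℕ) (v : Fin n) : (conf S G π own (t + 1) v).flooded =
    if t % 2 = 1 then (conf S G π own t v).flooded ∪
      rumorOf (out G π v (own v) (conf S G π own t v)) else (conf S G π own t v).flooded := by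
  rw [conf_succ]
  unfold step
  rcases hs : (conf S G π own t v).clock with _ | t'
  · rw [out_eq_none_of_clock G π hs]
    cases crecv S G π own (conf S G π own t) v <;> simp [rumorOf]
  · simp only [clock_mod_two S G π own t hs]

theorem held_mono (v : Fin n) : Monotone fun t => (conf S G π own t v).held :=
  monotone_nat_of_le_succ fun t => by
    simp only [held_succ]; exact Finset.subset_union_left

theorem flooded_mono (v : Fin n) : Monotone fun t => (conf S G π own t v).flooded :=
  monotone_nat_of_le_succ fun t => by
    simp only [flooded_succ]
    split_ifs
    · exact Finset.subset_union_left
    · exact le_rfl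

theorem own_subset_held (t : ℕ) (v : Fin n) : own v ⊆ (conf S G π own t v).held :=
  held_mono S G π own v (Nat.zero_le t)

theorem rumorOf_out_subset (t : ℕ) (v : Fin n) :
    rumorOf (out G π v (own v) (conf S G π own t v)) ⊆ (conf S G π own t v).held := by
  intro ρ hρ
  obtain ⟨p, hp, h⟩ := mem_rumorOf.1 hρ
  rcases Finset.mem_union.1 (mem_of_out G π hp h) with h1 | h1
  · exact own_subset_held S G π own t v h1
  · exact h1

theorem flooded_subset_held (t : ℕ) (v : Fin n) :
    (conf S G π own t v).flooded ⊆ (conf S G π own t v).held := by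
  induction t with
  | zero => exact Finset.empty_subset _
  | succ t ih =>
    rw [flooded_succ, held_succ]
    split_ifs
    · exact Finset.union_subset (ih.trans Finset.subset_union_left)
        ((rumorOf_out_subset S G π own t v).trans Finset.subset_union_left)
    · exact ih.trans Finset.subset_union_left

theorem held_subset (t : ℕ) (v : Fin n) :
    (conf S G π own t v).held ⊆ Finset.univ.biUnion own := by
  induction t generalizing v with
  | zero => exact Finset.subset_biUnion_of_mem own (Finset.mem_univ v)
  | succ t ih =>
    rw [held_succ]
    refine Finset.union_subset (ih v) fun ρ hρ => ?_
    obtain ⟨p, hp, h⟩ := mem_rumorOf.1 hρ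
    obtain ⟨w, hw⟩ := exists_out_of_crecv S G π own hp
    exact ih w (rumorOf_out_subset S G π own t w (mem_rumorOf.2 ⟨p, hw, h⟩))

theorem subset_held_of_receives {t : ℕ} {v u : Fin n}
    (h : Receives S G (ctrans G π own (conf S G π own t)) v u) :
    rumorOf (out G π v (own v) (conf S G π own t v)) ⊆ (conf S G π own (t + 1) u).held := by
  rw [held_succ, crecv_eq S G π own h]
  exact Finset.subset_union_right

/-! ### Odd rounds -/

/-- In odd rounds only members of the backbone with a common slot transmit. -/
theorem slot_of_mem_ctrans {t : ℕ} (ht : t % 2 = 1) {v : Fin n}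
    (h : v ∈ ctrans G π own (conf S G π own t)) :
    v ∈ π.H ∧ t % (2 * π.c) = 2 * π.slot v + 1 := by
  rw [mem_ctrans, out] at h
  rcases hs : (conf S G π own t v).clock with _ | t'
  · simp [hs] at h
  · have h2 := clock_mod_two S G π own t hs
    rw [ht] at h2
    simp only [hs, h2, one_ne_zero, if_false] at h
    split_ifs at h with h3
    · exact ⟨h3.1, (clock_modEq S G π own t hs) ▸ h3.2⟩
    · exact absurd rfl h

/-- In odd rounds the members of the backbone flood the rumors, in their slots. -/
theorem flooded_lt_succ {t : ℕ} {v : Fin n} (hv : v ∈ π.H)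
    (ht : t % (2 * π.c) = 2 * π.slot v + 1)
    (h : ¬ (conf S G π own t v).held ⊆ (conf S G π own t v).flooded) :
    (conf S G π own t v).flooded.card < (conf S G π own (t + 1) v).flooded.card := by
  have hodd : t % 2 = 1 := by
    have := Nat.mod_mul_right_mod t 2 π.c
    omega
  obtain ⟨t', hs⟩ : ∃ t', (conf S G π own t v).clock = some t' := by
    rw [← Option.ne_none_iff_exists']
    intro hs
    exact h (by rw [held_eq_empty_of_clock S G π own t hs]; exact Finset.empty_subset _)
  have hne : ((conf S G π own t v).held \ (conf S G π own t v).flooded).Nonempty :=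
    Finset.sdiff_nonempty.2 h
  have hp : pick (conf S G π own t v) = some hne.choose := dif_pos hne
  have hmem := Finset.mem_sdiff.1 (mem_of_pick hp)
  have h2 := clock_mod_two S G π own t hs
  have h3 : t' % (2 * π.c) = 2 * π.slot v + 1 := Eq.trans
    (show t' % (2 * π.c) = t % (2 * π.c) from clock_modEq S G π own t hs) ht
  have hout : hne.choose ∈ rumorOf (out G π v (own v) (conf S G π own t v)) := by
    unfold out
    simp only [hs, h2, hodd, one_ne_zero, if_false]
    rw [if_pos ⟨hv, h3⟩, hp]
    exact mem_rumorOf.2 ⟨_, rfl, rfl⟩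
  refine Finset.card_lt_card (Finset.ssubset_iff_of_subset
    (flooded_mono S G π own v (Nat.le_succ t)) |>.2 ⟨hne.choose, ?_, hmem.2⟩)
  change _ ∈ (conf S G π own (t + 1) v).flooded
  rw [flooded_succ, if_pos hodd]
  exact Finset.mem_union_right _ hout

/-- After a waiting time e less than the period, the slot of `v` comes. If `v` has nothing left to
send by then, it has sent something in the meantime, because there was something left at time t. -/
theorem flooded_lt_period {t : ℕ} {v : Fin n} (hv : v ∈ π.H)
    (h : ¬ (conf S G π own t v).held ⊆ (conf S G π own t v).flooded) :
    (conf S G π own t v).flooded.card < (conf S G π own (t + 2 * π.c) v).flooded.card := by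
  have hsl := (π.slot v).2
  set Q := 2 * π.c with hQ
  set e := (2 * (π.slot v : ℕ) + 1 + (Q - t % Q)) % Q with he
  have hlt : t % Q < Q := Nat.mod_lt _ (by omega)
  have heQ : e < Q := Nat.mod_lt _ (by omega)
  have hte : (t + e) % Q = 2 * π.slot v + 1 := by
    rw [he, Nat.add_mod, Nat.mod_mod, ← Nat.add_mod]
    have h1 : t + (2 * (π.slot v : ℕ) + 1 + (Q - t % Q)) =
        2 * (π.slot v : ℕ) + 1 + Q * (t / Q + 1) := by
      have := Nat.div_add_mod t Q
      rw [Nat.mul_add]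
      omega
    rw [h1, Nat.add_mul_mod_self_left]
    exact Nat.mod_eq_of_lt (by omega)
  have hm := flooded_mono S G π own v
  by_cases hc : (conf S G π own (t + e) v).held ⊆ (conf S G π own (t + e) v).flooded
  · refine (Finset.card_lt_card ?_).trans_le
      (Finset.card_le_card (hm (show t + e ≤ t + Q by omega)))
    refine ⟨hm (Nat.le_add_right t e), fun hs => h ?_⟩
    exact ((held_mono S G π own v (Nat.le_add_right t e)).trans hc).trans hs
  · have h1 := flooded_lt_succ S G π own hv hte hc
    have h2 := Finset.card_le_card (hm (Nat.le_add_right t e))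
    have h3 := Finset.card_le_card (hm (show t + e + 1 ≤ t + Q by omega))
    simp only at h2 h3
    omega

/-- `flooded` grows only in odd rounds, in which all transmitters belong to one class of the
backbone; so each message reaches all neighbors of its sender. -/
theorem flooded_subset_held_of_adj (hslot : ∀ T ⊆ π.H,
    (∀ v ∈ T, ∀ w ∈ T, π.slot v = π.slot w) →
      ∀ v ∈ T, ∀ u, (commGraph S G).Adj v u → Receives S G T v u)
    (t : ℕ) {v u : Fin n} (hvu : (commGraph S G).Adj v u) :
    (conf S G π own t v).flooded ⊆ (conf S G π own t u).held := by
  induction t with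
  | zero => exact Finset.empty_subset _
  | succ t ih =>
    have hm := held_mono S G π own u (Nat.le_succ t)
    rw [flooded_succ]
    split_ifs with ht
    · refine Finset.union_subset (ih.trans hm) ?_
      by_cases hv : v ∈ ctrans G π own (conf S G π own t)
      · refine subset_held_of_receives S G π own (hslot _ ?_ ?_ v hv u hvu)
        · exact fun w hw => (slot_of_mem_ctrans S G π own ht hw).1
        · intro a ha b hb
          have h1 := (slot_of_mem_ctrans S G π own ht ha).2
          have h2 := (slot_of_mem_ctrans S G π own ht hb).2
          exact Fin.ext (by omega)
      · rw [mem_ctrans, not_not] at hv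
        rw [hv]
        simp [rumorOf]
    · exact ih.trans hm

/-- Rumors that are held by members of the backbone are flooded by all members of the backbone in
time linear in the sum of the diameter of the backbone and the number of the rumors. -/
theorem subset_flooded (hslot : ∀ T ⊆ π.H,
    (∀ v ∈ T, ∀ w ∈ T, π.slot v = π.slot w) →
      ∀ v ∈ T, ∀ u, (commGraph S G).Adj v u → Receives S G T v u)
    {d t₀ t : ℕ} (hd : ∀ v o : (π.H : Set (Fin n)),
      ∃ p : ((commGraph S G).induce (π.H : Set (Fin n))).Walk v o, p.length ≤ d)
    (horig : ∀ ρ ∈ Finset.univ.biUnion own, ∃ o ∈ π.H, ρ ∈ (conf S G π own t₀ o).held)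
    (ht : t₀ + 2 * π.c * (d + (Finset.univ.biUnion own).card) ≤ t) {v : Fin n} (hv : v ∈ π.H) :
    Finset.univ.biUnion own ⊆ (conf S G π own t v).flooded := by
  intro ρ hρ
  obtain ⟨o, ho, hρo⟩ := horig ρ hρ
  obtain ⟨p, hp⟩ := hd ⟨v, hv⟩ ⟨o, ho⟩
  have key := mem_or_le_card_of_walk ((commGraph S G).induce (π.H : Set (Fin n)))
    (fun i w => (conf S G π own (t₀ + 2 * π.c * i) w).flooded)
    (fun i w => (conf S G π own (t₀ + 2 * π.c * i) w).held)
    (fun i w => held_mono S G π own w (by rw [Nat.mul_add]; omega))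
    (fun i w => flooded_mono S G π own w (by rw [Nat.mul_add]; omega))
    (fun i u w hwu => flooded_subset_held_of_adj S G π own hslot _ hwu.symm)
    (fun i w h => by
      have := flooded_lt_period S G π own w.2 h
      rwa [show t₀ + 2 * π.c * (i + 1) = t₀ + 2 * π.c * i + 2 * π.c by ring])
    p hρo (Finset.univ.biUnion own).card
  have hle : t₀ + 2 * π.c * (p.length + (Finset.univ.biUnion own).card) ≤ t := by
    refine le_trans ?_ ht
    have := Nat.mul_le_mul_left (2 * π.c) (Nat.add_le_add_right hp (Finset.univ.biUnion own).card)
    omega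
  refine flooded_mono S G π own v hle ?_
  -- If as many rumors as there are have been flooded, then ρ is among them.
  rcases key with h | h
  · exact h
  · have := Finset.eq_of_subset_of_card_le
      ((flooded_subset_held S G π own _ v).trans (held_subset S G π own _ v)) h
    simp only at this ⊢
    rw [this]
    exact hρ

/-! ### Even rounds -/

theorem gout_eq_none {v : Fin n} {own : Finset R} {τ : ℕ} {g : GState n} (h : ¬ own.Nonempty) :
    gout G π v own τ g = none := by
  simp [gout, h]

/-- In even rounds the sources carry out the collection. -/
theorem out_even {τ : ℕ}
    (ih : ∀ v, (own v).Nonempty → (conf S G π own (2 * τ) v).g = gstate S G π own τ v) (v : Fin n) :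
    out G π v (own v) (conf S G π own (2 * τ) v) =
      (gout G π v (own v) τ (gstate S G π own τ v)).map fun o =>
        ((v, π.tag v (2 * τ), o.1), o.2) := by
  unfold out
  by_cases hv : (own v).Nonempty
  · simp [clock_of_nonempty S G π own _ hv, ih v hv]
  · rw [gout_eq_none G π hv]
    rcases hs : (conf S G π own (2 * τ) v).clock with _ | t'
    · rfl
    · have := clock_mod_two S G π own _ hs
      have h2 : t' % 2 = 0 := by omega
      simp [h2, gout_eq_none G π hv]

theorem ctrans_even {τ : ℕ}
    (ih : ∀ v, (own v).Nonempty → (conf S G π own (2 * τ) v).g = gstate S G π own τ v) :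
    ctrans G π own (conf S G π own (2 * τ)) = gtrans G π own τ (gstate S G π own τ) := by
  ext v
  rw [mem_ctrans, out_even S G π own ih]
  simp [gtrans]

/-- The collection does not depend on the flooding: in even rounds only sources transmit, and their
clocks are exact. The claim is restricted to sources because the collection state of a sleeping
station is not updated; this does no harm, as such a station never speaks in even rounds. -/
theorem g_eq_gstate (τ : ℕ) :
    ∀ v, (own v).Nonempty → (conf S G π own (2 * τ) v).g = gstate S G π own τ v := by
  induction τ with
  | zero => intro v _; rfl
  | succ τ ih =>
    intro v hv
    have h1 : (conf S G π own (2 * τ + 1) v).g = gstate S G π own (τ + 1) v := by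
      have hrec : (crecv S G π own (conf S G π own (2 * τ)) v).map (fun p => (p.1.1, p.1.2.2)) =
          grecv S G π own τ (gstate S G π own τ) v := by
        unfold crecv grecv
        rw [ctrans_even S G π own ih]
        split_ifs
        · rw [out_even S G π own ih, Option.map_map]
          rfl
        · rfl
      rw [conf_succ, gstate_succ, ← hrec, ← ih v hv]
      unfold step
      simp [clock_of_nonempty S G π own _ hv]
    rw [show 2 * (τ + 1) = 2 * τ + 1 + 1 by ring, conf_succ, ← h1]
    unfold step
    have h3 : (2 * τ + 1) % 2 = 1 := by omega
    simp [clock_of_nonempty S G π own _ hv, h3]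

/-- The rumors that are received in the collection are held. -/
theorem mem_held_of_gout {τ t : ℕ} {v u : Fin n} {o : (Option (Fin n) × Fin n) × Option R} {ρ : R}
    (h : Receives S G (gtrans G π own τ (gstate S G π own τ)) v u)
    (ho : gout G π v (own v) τ (gstate S G π own τ v) = some o) (hρ : o.2 = some ρ)
    (ht : 2 * τ + 1 ≤ t) : ρ ∈ (conf S G π own t u).held := by
  have ih := g_eq_gstate S G π own τ
  refine held_mono S G π own u ht ?_
  rw [← ctrans_even S G π own ih] at h
  refine subset_held_of_receives S G π own h ?_
  rw [out_even S G π own ih, ho]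
  exact mem_rumorOf.2 ⟨_, rfl, hρ⟩

theorem out_eq_none {t : ℕ} {v : Fin n}
    (hg : ∀ τ, t = 2 * τ → gout G π v (own v) τ (gstate S G π own τ v) = none)
    (hf : v ∈ π.H → Finset.univ.biUnion own ⊆ (conf S G π own t v).flooded) :
    out G π v (own v) (conf S G π own t v) = none := by
  rcases Nat.even_or_odd' t with ⟨τ, rfl | rfl⟩
  · rw [out_even S G π own (g_eq_gstate S G π own τ), hg τ rfl]
    rfl
  · by_contra h
    have hodd : (2 * τ + 1) % 2 = 1 := by omega
    have hv := (slot_of_mem_ctrans S G π own hodd ((mem_ctrans G π own).2 h)).1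
    unfold out at h
    rcases hs : (conf S G π own (2 * τ + 1) v).clock with _ | t'
    · simp [hs] at h
    · have h2 := clock_mod_two S G π own _ hs
      rw [hodd] at h2
      have hp : pick (conf S G π own (2 * τ + 1) v) = none := by
        refine dif_neg ?_
        rw [Finset.not_nonempty_iff_eq_empty, Finset.sdiff_eq_empty_iff_subset]
        exact (held_subset S G π own _ v).trans (hf hv)
      simp [hs, h2, hp] at h

end Rounds

/-! ### The election: mutual choices and the effect of an iteration. -/

section Election

open scoped Classical

variable {n b : ℕ} {R : Type} (S : Params) (G : Network n) (π : Plan n b) (own : Fin n → Finset R)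

theorem mem_of_best {v w : Fin n} {X : Finset (Fin n)} (h : best G v X = some w) : w ∈ X := by
  unfold best at h
  split_ifs at h with hX
  rw [← Option.some.inj h]
  exact (Finset.exists_min_image X
    (fun w => toLex (dist (G.pos v) (G.pos w), w)) hX).choose_spec.1

theorem best_eq {v w : Fin n} {X : Finset (Fin n)} (hw : w ∈ X)
    (hle : ∀ z ∈ X, dist (G.pos v) (G.pos w) ≤ dist (G.pos v) (G.pos z))
    (hidx : ∀ z ∈ X, dist (G.pos v) (G.pos w) = dist (G.pos v) (G.pos z) → w ≤ z) :
    best G v X = some w := by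
  have hX : X.Nonempty := ⟨w, hw⟩
  obtain ⟨h1, h2⟩ := (Finset.exists_min_image X
    (fun w => toLex (dist (G.pos v) (G.pos w), w)) hX).choose_spec
  rw [best, dif_pos hX]
  congr 1
  set z := (Finset.exists_min_image X (fun w => toLex (dist (G.pos v) (G.pos w), w)) hX).choose
  have h3 := Prod.Lex.le_iff.1 (h2 w hw)
  simp only [ofLex_toLex] at h3
  rcases h3 with h3 | ⟨h3, h4⟩
  · exact absurd (hle z h1) (not_le.2 h3)
  · exact le_antisymm h4 (hidx z h1 h3.symm)

theorem grecv_eq {τ : ℕ} {x : Fin n → GState n} {v u : Fin n}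
    (h : Receives S G (gtrans G π own τ x) v u) :
    grecv S G π own τ x u = (gout G π v (own v) τ (x v)).map fun o => (v, o.1) := by
  have hex : ∃ v, Receives S G (gtrans G π own τ x) v u := ⟨v, h⟩
  rw [grecv, dif_pos hex, Receives.unique S G hex.choose_spec h]

theorem exists_of_grecv {τ : ℕ} {x : Fin n → GState n} {u : Fin n}
    {m : Fin n × Option (Fin n) × Fin n} (h : grecv S G π own τ x u = some m) :
    Receives S G (gtrans G π own τ x) m.1 u ∧
      ∃ r, gout G π m.1 (own m.1) τ (x m.1) = some (m.2, r) := by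
  unfold grecv at h
  split_ifs at h with hex
  obtain ⟨o, ho, rfl⟩ := Option.map_eq_some_iff.1 h
  exact ⟨hex.choose_spec, o.2, ho⟩

/-- The stations of the box of `u` that `u` hears in the first `m` rounds of an iteration of the
election in which the stations of `A` take part. -/
noncomputable def heardBy (A : Finset (Fin n)) (m : ℕ) (u : Fin n) : Finset (Fin n) :=
  Finset.univ.filter fun w => u ∈ A ∧ box S G w = box S G u ∧
    ∃ j < m, Receives S G (A ∩ π.sel j) w u

/-- `v` and `w` choose each other in the iteration of the election in which the stations of `A`
take part. -/
def Mates (A : Finset (Fin n)) (v w : Fin n) : Prop :=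
  best G v (heardBy S G π A π.L v) = some w ∧ best G w (heardBy S G π A π.L w) = some v

variable {S G π own} in
theorem Mates.symm {A : Finset (Fin n)} {v w : Fin n} (h : Mates S G π A v w) :
    Mates S G π A w v := ⟨h.2, h.1⟩

theorem mem_heardBy {A : Finset (Fin n)} {m : ℕ} {u w : Fin n} :
    w ∈ heardBy S G π A m u ↔ u ∈ A ∧ box S G w = box S G u ∧
      ∃ j < m, Receives S G (A ∩ π.sel j) w u := by
  simp [heardBy]

variable {S G π own} in
theorem Mates.spec {A : Finset (Fin n)} {v w : Fin n} (h : Mates S G π A v w) :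
    v ∈ A ∧ w ∈ A ∧ v ≠ w ∧ box S G w = box S G v := by
  obtain ⟨h1, h2, j, -, h3⟩ := (mem_heardBy S G π).1 (mem_of_best G h.1)
  refine ⟨h1, (Finset.mem_inter.1 h3.1).1, ?_, h2⟩
  rintro rfl
  exact h3.2.1 h3.1

variable {S G π own} in
theorem Mates.unique {A : Finset (Fin n)} {v w w' : Fin n} (h : Mates S G π A v w)
    (h' : Mates S G π A v w') : w = w' :=
  Option.some.inj (h.1.symm.trans h'.1)

variable {S G} in
theorem ClosestPair.symm {A : Finset (Fin n)} {v u : Fin n} (h : ClosestPair S G A v u) :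
    ClosestPair S G A u v :=
  ⟨h.right_mem, h.left_mem, h.ne.symm, h.box_eq.symm, by rw [dist_comm]; exact h.le⟩

variable {S G} in
theorem ClosestPair.of_dist_eq {A : Finset (Fin n)} {v u w : Fin n} (h : ClosestPair S G A v u)
    (hw : w ∈ A) (hne : v ≠ w) (hb : box S G v = box S G w)
    (hd : dist (G.pos v) (G.pos u) = dist (G.pos v) (G.pos w)) : ClosestPair S G A v w :=
  ⟨h.left_mem, hw, hne, hb, by rw [← hd]; exact h.le⟩

theorem exists_closestPair {A : Finset (Fin n)} {a b : Fin n} (ha : a ∈ A) (hb : b ∈ A)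
    (hab : a ≠ b) (hbox : box S G a = box S G b) : ∃ v u, ClosestPair S G A v u := by
  obtain ⟨⟨v, u⟩, hvu, hmin⟩ := Finset.exists_min_image
    ((A ×ˢ A).filter fun p => p.1 ≠ p.2 ∧ box S G p.1 = box S G p.2)
    (fun p => dist (G.pos p.1) (G.pos p.2)) ⟨(a, b), by simp [ha, hb, hab, hbox]⟩
  simp only [Finset.mem_filter, Finset.mem_product] at hvu hmin
  exact ⟨v, u, hvu.1.1, hvu.1.2, hvu.2.1, hvu.2.2,
    fun c hc d hd hcd hbx => hmin (c, d) ⟨⟨hc, hd⟩, hcd, hbx⟩⟩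

/-- If some box contains two stations of `A`, then there are mates. -/
theorem exists_mates (hsel : ∀ (A : Finset (Fin n)) (v u : Fin n), ClosestPair S G A v u →
      ∃ j < π.L, Receives S G (A ∩ π.sel j) v u)
    {A : Finset (Fin n)} {a b : Fin n} (ha : a ∈ A) (hb : b ∈ A)
    (hab : a ≠ b) (hbox : box S G a = box S G b) : ∃ v w, Mates S G π A v w := by
  have hex : (Finset.univ.filter fun v => ∃ u, ClosestPair S G A v u).Nonempty := by
    obtain ⟨v, u, h⟩ := exists_closestPair S G ha hb hab hbox
    exact ⟨v, by simpa using ⟨u, h⟩⟩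
  obtain ⟨u, hu, humin⟩ := Finset.exists_min_image _ id hex
  simp only [Finset.mem_filter, Finset.mem_univ, true_and, id] at hu humin
  have hex2 : (Finset.univ.filter fun v => ClosestPair S G A u v).Nonempty := by
    obtain ⟨v, hv⟩ := hu
    exact ⟨v, by simpa using hv⟩
  obtain ⟨v, hv, hvmin⟩ := Finset.exists_min_image _ id hex2
  simp only [Finset.mem_filter, Finset.mem_univ, true_and, id] at hv hvmin
  have hmem : ∀ y z, z ∈ heardBy S G π A π.L y → z ∈ A ∧ y ≠ z ∧ box S G y = box S G z := by
    intro y z hz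
    obtain ⟨-, h2, j, -, h3⟩ := (mem_heardBy S G π).1 hz
    refine ⟨(Finset.mem_inter.1 h3.1).1, ?_, h2.symm⟩
    rintro rfl
    exact h3.2.1 h3.1
  -- Here `u` is the smallest member of any closest pair and `v` its smallest partner. Nothing heard
  -- is nearer than the partner, and a station heard at the same distance forms a closest pair as
  -- well; so the two minimality conditions resolve the ties in favor of a mutual choice.
  refine ⟨u, v, best_eq G ?_ ?_ ?_, best_eq G ?_ ?_ ?_⟩
  · exact (mem_heardBy S G π).2 ⟨hv.left_mem, hv.box_eq.symm, hsel A v u hv.symm⟩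
  · intro z hz
    obtain ⟨h1, h2, h3⟩ := hmem u z hz
    exact hv.le u hv.left_mem z h1 h2 h3
  · intro z hz hd
    obtain ⟨h1, h2, h3⟩ := hmem u z hz
    exact hvmin z (hv.of_dist_eq h1 h2 h3 hd)
  · exact (mem_heardBy S G π).2 ⟨hv.right_mem, hv.box_eq, hsel A u v hv⟩
  · intro z hz
    obtain ⟨h1, h2, h3⟩ := hmem v z hz
    exact hv.symm.le v hv.right_mem z h1 h2 h3
  · intro z hz hd
    obtain ⟨h1, h2, h3⟩ := hmem v z hz
    exact humin z ⟨v, (hv.symm.of_dist_eq h1 h2 h3 hd).symm⟩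

/-! ### One iteration of the election -/

/-- The state between two iterations of the election. -/
structure Clean (x : Fin n → GState n) : Prop where
  heard : ∀ v, (x v).heard = ∅
  mate : ∀ v, (x v).mate = none
  token : ∀ v, (x v).token = false
  spoken : ∀ v, (x v).spoken = 0
  source : ∀ v, (x v).active = true → (own v).Nonempty

/-- The stations that are active. -/
def actives (x : Fin n → GState n) : Finset (Fin n) :=
  Finset.univ.filter fun v => (x v).active = true

theorem mem_actives {x : Fin n → GState n} {v : Fin n} :
    v ∈ actives x ↔ (x v).active = true := by simp [actives]

theorem iteration_round {i j : ℕ} (hi : i < π.k) (hj : j < π.len) :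
    i * π.len + j < π.electionEnd ∧ (i * π.len + j) % π.len = j := by
  refine ⟨?_, by rw [Nat.mul_add_mod_self_right, Nat.mod_eq_of_lt hj]⟩
  have := Nat.mul_le_mul_right π.len hi
  rw [Nat.succ_mul] at this
  unfold Plan.electionEnd
  omega

variable {x : Fin n → GState n}

/-- Activity does not change within an iteration, and the transmitters depend on nothing else; so
rounds j and L + j have the same transmitters and the same receptions. -/
theorem gtrans_election {y : Fin n → GState n} (hx : Clean own x)
    (hy : ∀ v, (y v).active = (x v).active) {i j : ℕ} (hi : i < π.k) (hj : j < 2 * π.L) :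
    gtrans G π own (i * π.len + j) y = actives x ∩ π.sel (j % π.L) := by
  obtain ⟨h1, h2⟩ := iteration_round π (j := j) hi (by unfold Plan.len; omega)
  ext v
  simp only [gtrans, gout, h1, h2, hj, Finset.mem_filter, Finset.mem_univ, true_and, if_true, hy,
    Finset.mem_inter, mem_actives]
  by_cases hv : (x v).active = true
  · by_cases hs : v ∈ π.sel (j % π.L) <;> simp [hv, hs, hx.source v hv]
  · simp [hv]

theorem gstep_election {u : Fin n} {o : Finset R} {g : GState n} {i j : ℕ}
    {m : Option (Fin n × Option (Fin n) × Fin n)} (hi : i < π.k) (hj : j < 2 * π.L) :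
    gstep S G π u o (i * π.len + j) g m = match m with
      | none => g
      | some (w, tgt, f) =>
        if g.active = true ∧ box S G w = box S G u then
          if j < π.L then { g with heard := insert w g.heard }
          else if tgt = some u ∧ best G u g.heard = some w then { g with mate := some (w, f) }
          else g
        else g := by
  obtain ⟨h1, h2⟩ := iteration_round π (j := j) hi (by unfold Plan.len; omega)
  rcases m with _ | ⟨w, tgt, f⟩ <;> simp only [gstep, h1, h2, hj.ne, if_true, if_false]

theorem gstate_first_pass {i : ℕ} (hi : i < π.k)
    (hx : Clean own (gstate S G π own (i * π.len))) {j : ℕ} (hj : j ≤ π.L) (v : Fin n) :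
    gstate S G π own (i * π.len + j) v = { gstate S G π own (i * π.len) v with
      heard := heardBy S G π (actives (gstate S G π own (i * π.len))) j v } := by
  set x := gstate S G π own (i * π.len) with hxdef
  induction j generalizing v with
  | zero =>
    have h0 : heardBy S G π (actives x) 0 v = ∅ := by simp [heardBy]
    rw [Nat.add_zero, ← hxdef, h0, ← hx.heard v]
  | succ j ih =>
    have ih := fun v => ih (by omega) v
    rw [← Nat.add_assoc, gstate_succ, gstep_election S G π hi (by omega)]
    have htr := gtrans_election G π own (y := gstate S G π own (i * π.len + j)) hx
      (fun v => by rw [ih v]) hi (show j < 2 * π.L by omega)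
    rw [Nat.mod_eq_of_lt (by omega)] at htr
    have hsucc : ∀ w, w ∈ heardBy S G π (actives x) (j + 1) v ↔
        w ∈ heardBy S G π (actives x) j v ∨ v ∈ actives x ∧ box S G w = box S G v ∧
          Receives S G (actives x ∩ π.sel j) w v := by
      intro w
      simp only [mem_heardBy, Nat.lt_succ_iff_lt_or_eq]
      constructor
      · rintro ⟨h1, h2, j', h3 | rfl, h4⟩
        · exact Or.inl ⟨h1, h2, j', h3, h4⟩
        · exact Or.inr ⟨h1, h2, h4⟩
      · rintro (⟨h1, h2, j', h3, h4⟩ | ⟨h1, h2, h4⟩)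
        · exact ⟨h1, h2, j', Or.inl h3, h4⟩
        · exact ⟨h1, h2, j, Or.inr rfl, h4⟩
    rcases hr : grecv S G π own (i * π.len + j) (gstate S G π own (i * π.len + j)) v
      with _ | ⟨w, tgt, f⟩
    · have hnone : ∀ w, ¬ Receives S G (actives x ∩ π.sel j) w v := by
        intro w hw
        have hw' := hw
        rw [← htr] at hw'
        rw [grecv_eq S G π own hw'] at hr
        have := hw'.1
        simp only [gtrans, Finset.mem_filter] at this
        exact this.2 (Option.map_eq_none_iff.1 hr)
      have e : heardBy S G π (actives x) (j + 1) v = heardBy S G π (actives x) j v := by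
        ext w
        rw [hsucc]
        simp [hnone]
      rw [e]
      exact ih v
    · obtain ⟨hw, -⟩ := exists_of_grecv S G π own hr
      simp only at hw
      rw [htr] at hw
      have huniq : ∀ w', Receives S G (actives x ∩ π.sel j) w' v ↔ w' = w :=
        fun w' => ⟨fun h => Receives.unique S G h hw, fun h => h ▸ hw⟩
      simp only [show j < π.L by omega, if_true]
      rw [ih v]
      simp only
      split_ifs with hc
      · congr 1
        ext w'
        rw [Finset.mem_insert, hsucc, huniq, mem_actives]
        constructor
        · rintro (rfl | h)
          · exact Or.inr ⟨hc.1, hc.2, rfl⟩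
          · exact Or.inl h
        · rintro (h | ⟨-, -, h⟩)
          · exact Or.inr h
          · exact Or.inl h
      · congr 1
        ext w'
        rw [hsucc, huniq, mem_actives]
        constructor
        · exact Or.inl
        · rintro (h | ⟨h1, h2, rfl⟩)
          · exact h
          · exact absurd ⟨h1, h2⟩ hc

/-- What was heard in the first pass is heard again, now with the choice of the sender and the head
of its list. A mate is therefore recorded exactly if the choice is mutual; the condition on j' < j
says that the announcement has already been heard. -/
theorem gstate_second_pass {i : ℕ} (hi : i < π.k)
    (hx : Clean own (gstate S G π own (i * π.len))) {j : ℕ} (hj : j ≤ π.L) (v : Fin n) :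
    ∃ m, gstate S G π own (i * π.len + π.L + j) v = { gstate S G π own (i * π.len) v with
      heard := heardBy S G π (actives (gstate S G π own (i * π.len))) π.L v
      mate := m } ∧
      ∀ w f, m = some (w, f) ↔ Mates S G π (actives (gstate S G π own (i * π.len))) v w ∧
        (∃ j' < j, Receives S G (actives (gstate S G π own (i * π.len)) ∩ π.sel j') w v) ∧
        f = (gstate S G π own (i * π.len) w).first := by
  set x := gstate S G π own (i * π.len) with hxdef
  set A := actives x with hA
  induction j generalizing v with
  | zero =>
    refine ⟨none, ?_, by simp⟩
    rw [Nat.add_zero, gstate_first_pass S G π own hi hx le_rfl, ← hxdef]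
    simp only [hx.mate v, hA]
  | succ j ih =>
    have ih := fun v => ih (by omega) v
    rw [← Nat.add_assoc, gstate_succ, Nat.add_assoc, gstep_election S G π hi (by omega)]
    have htr := gtrans_election G π own (y := gstate S G π own (i * π.len + (π.L + j))) hx
      (fun v => by
        obtain ⟨m, h, -⟩ := ih v
        rw [← Nat.add_assoc, h]) hi (show π.L + j < 2 * π.L by omega)
    rw [Nat.add_mod_left, Nat.mod_eq_of_lt (show j < π.L by omega)] at htr
    obtain ⟨m, hm, hmates⟩ := ih v
    rw [Nat.add_assoc] at hm
    rcases hr : grecv S G π own (i * π.len + (π.L + j))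
      (gstate S G π own (i * π.len + (π.L + j))) v with _ | ⟨w, tgt, f⟩
    · have hnone : ∀ w, ¬ Receives S G (A ∩ π.sel j) w v := by
        intro w hw
        have hw' := hw
        rw [← htr] at hw'
        rw [grecv_eq S G π own hw'] at hr
        have := hw'.1
        simp only [gtrans, Finset.mem_filter] at this
        exact this.2 (Option.map_eq_none_iff.1 hr)
      refine ⟨m, hm, fun w f => (hmates w f).trans ?_⟩
      refine and_congr_right fun _ => and_congr_left fun _ => ?_
      constructor
      · rintro ⟨j', h1, h2⟩
        exact ⟨j', by omega, h2⟩
      · rintro ⟨j', h1, h2⟩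
        rcases Nat.lt_succ_iff_lt_or_eq.1 h1 with h1 | rfl
        · exact ⟨j', h1, h2⟩
        · exact absurd h2 (hnone w)
    · obtain ⟨hw, r, hout⟩ := exists_of_grecv S G π own hr
      simp only at hw hout
      rw [htr] at hw
      have hwA : (x w).active = true := mem_actives.1 (Finset.mem_inter.1 hw.1).1
      obtain ⟨mw, hmw, -⟩ := ih w
      rw [Nat.add_assoc] at hmw
      obtain ⟨htgt, hf⟩ : best G w (heardBy S G π A π.L w) = tgt ∧ (x w).first = f := by
        obtain ⟨h1, h2⟩ := iteration_round π (j := π.L + j) hi (by unfold Plan.len; omega)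
        have hs : w ∈ π.sel j := (Finset.mem_inter.1 hw.1).2
        rw [hmw] at hout
        simp only [gout, hx.source w hwA, h1, h2, hwA, Nat.add_mod_left,
          Nat.mod_eq_of_lt (show j < π.L by omega), hs, show π.L + j < 2 * π.L by omega,
          not_true_eq_false, if_false, if_true, and_self, Option.some.injEq, Prod.mk.injEq,
          show ¬ π.L + j < π.L by omega] at hout
        exact hout.1
      have hmates' : ∀ w' f', (Mates S G π A v w' ∧
          (∃ j' < j + 1, Receives S G (A ∩ π.sel j') w' v) ∧ f' = (x w').first) ↔
          m = some (w', f') ∨ Mates S G π A v w' ∧ w' = w ∧ f' = f := by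
        intro w' f'
        rw [hmates]
        constructor
        · rintro ⟨h1, ⟨j', h2, h3⟩, h4⟩
          rcases Nat.lt_succ_iff_lt_or_eq.1 h2 with h2 | rfl
          · exact Or.inl ⟨h1, ⟨j', h2, h3⟩, h4⟩
          · obtain rfl := Receives.unique S G h3 hw
            exact Or.inr ⟨h1, rfl, h4.trans hf⟩
        · rintro (⟨h1, ⟨j', h2, h3⟩, h4⟩ | ⟨h1, rfl, rfl⟩)
          · exact ⟨h1, ⟨j', by omega, h3⟩, h4⟩
          · exact ⟨h1, ⟨j, by omega, hw⟩, hf.symm⟩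
      simp only [show ¬ π.L + j < π.L by omega, if_false]
      rw [hm]
      simp only
      by_cases hc : Mates S G π A v w
      · have hsp := hc.spec
        rw [if_pos ⟨mem_actives.1 hsp.1, hsp.2.2.2⟩, if_pos ⟨by rw [← htgt]; exact hc.2, hc.1⟩]
        refine ⟨some (w, f), rfl, fun w' f' => ?_⟩
        rw [hmates' w' f']
        simp only [Option.some.injEq, Prod.mk.injEq]
        constructor
        · rintro ⟨rfl, rfl⟩
          exact Or.inr ⟨hc, rfl, rfl⟩
        · rintro (h | ⟨h1, h2, h3⟩)
          · obtain ⟨h1, -, h3⟩ := (hmates w' f').1 h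
            obtain rfl := hc.unique h1
            exact ⟨rfl, by rw [h3, hf]⟩
          · exact ⟨h2.symm, h3.symm⟩
      · refine ⟨m, ?_, fun w' f' => ?_⟩
        · split_ifs with h1 h2
          · exact absurd ⟨h2.2, htgt.trans h2.1⟩ hc
          · rfl
          · rfl
        · rw [hmates' w' f']
          constructor
          · exact Or.inl
          · rintro (h | ⟨h1, rfl, -⟩)
            · exact h
            · exact absurd h1 hc

/-- The effect of an iteration of the election. -/
theorem gstate_iteration {i : ℕ} (hi : i < π.k)
    (hx : Clean own (gstate S G π own (i * π.len))) (v : Fin n) :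
    (∀ w, Mates S G π (actives (gstate S G π own (i * π.len))) v w →
      gstate S G π own ((i + 1) * π.len) v =
        if w < v then { gstate S G π own (i * π.len) v with
          active := false, next := some (gstate S G π own (i * π.len) w).first }
        else { gstate S G π own (i * π.len) v with
          first := (gstate S G π own (i * π.len) w).first }) ∧
    ((∀ w, ¬ Mates S G π (actives (gstate S G π own (i * π.len))) v w) →
      gstate S G π own ((i + 1) * π.len) v = gstate S G π own (i * π.len) v) := by
  set x := gstate S G π own (i * π.len) with hxdef
  have hend : gstate S G π own ((i + 1) * π.len) v =
      settle v (gstate S G π own (i * π.len + π.L + π.L) v) := by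
    have h0 : (i + 1) * π.len = i * π.len + (2 * π.L) + 1 := by
      rw [Nat.succ_mul]; unfold Plan.len; omega
    obtain ⟨h1, h2⟩ := iteration_round π (j := 2 * π.L) hi (by unfold Plan.len; omega)
    rw [h0, gstate_succ]
    unfold gstep
    rw [if_pos h1, h2, if_pos rfl, Nat.add_assoc, ← Nat.two_mul]
  obtain ⟨m, hm, hmates⟩ := gstate_second_pass S G π own hi hx le_rfl v
  rw [← hxdef] at hm hmates
  rw [hend, hm]
  have hxe : ∀ g : GState n, g = x v → { g with heard := ∅, mate := none } = x v := by
    rintro g rfl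
    rw [← hx.heard v, ← hx.mate v]
  constructor
  · intro w hw
    -- A chosen station was heard in the first pass, so its announcement is heard by the end of the
    -- second.
    have hhear : ∃ j' < π.L, Receives S G (actives x ∩ π.sel j') w v :=
      ((mem_heardBy S G π).1 (mem_of_best G hw.1)).2.2
    obtain rfl := (hmates w (x w).first).2 ⟨hw, hhear, rfl⟩
    simp only [settle]
    split_ifs <;> rw [← hx.heard v, ← hx.mate v]
  · intro hw
    have : m = none := by
      rcases m with _ | ⟨w, f⟩
      · rfl
      · exact absurd ((hmates w f).1 rfl).1 (hw w)
    subst this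
    simp only [settle]
    exact hxe _ rfl

end Election

/-! ### Linked lists of sources and the end of the election. -/

section Lists

open scoped Classical

variable {n b : ℕ} {R : Type} (S : Params) (G : Network n) (π : Plan n b) (own : Fin n → Finset R)

/-- The list `l`, followed by `r`, starts with `f` and is linked by `nx`. -/
def Linked (nx : Fin n → Option (Fin n)) : Fin n → List (Fin n) → Fin n → Prop
  | f, [], r => f = r
  | f, a :: l, r => f = a ∧ ∃ z, nx a = some z ∧ Linked nx z l r

theorem Linked.congr {nx nx' : Fin n → Option (Fin n)} {f r : Fin n} {l : List (Fin n)}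
    (h : Linked nx f l r) (he : ∀ a ∈ l, nx' a = nx a) : Linked nx' f l r := by
  induction l generalizing f with
  | nil => exact h
  | cons a l ih =>
    obtain ⟨h1, z, h2, h3⟩ := h
    exact ⟨h1, z, (he a (by simp)).trans h2, ih h3 fun c hc => he c (by simp [hc])⟩

theorem Linked.append {nx : Fin n → Option (Fin n)} {f w f' r : Fin n} {l l' : List (Fin n)}
    (h : Linked nx f l w) (hw : nx w = some f') (h' : Linked nx f' l' r) :
    Linked nx f (l ++ w :: l') r := by
  induction l generalizing f with
  | nil => exact ⟨h, f', hw, h'⟩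
  | cons a l ih =>
    obtain ⟨h1, z, h2, h3⟩ := h
    exact ⟨h1, z, h2, ih h3⟩

/-- The sources are divided into lists, each of which lies in one box and ends with an active
station `r`, preceded by the stations of `pre r`. -/
structure Lists (x : Fin n → GState n) (pre : Fin n → List (Fin n)) : Prop where
  linked : ∀ r, (x r).active = true → Linked (fun v => (x v).next) (x r).first (pre r) r
  next : ∀ r, (x r).active = true → (x r).next = none
  inactive : ∀ r, (x r).active = true → ∀ y ∈ pre r, (x y).active = false
  box_eq : ∀ r, (x r).active = true → ∀ y ∈ pre r, box S G y = box S G r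
  source : ∀ r, (x r).active = true → ∀ y ∈ pre r, (own y).Nonempty
  nodup : ∀ r, (x r).active = true → (pre r).Nodup
  disjoint : ∀ r, (x r).active = true → ∀ r', (x r').active = true →
    ∀ y, y ∈ pre r → y ∈ pre r' → r = r'
  cover : ∀ y, (own y).Nonempty → ∃ r, (x r).active = true ∧ (y = r ∨ y ∈ pre r)

theorem clean_zero : Clean own (gstate S G π own 0) :=
  ⟨fun _ => rfl, fun _ => rfl, fun _ => rfl, fun _ => rfl, fun v h => by
    simpa [gstate, ginit] using h⟩

theorem lists_zero : Lists S G own (gstate S G π own 0) fun _ => [] where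
  linked _ _ := rfl
  next _ _ := rfl
  inactive := by simp
  box_eq := by simp
  source := by simp
  nodup := by simp
  disjoint := by simp
  cover y hy := ⟨y, by simp [gstate, ginit, hy], Or.inl rfl⟩

variable {x x' : Fin n → GState n}

/-- `x'` arises from `x` by an iteration of the election. -/
def IterationStep (x x' : Fin n → GState n) : Prop :=
  ∀ v, (∀ w, Mates S G π (actives x) v w →
      x' v = if w < v then { x v with active := false, next := some (x w).first }
        else { x v with first := (x w).first }) ∧
    ((∀ w, ¬ Mates S G π (actives x) v w) → x' v = x v)

variable {S G π own}

theorem IterationStep.cases (h : IterationStep S G π x x') (v : Fin n) :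
    (∃ w, Mates S G π (actives x) v w ∧ w < v ∧
      x' v = { x v with active := false, next := some (x w).first }) ∨
    (∃ w, Mates S G π (actives x) v w ∧ v < w ∧ x' v = { x v with first := (x w).first }) ∨
    ((∀ w, ¬ Mates S G π (actives x) v w) ∧ x' v = x v) := by
  by_cases hM : ∃ w, Mates S G π (actives x) v w
  · obtain ⟨w, hw⟩ := hM
    have := (h v).1 w hw
    rcases lt_trichotomy w v with hlt | heq | hlt
    · exact Or.inl ⟨w, hw, hlt, by rw [this, if_pos hlt]⟩
    · exact absurd heq hw.spec.2.2.1.symm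
    · exact Or.inr (Or.inl ⟨w, hw, hlt, by rw [this, if_neg hlt.asymm]⟩)
  · push Not at hM
    exact Or.inr (Or.inr ⟨hM, (h v).2 hM⟩)

theorem IterationStep.clean (h : IterationStep S G π x x') (hx : Clean own x) : Clean own x' := by
  refine ⟨fun v => ?_, fun v => ?_, fun v => ?_, fun v => ?_, fun v => ?_⟩ <;>
    rcases h.cases v with ⟨w, -, -, he⟩ | ⟨w, -, -, he⟩ | ⟨-, he⟩ <;> rw [he] <;>
    first
    | exact hx.heard v
    | exact hx.mate v
    | exact hx.token v
    | exact hx.spoken v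
    | exact hx.source v
    | simp

theorem IterationStep.eq_of_inactive (h : IterationStep S G π x x') {v : Fin n}
    (hv : (x v).active = false) : x' v = x v := by
  refine (h v).2 fun w hw => ?_
  have := mem_actives.1 hw.spec.1
  simp [hv] at this

theorem IterationStep.active_iff (h : IterationStep S G π x x') (v : Fin n) :
    (x' v).active = true ↔
      (x v).active = true ∧ ∀ w, Mates S G π (actives x) v w → v < w := by
  rcases h.cases v with ⟨w, hw, hlt, he⟩ | ⟨w, hw, hlt, he⟩ | ⟨hM, he⟩
  · rw [he]
    simp only [Bool.false_eq_true, false_iff, not_and, not_forall]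
    exact fun _ => ⟨w, hw, hlt.asymm⟩
  · rw [he]
    simp only [iff_self_and]
    exact fun _ w' hw' => hw.unique hw' ▸ hlt
  · rw [he]
    simp only [iff_self_and]
    exact fun _ w hw => absurd hw (hM w)

/-- If `w` is eliminated by its mate `u`, the new list of `u` is that of `w`, then `w`, then that of
`u`: `w` now points to the old head for `u`, and `u` adopts the head for `w`. The links of stations
that were inactive before do not change, and since mates are unique no list is used twice. -/
theorem IterationStep.lists (h : IterationStep S G π x x') {pre : Fin n → List (Fin n)}
    (hp : Lists S G own x pre) (hx : Clean own x) : ∃ pre', Lists S G own x' pre' := by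
  set M := Mates S G π (actives x) with hM
  have hact : ∀ {v w}, M v w → (x v).active = true := fun hm => mem_actives.1 hm.spec.1
  refine ⟨fun u => if h : ∃ w, M u w ∧ u < w then pre h.choose ++ h.choose :: pre u else pre u, ?_⟩
  set pre' : Fin n → List (Fin n) := fun u =>
    if h : ∃ w, M u w ∧ u < w then pre h.choose ++ h.choose :: pre u else pre u with hpre'
  have hpos : ∀ {u w}, M u w → u < w → pre' u = pre w ++ w :: pre u := by
    intro u w hm hlt
    have hex : ∃ w, M u w ∧ u < w := ⟨w, hm, hlt⟩
    simp only [hpre']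
    rw [dif_pos hex, hex.choose_spec.1.unique hm]
  have hneg : ∀ {u}, (∀ w, ¬ M u w) → pre' u = pre u := by
    intro u hu
    simp only [hpre']
    rw [dif_neg (by rintro ⟨w, hw, -⟩; exact hu w hw)]
  have hsplit : ∀ {r}, (x' r).active = true → (x r).active = true ∧
      ((∃ w, M r w ∧ r < w ∧ pre' r = pre w ++ w :: pre r ∧ (x' r).first = (x w).first ∧
        (x' r).next = (x r).next) ∨
      ((∀ w, ¬ M r w) ∧ pre' r = pre r ∧ x' r = x r)) := by
    intro r hr
    refine ⟨((h.active_iff r).1 hr).1, ?_⟩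
    rcases h.cases r with ⟨w, hw, hlt, he⟩ | ⟨w, hw, hlt, he⟩ | ⟨hm, he⟩
    · rw [he] at hr
      simp at hr
    · exact Or.inl ⟨w, hw, hlt, hpos hw hlt, by rw [he], by rw [he]⟩
    · exact Or.inr ⟨hm, hneg hm, he⟩
  have hmem : ∀ {r y}, (x' r).active = true → y ∈ pre' r → (y ∈ pre r ∨
      ∃ w, M r w ∧ r < w ∧ (y = w ∨ y ∈ pre w)) := by
    intro r y hr hy
    rcases (hsplit hr).2 with ⟨w, hw, hlt, hpe, -⟩ | ⟨-, hpe, -⟩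
    · rw [hpe, List.mem_append, List.mem_cons] at hy
      rcases hy with hy | rfl | hy
      · exact Or.inr ⟨w, hw, hlt, Or.inr hy⟩
      · exact Or.inr ⟨y, hw, hlt, Or.inl rfl⟩
      · exact Or.inl hy
    · exact Or.inl (hpe ▸ hy)
  have hnx : ∀ r, (x r).active = true → Linked (fun v => (x' v).next) (x r).first (pre r) r :=
    fun r hr => (hp.linked r hr).congr fun a ha => by
      simp only [h.eq_of_inactive (hp.inactive r hr a ha)]
  have hdrop : ∀ {r w}, M r w → r < w → x' w = { x w with
      active := false, next := some (x r).first } := by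
    intro r w hm hlt
    rw [(h w).1 r hm.symm, if_pos hlt]
  constructor
  · intro r hr
    obtain ⟨hr0, ⟨w, hw, hlt, hpe, hf, -⟩ | ⟨-, hpe, he⟩⟩ := hsplit hr
    · rw [hpe, hf]
      exact (hnx w (hact hw.symm)).append (by simp only [hdrop hw hlt]) (hnx r hr0)
    · rw [hpe, he]
      exact hnx r hr0
  · intro r hr
    obtain ⟨hr0, ⟨w, -, -, -, -, hn⟩ | ⟨-, -, he⟩⟩ := hsplit hr
    · rw [hn]
      exact hp.next r hr0
    · rw [he]
      exact hp.next r hr0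
  · intro r hr y hy
    rcases hmem hr hy with hy | ⟨w, hw, hlt, rfl | hy⟩
    · rw [h.eq_of_inactive (hp.inactive r (hsplit hr).1 y hy)]
      exact hp.inactive r (hsplit hr).1 y hy
    · rw [hdrop hw hlt]
    · rw [h.eq_of_inactive (hp.inactive w (hact hw.symm) y hy)]
      exact hp.inactive w (hact hw.symm) y hy
  · intro r hr y hy
    rcases hmem hr hy with hy | ⟨w, hw, hlt, rfl | hy⟩
    · exact hp.box_eq r (hsplit hr).1 y hy
    · exact hw.spec.2.2.2
    · exact (hp.box_eq w (hact hw.symm) y hy).trans hw.spec.2.2.2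
  · intro r hr y hy
    rcases hmem hr hy with hy | ⟨w, hw, hlt, rfl | hy⟩
    · exact hp.source r (hsplit hr).1 y hy
    · exact hx.source y (hact hw.symm)
    · exact hp.source w (hact hw.symm) y hy
  · intro r hr
    obtain ⟨hr0, ⟨w, hw, hlt, hpe, -⟩ | ⟨-, hpe, -⟩⟩ := hsplit hr
    · have hw0 := hact hw.symm
      have hnot : ∀ r, (x r).active = true → w ∉ pre r := fun r hr hwr => by
        have := hp.inactive r hr w hwr
        rw [hw0] at this
        simp at this
      rw [hpe, List.nodup_append]
      refine ⟨hp.nodup w hw0, List.nodup_cons.2 ⟨hnot r hr0, hp.nodup r hr0⟩, ?_⟩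
      rintro a ha c hc rfl
      rcases List.mem_cons.1 hc with rfl | hc
      · exact hnot _ hw0 ha
      · exact hlt.ne (hp.disjoint r hr0 w hw0 a hc ha)
    · rw [hpe]
      exact hp.nodup r hr0
  · intro r hr r' hr' y hy hy'
    have hr0 := (hsplit hr).1
    have hr0' := (hsplit hr').1
    have hnot : ∀ {w r}, (x w).active = true → (x r).active = true → w ∉ pre r :=
      fun {w r} hw hr hwr => by
        have := hp.inactive r hr w hwr
        rw [hw] at this
        simp at this
    have hno : ∀ {r w}, M r w → r < w → (x' w).active = true → False := by
      intro r w hw hlt ha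
      rw [hdrop hw hlt] at ha
      simp at ha
    -- In each new list, `y` comes from the old list, is the eliminated mate, or comes from the list
    -- of that mate. Active stations lie on no `pre`, the old lists are disjoint, and an eliminated
    -- station is not the end of a new list.
    rcases hmem hr hy with hy | ⟨w, hw, hlt, rfl | hy⟩ <;>
      rcases hmem hr' hy' with hy' | ⟨w', hw', hlt', rfl | hy'⟩
    · exact hp.disjoint r hr0 r' hr0' y hy hy'
    · exact absurd hy (hnot (hact hw'.symm) hr0)
    · have := hp.disjoint r hr0 w' (hact hw'.symm) y hy hy'
      exact (hno hw' hlt' (this ▸ hr)).elim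
    · exact absurd hy' (hnot (hact hw.symm) hr0')
    · exact hw.symm.unique hw'.symm
    · exact absurd hy' (hnot (hact hw.symm) (hact hw'.symm))
    · have := hp.disjoint r' hr0' w (hact hw.symm) y hy' hy
      exact (hno hw hlt (this ▸ hr')).elim
    · exact absurd hy (hnot (hact hw'.symm) (hact hw.symm))
    · have := hp.disjoint w (hact hw.symm) w' (hact hw'.symm) y hy hy'
      subst this
      exact hw.symm.unique hw'.symm
  · intro y hy
    obtain ⟨r, hr, hyr⟩ := hp.cover y hy
    rcases h.cases r with ⟨w, hw, hlt, -⟩ | ⟨w, hw, hlt, -⟩ | ⟨hm, he⟩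
    · refine ⟨w, (h.active_iff w).2 ⟨hact hw.symm, fun z hz => hw.symm.unique hz ▸ hlt⟩, ?_⟩
      rw [hpos hw.symm hlt]
      right
      rcases hyr with rfl | hyr
      · simp
      · simp [hyr]
    · refine ⟨r, (h.active_iff r).2 ⟨hr, fun z hz => hw.unique hz ▸ hlt⟩, ?_⟩
      rw [hpos hw hlt]
      rcases hyr with rfl | hyr
      · exact Or.inl rfl
      · simp [hyr]
    · refine ⟨r, by rw [he]; exact hr, ?_⟩
      rw [hneg hm]
      exact hyr

theorem IterationStep.actives_subset (h : IterationStep S G π x x') : actives x' ⊆ actives x :=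
  fun v hv => mem_actives.2 ((h.active_iff v).1 (mem_actives.1 hv)).1

theorem IterationStep.card_actives_lt (h : IterationStep S G π x x') {v w : Fin n}
    (hm : Mates S G π (actives x) v w) : (actives x').card < (actives x).card := by
  refine Finset.card_lt_card (Finset.ssubset_iff_of_subset h.actives_subset |>.2 ?_)
  rcases lt_or_gt_of_ne hm.spec.2.2.1 with hlt | hlt
  · refine ⟨w, hm.spec.2.1, fun hw => ?_⟩
    exact ((h.active_iff w).1 (mem_actives.1 hw)).2 v hm.symm |>.asymm hlt
  · refine ⟨v, hm.spec.1, fun hv => ?_⟩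
    exact ((h.active_iff v).1 (mem_actives.1 hv)).2 w hm |>.asymm hlt

variable (S G π own)

/-- At the end of the election, the sources of every box form one list. -/
theorem election (hsel : ∀ (A : Finset (Fin n)) (v u : Fin n), ClosestPair S G A v u →
      ∃ j < π.L, Receives S G (A ∩ π.sel j) v u)
    (hk : ∑ v, (own v).card ≤ π.k) :
    Clean own (gstate S G π own π.electionEnd) ∧
    (∃ pre, Lists S G own (gstate S G π own π.electionEnd) pre) ∧
    ∀ v w, (gstate S G π own π.electionEnd v).active = true →
      (gstate S G π own π.electionEnd w).active = true → box S G v = box S G w → v = w := by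
  -- As long as a box has two active stations, every iteration eliminates at least one, so at most k
  -- - i are active after i iterations. Uniqueness in the boxes persists because no station becomes
  -- active again.
  have key : ∀ i ≤ π.k, Clean own (gstate S G π own (i * π.len)) ∧
      (∃ pre, Lists S G own (gstate S G π own (i * π.len)) pre) ∧
      ((actives (gstate S G π own (i * π.len))).card + i ≤ π.k ∨
        ∀ v ∈ actives (gstate S G π own (i * π.len)),
          ∀ w ∈ actives (gstate S G π own (i * π.len)), box S G v = box S G w → v = w) := by
    intro i hi
    induction i with
    | zero =>
      rw [Nat.zero_mul]
      refine ⟨clean_zero S G π own, ⟨_, lists_zero S G π own⟩, Or.inl (le_trans ?_ hk)⟩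
      rw [Nat.add_zero, Finset.card_eq_sum_ones]
      -- Every source has at least one rumor, so there are at most k sources.
      refine (Finset.sum_le_sum (g := fun v => (own v).card) fun v hv => ?_).trans
        (Finset.sum_le_univ_sum_of_nonneg fun v => Nat.zero_le _)
      exact Finset.card_pos.2 ((clean_zero S G π own).source v (mem_actives.1 hv))
    | succ i ih =>
      obtain ⟨h1, ⟨pre, h2⟩, h3⟩ := ih (by omega)
      have hstep : IterationStep S G π (gstate S G π own (i * π.len))
          (gstate S G π own ((i + 1) * π.len)) := gstate_iteration S G π own (by omega) h1
      refine ⟨hstep.clean h1, hstep.lists h2 h1, ?_⟩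
      by_cases hu : ∀ v ∈ actives (gstate S G π own (i * π.len)),
          ∀ w ∈ actives (gstate S G π own (i * π.len)), box S G v = box S G w → v = w
      · exact Or.inr fun v hv w hw =>
          hu v (hstep.actives_subset hv) w (hstep.actives_subset hw)
      · have h3 := h3.resolve_right hu
        push Not at hu
        obtain ⟨a, ha, c, hc, hbox, hne⟩ := hu
        obtain ⟨v, w, hm⟩ := exists_mates S G π hsel ha hc hne hbox
        have := hstep.card_actives_lt hm
        exact Or.inl (by omega)
  obtain ⟨h1, h2, h3⟩ := key π.k le_rfl
  refine ⟨h1, h2, fun v w hv hw hbox => ?_⟩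
  rcases h3 with h3 | h3
  · have h0 : (actives (gstate S G π own (π.k * π.len))).card = 0 := by omega
    have := mem_actives.2 hv
    rw [Plan.electionEnd, Finset.card_eq_zero.1 h0] at this
    simp at this
  · exact h3 v (mem_actives.2 hv) w (mem_actives.2 hw) hbox

end Lists

/-! ### The conversations in the boxes: tokens and simultaneous speakers. -/

section Conversation

open scoped Classical

variable {n b : ℕ} {R : Type} (S : Params) (G : Network n) (π : Plan n b) (own : Fin n → Finset R)

theorem Linked.exists_cons {nx : Fin n → Option (Fin n)} {f r : Fin n} {l : List (Fin n)}
    (h : Linked nx f l r) : ∃ t, l ++ [r] = f :: t := by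
  cases l with
  | nil => exact ⟨[], by rw [show f = r from h]; rfl⟩
  | cons a l => exact ⟨l ++ [r], by rw [h.1]; rfl⟩

theorem Linked.next_eq {nx : Fin n → Option (Fin n)} {f r a c : Fin n} {l l₁ l₂ : List (Fin n)}
    (h : Linked nx f l r) (he : l ++ [r] = l₁ ++ a :: c :: l₂) : nx a = some c := by
  induction l₁ generalizing f l with
  | nil =>
    cases l with
    | nil => simp at he
    | cons d l =>
      obtain ⟨-, z, h2, h3⟩ := h
      obtain ⟨t, ht⟩ := h3.exists_cons
      simp only [List.cons_append, List.nil_append, List.cons.injEq, ht] at he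
      rw [← he.1, h2, he.2.1]
  | cons e l₁ ih =>
    cases l with
    | nil => simp at he
    | cons d l =>
      obtain ⟨-, z, h2, h3⟩ := h
      simp only [List.cons_append, List.cons.injEq] at he
      exact ih h3 he.2

/-- The stations that transmit after the election, in round `σ`. -/
theorem mem_gtrans_conversation {σ : ℕ} {y : Fin n → GState n} {v : Fin n} :
    v ∈ gtrans G π own (π.electionEnd + σ) y ↔ (own v).Nonempty ∧ σ % π.C = π.col v ∧
      ((σ < π.C ∧ (y v).active = true) ∨ (π.C ≤ σ ∧ (y v).token = true)) := by
  simp only [gtrans, gout, Finset.mem_filter, Finset.mem_univ, true_and,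
    Nat.add_sub_cancel_left, show ¬ π.electionEnd + σ < π.electionEnd by omega, if_false]
  by_cases h1 : (own v).Nonempty
  · by_cases h2 : σ % π.C = π.col v
    · by_cases h3 : σ < π.C
      · by_cases h4 : (y v).active = true <;> simp [h1, h2, h3, h4, not_le.2 h3]
      · by_cases h4 : (y v).token = true <;> simp [h1, h2, h3, h4, not_lt.1 h3]
    · simp [h2]
  · simp [h1]

theorem gstep_conversation_static (v : Fin n) (o : Finset R) (σ : ℕ) (g : GState n)
    (m : Option (Fin n × Option (Fin n) × Fin n)) :
    (gstep S G π v o (π.electionEnd + σ) g m).active = g.active ∧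
    (gstep S G π v o (π.electionEnd + σ) g m).first = g.first ∧
    (gstep S G π v o (π.electionEnd + σ) g m).next = g.next := by
  unfold gstep
  rw [if_neg (by omega)]
  rcases m with _ | ⟨w, tgt, f⟩ <;> dsimp only <;> split_ifs <;> simp

theorem gstate_conversation_static (σ : ℕ) (v : Fin n) :
    (gstate S G π own (π.electionEnd + σ) v).active = (gstate S G π own π.electionEnd v).active ∧
    (gstate S G π own (π.electionEnd + σ) v).first = (gstate S G π own π.electionEnd v).first ∧
    (gstate S G π own (π.electionEnd + σ) v).next = (gstate S G π own π.electionEnd v).next := by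
  induction σ with
  | zero => exact ⟨rfl, rfl, rfl⟩
  | succ σ ih =>
    rw [← Nat.add_assoc, gstate_succ]
    obtain ⟨h1, h2, h3⟩ := gstep_conversation_static S G π v (own v) σ
      (gstate S G π own (π.electionEnd + σ) v)
      (grecv S G π own (π.electionEnd + σ) (gstate S G π own (π.electionEnd + σ)) v)
    exact ⟨h1.trans ih.1, h2.trans ih.2.1, h3.trans ih.2.2⟩

/-- The rumor `ρ` of `v` has been received by all other stations of its box before round `τ`. -/
def Delivered (τ : ℕ) (v : Fin n) (ρ : R) : Prop :=
  ∃ τ' < τ, ∃ o, gout G π v (own v) τ' (gstate S G π own τ' v) = some o ∧ o.2 = some ρ ∧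
    ∀ u, box S G u = box S G v → u ≠ v →
      Receives S G (gtrans G π own τ' (gstate S G π own τ')) v u

variable {S G π own} in
theorem Delivered.mono {τ τ' : ℕ} {v : Fin n} {ρ : R} (h : Delivered S G π own τ v ρ)
    (hτ : τ ≤ τ') : Delivered S G π own τ' v ρ := by
  obtain ⟨t, ht, h⟩ := h
  exact ⟨t, ht.trans_le hτ, h⟩

/-- The number of turns of the color `c` before round `σ`. -/
def Plan.turns (c σ : ℕ) : ℕ := Nat.count (fun s => s % π.C = c) σ

theorem turns_succ (c σ : ℕ) :
    π.turns c (σ + 1) = π.turns c σ + if σ % π.C = c then 1 else 0 :=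
  Nat.count_succ _ _

theorem turns_eq_zero {c σ : ℕ} (hc : c < π.C) (h : σ ≤ c) : π.turns c σ = 0 := by
  induction σ with
  | zero => exact Nat.count_zero _
  | succ σ ih =>
    rw [turns_succ, ih (by omega), Nat.mod_eq_of_lt (by omega), if_neg (by omega)]

theorem le_turns {c : ℕ} (hc : c < π.C) (p : ℕ) : p ≤ π.turns c (π.C * p) := by
  induction p with
  | zero => exact Nat.zero_le _
  | succ p ih =>
    have hm : Monotone (π.turns c) := Nat.count_monotone _
    have h1 := hm (show π.C * p ≤ π.C * p + c by omega)
    have h2 := hm (show π.C * p + c + 1 ≤ π.C * (p + 1) by rw [Nat.mul_succ]; omega)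
    rw [turns_succ, Nat.mul_add_mod, Nat.mod_eq_of_lt hc, if_pos rfl] at h2
    omega

/-- The progress of the conversation in the box whose list of sources consists of the stations of
`l`: it has not started yet, or some station has the token, or it is over. -/
inductive Progress (c σ : ℕ) (y : Fin n → GState n) (l : List (Fin n)) : Prop
  | start (hσ : σ ≤ c) (h : ∀ v ∈ l, (y v).token = false ∧ (y v).spoken = 0)
  -- The turns so far are counted exactly: one for handing over the token at the start, and one for
  -- each rumor already spoken.
  | turn (hσ : c < σ) (l₁ l₂ : List (Fin n)) (a : Fin n) (hl : l = l₁ ++ a :: l₂)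
      (ha : (y a).token = true) (hlt : (y a).spoken < (own a).card)
      (hturns : π.turns c σ = 1 + (l₁.map fun v => (own v).card).sum + (y a).spoken)
      (h₁ : ∀ v ∈ l₁, (y v).token = false)
      (h₂ : ∀ v ∈ l₂, (y v).token = false ∧ (y v).spoken = 0)
      (hd₁ : ∀ v ∈ l₁, ∀ ρ ∈ own v, Delivered S G π own (π.electionEnd + σ) v ρ)
      (hd : ∀ i < (y a).spoken, ∀ ρ, (own a).toList[i]? = some ρ →
        Delivered S G π own (π.electionEnd + σ) a ρ)
  | over (hσ : c < σ) (h : ∀ v ∈ l, (y v).token = false)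
      (hd : ∀ v ∈ l, ∀ ρ ∈ own v, Delivered S G π own (π.electionEnd + σ) v ρ)

variable {S G π own} {pre : Fin n → List (Fin n)}

theorem Lists.mem_props {x : Fin n → GState n} (hp : Lists S G own x pre) (hx : Clean own x)
    {r v : Fin n} (hr : (x r).active = true) (hv : v ∈ pre r ++ [r]) :
    (own v).Nonempty ∧ box S G v = box S G r ∧ ((x v).active = true → v = r) := by
  rw [List.mem_append, List.mem_singleton] at hv
  rcases hv with hv | rfl
  · refine ⟨hp.source r hr v hv, hp.box_eq r hr v hv, fun h => ?_⟩
    rw [hp.inactive r hr v hv] at h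
    simp at h
  · exact ⟨hx.source v hr, rfl, fun _ => rfl⟩

theorem Lists.nodup_append {x : Fin n → GState n} (hp : Lists S G own x pre)
    {r : Fin n} (hr : (x r).active = true) : (pre r ++ [r]).Nodup := by
  rw [List.nodup_append]
  refine ⟨hp.nodup r hr, by simp, ?_⟩
  rintro a ha c hc rfl
  obtain rfl := List.mem_singleton.1 hc
  have := hp.inactive a hr a ha
  rw [hr] at this
  simp at this

variable (S G π own)

/-- What is known after the election. -/
structure Elected (pre : Fin n → List (Fin n)) : Prop where
  clean : Clean own (gstate S G π own π.electionEnd)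
  lists : Lists S G own (gstate S G π own π.electionEnd) pre
  unique : ∀ v w, (gstate S G π own π.electionEnd v).active = true →
    (gstate S G π own π.electionEnd w).active = true → box S G v = box S G w → v = w

/-- Which boxes are heard simultaneously. -/
structure GoodColoring : Prop where
  eq_of_box : ∀ v w, box S G v = box S G w → π.col v = π.col w
  receives : ∀ (T : Finset (Fin n)) (v u : Fin n), v ∈ T → u ∉ T →
      dist (G.pos v) (G.pos u) ≤ range S →
      (∀ w ∈ T, ∀ w' ∈ T, w ≠ w' → π.col w = π.col w' ∧ box S G w ≠ box S G w') →
      Receives S G T v u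

/-- The progress of all conversations. -/
def AllProgress (pre : Fin n → List (Fin n)) (σ : ℕ) : Prop :=
  ∀ r, (gstate S G π own π.electionEnd r).active = true →
    Progress S G π own (π.col r) σ (gstate S G π own (π.electionEnd + σ)) (pre r ++ [r])

variable {S G π own}

variable {σ : ℕ}

/-- In the first C rounds only active stations speak, and each box has at most one. Later speakers
have the token; all sources of the box are on one list, on which `Progress` leaves room for one
token. -/
theorem speaker_unique (hE : Elected S G π own pre) (hA : AllProgress S G π own pre σ)
    {v w : Fin n}
    (hv : v ∈ gtrans G π own (π.electionEnd + σ) (gstate S G π own (π.electionEnd + σ)))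
    (hw : w ∈ gtrans G π own (π.electionEnd + σ) (gstate S G π own (π.electionEnd + σ)))
    (hbox : box S G v = box S G w) : v = w := by
  rw [mem_gtrans_conversation] at hv hw
  obtain ⟨hv0, -, hv⟩ := hv
  obtain ⟨hw0, hcw, hw⟩ := hw
  have hmem : ∀ u, (own u).Nonempty →
      ∃ r, (gstate S G π own π.electionEnd r).active = true ∧ u ∈ pre r ++ [r] := by
    intro u hu
    obtain ⟨r, hr, h⟩ := hE.lists.cover u hu
    refine ⟨r, hr, ?_⟩
    rcases h with rfl | h <;> simp_all
  obtain ⟨r, hr, hvr⟩ := hmem v hv0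
  obtain ⟨r', hr', hwr⟩ := hmem w hw0
  have hpv := hE.lists.mem_props hE.clean hr hvr
  have hpw := hE.lists.mem_props hE.clean hr' hwr
  obtain rfl : r = r' := hE.unique r r' hr hr' (by rw [← hpv.2.1, ← hpw.2.1, hbox])
  rw [(gstate_conversation_static S G π own σ v).1] at hv
  rw [(gstate_conversation_static S G π own σ w).1] at hw
  rcases hv with ⟨h1, hv⟩ | ⟨h1, hv⟩
  · rcases hw with ⟨-, hw⟩ | ⟨h2, -⟩
    · rw [hpv.2.2 hv, hpw.2.2 hw]
    · omega
  · rcases hw with ⟨h2, -⟩ | ⟨-, hw⟩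
    · omega
    · have honly : ∀ u ∈ pre r ++ [r], ∀ l₁ l₂ a, pre r ++ [r] = l₁ ++ a :: l₂ →
          (∀ z ∈ l₁, (gstate S G π own (π.electionEnd + σ) z).token = false) →
          (∀ z ∈ l₂, (gstate S G π own (π.electionEnd + σ) z).token = false ∧
            (gstate S G π own (π.electionEnd + σ) z).spoken = 0) →
          (gstate S G π own (π.electionEnd + σ) u).token = true → u = a := by
        intro u hu l₁ l₂ a hl h3 h4 ht
        rw [hl, List.mem_append, List.mem_cons] at hu
        rcases hu with hu | rfl | hu
        · simp [h3 u hu] at ht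
        · rfl
        · simp [(h4 u hu).1] at ht
      rcases hA r hr with ⟨-, h⟩ | ⟨-, l₁, l₂, a, hl, -, -, -, h3, h4, -, -⟩ | ⟨-, h, -⟩
      · simp [(h v hvr).1] at hv
      · rw [honly v hvr l₁ l₂ a hl h3 h4 hv, honly w hwr l₁ l₂ a hl h3 h4 hw]
      · simp [h v hvr] at hv

/-- The speakers of a round have the color of the round and lie in different boxes, so the coloring
guarantees reception within the range and in particular in the whole box. -/
theorem receives_speaker (hE : Elected S G π own pre) (hC : GoodColoring S G π)
    (hA : AllProgress S G π own pre σ) {v u : Fin n}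
    (hv : v ∈ gtrans G π own (π.electionEnd + σ) (gstate S G π own (π.electionEnd + σ)))
    (hbox : box S G u = box S G v) (hne : u ≠ v) :
    Receives S G (gtrans G π own (π.electionEnd + σ) (gstate S G π own (π.electionEnd + σ)))
      v u := by
  refine hC.receives _ v u hv (fun hu => hne (speaker_unique hE hA hu hv hbox))
    (dist_lt_of_box_eq S G hbox.symm).le fun w hw w' hw' hww => ?_
  refine ⟨Fin.ext ?_, fun hb => hww (speaker_unique hE hA hw hw' hb)⟩
  rw [← ((mem_gtrans_conversation G π own).1 hw).2.1,
    ← ((mem_gtrans_conversation G π own).1 hw').2.1]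

theorem gstate_of_speaker {v : Fin n}
    (hv : v ∈ gtrans G π own (π.electionEnd + σ) (gstate S G π own (π.electionEnd + σ))) :
    gstate S G π own (π.electionEnd + (σ + 1)) v =
      if σ < π.C then { gstate S G π own (π.electionEnd + σ) v with
        token := decide ((gstate S G π own (π.electionEnd + σ) v).first = v) }
      else { gstate S G π own (π.electionEnd + σ) v with
        spoken := (gstate S G π own (π.electionEnd + σ) v).spoken + 1
        token := decide ((gstate S G π own (π.electionEnd + σ) v).spoken + 1 < (own v).card) } := by
  have hnone : grecv S G π own (π.electionEnd + σ) (gstate S G π own (π.electionEnd + σ)) v =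
      none := by
    refine dif_neg ?_
    rintro ⟨w, hw⟩
    exact hw.2.1 hv
  obtain ⟨-, h2, h3⟩ := (mem_gtrans_conversation G π own).1 hv
  rw [← Nat.add_assoc, gstate_succ, hnone]
  unfold gstep
  rw [if_neg (by omega)]
  simp only [Nat.add_sub_cancel_left, h2, if_true]
  rcases h3 with ⟨h3, h4⟩ | ⟨h3, h4⟩
  · simp only [h3, h4, if_true]
  · simp only [show ¬ σ < π.C by omega, h4, if_true, if_false]

theorem gstate_of_listener (hE : Elected S G π own pre) (hC : GoodColoring S G π)
    (hA : AllProgress S G π own pre σ) {v u : Fin n}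
    (hv : v ∈ gtrans G π own (π.electionEnd + σ) (gstate S G π own (π.electionEnd + σ)))
    (hbox : box S G u = box S G v) (hne : u ≠ v)
    {o : (Option (Fin n) × Fin n) × Option R}
    (ho : gout G π v (own v) (π.electionEnd + σ) (gstate S G π own (π.electionEnd + σ) v) =
      some o) :
    gstate S G π own (π.electionEnd + (σ + 1)) u =
      if o.1.1 = some u then { gstate S G π own (π.electionEnd + σ) u with token := true }
      else gstate S G π own (π.electionEnd + σ) u := by
  have hr := grecv_eq S G π own (receives_speaker hE hC hA hv hbox hne)
  rw [ho] at hr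
  rw [← Nat.add_assoc, gstate_succ, hr]
  unfold gstep
  rw [if_neg (by omega)]
  simp [hbox]

/-- Messages from other boxes are ignored. -/
theorem gstate_of_silent_box {u : Fin n} (hu : (own u).Nonempty)
    (h : ∀ v ∈ gtrans G π own (π.electionEnd + σ) (gstate S G π own (π.electionEnd + σ)),
      box S G v ≠ box S G u) :
    gstate S G π own (π.electionEnd + (σ + 1)) u = gstate S G π own (π.electionEnd + σ) u := by
  have hu' : u ∉ gtrans G π own (π.electionEnd + σ) (gstate S G π own (π.electionEnd + σ)) :=
    fun h' => h u h' rfl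
  rw [mem_gtrans_conversation] at hu'
  rw [← Nat.add_assoc, gstate_succ]
  unfold gstep
  rw [if_neg (by omega)]
  rcases hr : grecv S G π own (π.electionEnd + σ) (gstate S G π own (π.electionEnd + σ)) u
    with _ | ⟨w, tgt, f⟩
  · simp only [Nat.add_sub_cancel_left]
    split_ifs with h1 h2 h3 h4
    · exact absurd ⟨hu, h1, Or.inl ⟨h2, h3⟩⟩ hu'
    · rfl
    · exact absurd ⟨hu, h1, Or.inr ⟨by omega, h4⟩⟩ hu'
    · rfl
    · rfl
  · obtain ⟨hw, -⟩ := exists_of_grecv S G π own hr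
    have := h w hw.1
    simp [this]

end Conversation

/-! ### Progress and termination of the conversations. -/

section ConversationProgress

open scoped Classical

variable {n b : ℕ} {R : Type} {S : Params} {G : Network n} {π : Plan n b} {own : Fin n → Finset R}
  {pre : Fin n → List (Fin n)} {σ : ℕ}

theorem gout_conversation {y : Fin n → GState n} {v : Fin n}
    (hv : v ∈ gtrans G π own (π.electionEnd + σ) y) :
    gout G π v (own v) (π.electionEnd + σ) (y v) =
      if σ < π.C then some ((some (y v).first, v), none)
      else some ((if (y v).spoken + 1 < (own v).card then none else (y v).next, v),
        (own v).toList[(y v).spoken]?) := by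
  obtain ⟨h1, h2, h3⟩ := (mem_gtrans_conversation G π own).1 hv
  unfold gout
  rw [if_neg (not_not.2 h1), if_neg (by omega), Nat.add_sub_cancel_left, if_pos h2]
  rcases h3 with ⟨h3, h4⟩ | ⟨h3, h4⟩
  · simp only [h3, h4, if_true]
  · simp only [show ¬ σ < π.C by omega, h4, if_true, if_false]

theorem mem_list_of_box_eq (hE : Elected S G π own pre) {r w : Fin n}
    (hr : (gstate S G π own π.electionEnd r).active = true) (hw : (own w).Nonempty)
    (hbox : box S G w = box S G r) : w ∈ pre r ++ [r] := by
  obtain ⟨r', hr', h⟩ := hE.lists.cover w hw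
  have hmem : w ∈ pre r' ++ [r'] := by
    rw [List.mem_append, List.mem_singleton]; exact h.symm
  have := (hE.lists.mem_props hE.clean hr' hmem).2.1
  obtain rfl : r' = r := hE.unique r' r hr' hr (this.symm.trans hbox)
  exact hmem

/-- A conversation does not change in a round in which its box is silent. -/
theorem Progress.of_silent (hE : Elected S G π own pre) {r : Fin n}
    (hr : (gstate S G π own π.electionEnd r).active = true)
    (h : Progress S G π own (π.col r) σ (gstate S G π own (π.electionEnd + σ)) (pre r ++ [r]))
    (hsil : ∀ w ∈ gtrans G π own (π.electionEnd + σ) (gstate S G π own (π.electionEnd + σ)),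
      box S G w ≠ box S G r)
    (hσ : σ % π.C ≠ π.col r ∨ ∀ v ∈ pre r ++ [r],
      (gstate S G π own (π.electionEnd + σ) v).token = false ∧ (π.col r : ℕ) < σ) :
    Progress S G π own (π.col r) (σ + 1) (gstate S G π own (π.electionEnd + (σ + 1)))
      (pre r ++ [r]) := by
  have heq : ∀ v ∈ pre r ++ [r],
      gstate S G π own (π.electionEnd + (σ + 1)) v = gstate S G π own (π.electionEnd + σ) v := by
    intro v hv
    obtain ⟨h1, h2, -⟩ := hE.lists.mem_props hE.clean hr hv
    exact gstate_of_silent_box h1 fun w hw => by rw [h2]; exact hsil w hw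
  rcases h with ⟨h1, h2⟩ | ⟨h1, l₁, l₂, a, hl, ha, hlt, ht, h3, h4, h5, h6⟩ | ⟨h1, h2, h3⟩
  · refine .start ?_ fun v hv => by rw [heq v hv]; exact h2 v hv
    rcases hσ with hσ | hσ
    · have := (π.col r).2
      rcases Nat.lt_or_eq_of_le h1 with h | h
      · exact h
      · rw [h, Nat.mod_eq_of_lt this] at hσ
        exact absurd rfl hσ
    · have := (hσ r (by simp)).2
      omega
  · have hσ' : σ % π.C ≠ π.col r := by
      rcases hσ with hσ | hσ
      · exact hσ
      · have := (hσ a (by rw [hl]; simp)).1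
        rw [ha] at this
        simp at this
    have hea := heq a (by rw [hl]; simp)
    refine .turn (by omega) l₁ l₂ a hl (by rw [hea]; exact ha) (by rw [hea]; exact hlt) ?_ ?_ ?_
      ?_ ?_
    · rw [turns_succ, if_neg hσ', hea]
      exact ht
    · intro v hv
      rw [heq v (by rw [hl]; simp [hv])]
      exact h3 v hv
    · intro v hv
      rw [heq v (by rw [hl]; simp [hv])]
      exact h4 v hv
    · exact fun v hv ρ hρ => (h5 v hv ρ hρ).mono (by omega)
    · rw [hea]
      exact fun i hi ρ hρ => (h6 i hi ρ hρ).mono (by omega)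
  · refine .over (by omega) (fun v hv => by rw [heq v hv]; exact h2 v hv) ?_
    exact fun v hv ρ hρ => (h3 v hv ρ hρ).mono (by omega)

/-- When the conversation starts, the last station of the list passes the token to the first one. -/
theorem Progress.of_start (hE : Elected S G π own pre) (hC : GoodColoring S G π)
    (hA : AllProgress S G π own pre σ) {r : Fin n}
    (hr : (gstate S G π own π.electionEnd r).active = true) (hσ : σ = π.col r)
    (h : ∀ v ∈ pre r ++ [r], (gstate S G π own (π.electionEnd + σ) v).token = false ∧
      (gstate S G π own (π.electionEnd + σ) v).spoken = 0) :
    Progress S G π own (π.col r) (σ + 1) (gstate S G π own (π.electionEnd + (σ + 1)))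
      (pre r ++ [r]) := by
  have hlt : σ < π.C := hσ ▸ (π.col r).2
  have hst := gstate_conversation_static S G π own σ r
  have hrT : r ∈ gtrans G π own (π.electionEnd + σ) (gstate S G π own (π.electionEnd + σ)) :=
    (mem_gtrans_conversation G π own).2 ⟨hE.clean.source r hr, by rw [Nat.mod_eq_of_lt hlt, hσ],
      Or.inl ⟨hlt, by rw [hst.1]; exact hr⟩⟩
  have hout := gout_conversation hrT
  rw [if_pos hlt] at hout
  set f := (gstate S G π own (π.electionEnd + σ) r).first with hf
  have hnew : ∀ v ∈ pre r ++ [r],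
      (gstate S G π own (π.electionEnd + (σ + 1)) v).token = decide (f = v) ∧
      (gstate S G π own (π.electionEnd + (σ + 1)) v).spoken = 0 := by
    intro v hv
    by_cases hvr : v = r
    · subst hvr
      rw [gstate_of_speaker hrT, if_pos hlt]
      exact ⟨rfl, (h v hv).2⟩
    · rw [gstate_of_listener hE hC hA hrT (hE.lists.mem_props hE.clean hr hv).2.1 hvr hout]
      simp only [Option.some.injEq]
      split_ifs with hfv
      · simp [hfv, (h v hv).2]
      · simp [hfv, (h v hv)]
  obtain ⟨t, ht⟩ := (hE.lists.linked r hr).exists_cons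
  rw [← hst.2.1] at ht
  have hnd := hE.lists.nodup_append hr
  have hfm : f ∈ pre r ++ [r] := by rw [ht]; simp
  -- This was the first turn of the color, and it was spent on passing the token to the head `f`,
  -- which has not spoken yet.
  refine .turn (by omega) [] t f ht ?_ ?_ ?_ (by simp) ?_ (by simp) ?_
  · simp [(hnew f hfm).1]
  · rw [(hnew f hfm).2]
    exact Finset.card_pos.2 (hE.lists.mem_props hE.clean hr hfm).1
  · rw [(hnew f hfm).2, turns_succ, turns_eq_zero π (π.col r).2 hσ.le, hσ,
      Nat.mod_eq_of_lt (π.col r).2]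
    simp
  · intro v hv
    have hv' := hnew v (by rw [ht]; simp [hv])
    refine ⟨?_, hv'.2⟩
    rw [hv'.1, decide_eq_false_iff_not]
    rintro rfl
    rw [ht, List.nodup_cons] at hnd
    exact hnd.1 hv
  · rw [(hnew f hfm).2]
    simp

/-- A station that has the token transmits one of its rumors, and, with the last one, passes
the token to the next station of the list. -/
theorem Progress.of_turn (hE : Elected S G π own pre) (hC : GoodColoring S G π)
    (hA : AllProgress S G π own pre σ) {r : Fin n}
    (hr : (gstate S G π own π.electionEnd r).active = true) (hσ : (π.col r : ℕ) < σ)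
    (hmod : σ % π.C = π.col r) {l₁ l₂ : List (Fin n)} {a : Fin n}
    (hl : pre r ++ [r] = l₁ ++ a :: l₂)
    (ha : (gstate S G π own (π.electionEnd + σ) a).token = true)
    (hlt : (gstate S G π own (π.electionEnd + σ) a).spoken < (own a).card)
    (hturns : π.turns (π.col r) σ = 1 + (l₁.map fun v => (own v).card).sum +
      (gstate S G π own (π.electionEnd + σ) a).spoken)
    (h₁ : ∀ v ∈ l₁, (gstate S G π own (π.electionEnd + σ) v).token = false)
    (h₂ : ∀ v ∈ l₂, (gstate S G π own (π.electionEnd + σ) v).token = false ∧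
      (gstate S G π own (π.electionEnd + σ) v).spoken = 0)
    (hd₁ : ∀ v ∈ l₁, ∀ ρ ∈ own v, Delivered S G π own (π.electionEnd + σ) v ρ)
    (hd : ∀ i < (gstate S G π own (π.electionEnd + σ) a).spoken, ∀ ρ,
      (own a).toList[i]? = some ρ → Delivered S G π own (π.electionEnd + σ) a ρ) :
    Progress S G π own (π.col r) (σ + 1) (gstate S G π own (π.electionEnd + (σ + 1)))
      (pre r ++ [r]) := by
  -- A round after round `col r` with the same residue is no longer among the first C rounds.
  have hσC : π.C ≤ σ := by
    by_contra hc
    rw [Nat.mod_eq_of_lt (not_le.1 hc)] at hmod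
    omega
  have ham : a ∈ pre r ++ [r] := by rw [hl]; simp
  obtain ⟨ha0, habox, -⟩ := hE.lists.mem_props hE.clean hr ham
  have haT : a ∈ gtrans G π own (π.electionEnd + σ) (gstate S G π own (π.electionEnd + σ)) :=
    (mem_gtrans_conversation G π own).2 ⟨ha0, by rw [hmod, hC.eq_of_box a r habox],
      Or.inr ⟨hσC, ha⟩⟩
  have hout := gout_conversation haT
  rw [if_neg (not_lt.2 hσC)] at hout
  have hnewa := gstate_of_speaker (S := S) haT
  rw [if_neg (not_lt.2 hσC)] at hnewa
  set s := (gstate S G π own (π.electionEnd + σ) a).spoken with hs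
  have hnd := hE.lists.nodup_append hr
  rw [hl, List.nodup_append, List.nodup_cons] at hnd
  obtain ⟨hnd1, ⟨hna2, hnd2⟩, hdis⟩ := hnd
  have hna1 : a ∉ l₁ := fun h => hdis a h a (by simp) rfl
  have hnew : ∀ v ∈ l₁ ++ l₂, gstate S G π own (π.electionEnd + (σ + 1)) v =
      if (if s + 1 < (own a).card then none
        else (gstate S G π own (π.electionEnd + σ) a).next) = some v then
        { gstate S G π own (π.electionEnd + σ) v with token := true }
      else gstate S G π own (π.electionEnd + σ) v := by
    intro v hv
    have hvm : v ∈ pre r ++ [r] := by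
      rw [hl]; simp only [List.mem_append, List.mem_cons] at hv ⊢; tauto
    have hva : v ≠ a := by
      rintro rfl
      rcases List.mem_append.1 hv with h | h
      · exact hna1 h
      · exact hna2 h
    rw [gstate_of_listener hE hC hA haT
      ((hE.lists.mem_props hE.clean hr hvm).2.1.trans habox.symm) hva hout]
  have hdel : ∀ i < s + 1, ∀ ρ, (own a).toList[i]? = some ρ →
      Delivered S G π own (π.electionEnd + (σ + 1)) a ρ := by
    intro i hi ρ hρ
    rcases Nat.lt_succ_iff_lt_or_eq.1 hi with hi | rfl
    · exact (hd i hi ρ hρ).mono (by omega)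
    · exact ⟨π.electionEnd + σ, by omega, _, hout, hρ, fun u hu hne =>
        receives_speaker hE hC hA haT hu hne⟩
  have hdel₁ : ∀ v ∈ l₁, ∀ ρ ∈ own v, Delivered S G π own (π.electionEnd + (σ + 1)) v ρ :=
    fun v hv ρ hρ => (hd₁ v hv ρ hρ).mono (by omega)
  have htu : π.turns (π.col r) (σ + 1) = 1 + (l₁.map fun v => (own v).card).sum + (s + 1) := by
    rw [turns_succ, if_pos hmod, hturns, Nat.add_assoc]
  by_cases hlast : s + 1 < (own a).card
  · simp only [hlast, if_true, reduceCtorEq, if_false] at hnew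
    refine .turn (by omega) l₁ l₂ a hl ?_ ?_ ?_ ?_ ?_ hdel₁ ?_
    · rw [hnewa]; simp [hlast]
    · rw [hnewa]; exact hlast
    · rw [hnewa]; exact htu
    · intro v hv
      rw [hnew v (List.mem_append_left _ hv)]
      exact h₁ v hv
    · intro v hv
      rw [hnew v (List.mem_append_right _ hv)]
      exact h₂ v hv
    · rw [hnewa]; exact hdel
  · have hdela : ∀ ρ ∈ own a, Delivered S G π own (π.electionEnd + (σ + 1)) a ρ := by
      intro ρ hρ
      obtain ⟨i, hi, he⟩ := List.mem_iff_getElem.1 (Finset.mem_toList.2 hρ)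
      rw [Finset.length_toList] at hi
      exact hdel i (by omega) ρ (List.getElem?_eq_some_iff.2 ⟨_, he⟩)
    simp only [hlast, if_false, (gstate_conversation_static S G π own σ a).2.2] at hnew
    have hta : (gstate S G π own (π.electionEnd + (σ + 1)) a).token = false := by
      rw [hnewa]; simp [hlast]
    cases l₂ with
    | nil =>
      -- The last station of the list has no `next`, so the token disappears and the conversation is
      -- over.
      have har : a = r := by
        have := congrArg List.getLast? hl
        simpa using this.symm
      rw [har, hE.lists.next r hr] at hnew
      simp only [reduceCtorEq, if_false] at hnew
      refine .over (by omega) ?_ ?_ <;> rw [hl] <;> intro v hv <;>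
        rw [List.mem_append, List.mem_singleton] at hv <;> rcases hv with hv | rfl
      · rw [hnew v (by simp [hv])]
        exact h₁ v hv
      · exact hta
      · exact hdel₁ v hv
      · exact hdela
    | cons c l₂ =>
      have hnext := (hE.lists.linked r hr).next_eq hl
      rw [hnext] at hnew
      simp only [Option.some.injEq] at hnew
      have hnewc := hnew c (by simp)
      rw [if_pos rfl] at hnewc
      have hcm : c ∈ pre r ++ [r] := by rw [hl]; simp
      rw [List.nodup_cons] at hnd2
      refine .turn (by omega) (l₁ ++ [a]) l₂ c (by rw [hl]; simp) (by rw [hnewc]) ?_ ?_ ?_ ?_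
        ?_ ?_
      · rw [hnewc]
        simp only [(h₂ c (by simp)).2]
        exact Finset.card_pos.2 (hE.lists.mem_props hE.clean hr hcm).1
      · rw [hnewc, htu]
        simp only [(h₂ c (by simp)).2, List.map_append, List.sum_append, List.map_cons,
          List.map_nil, List.sum_cons, List.sum_nil]
        omega
      · intro v hv
        rw [List.mem_append, List.mem_singleton] at hv
        rcases hv with hv | rfl
        · have hcv : c ≠ v := fun h => hdis v hv c (by simp) h.symm
          rw [hnew v (by simp [hv]), if_neg hcv]
          exact h₁ v hv
        · exact hta
      · intro v hv
        have hcv : c ≠ v := fun h => hnd2.1 (h ▸ hv)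
        rw [hnew v (by simp [hv]), if_neg hcv]
        exact h₂ v (by simp [hv])
      · intro v hv
        rw [List.mem_append, List.mem_singleton] at hv
        rcases hv with hv | rfl
        · exact hdel₁ v hv
        · exact hdela
      · rw [hnewc]
        simp only [(h₂ c (by simp)).2]
        simp

/-- The induction treats all boxes simultaneously, since reception in one box needs unique speakers
in all the others. -/
theorem AllProgress.succ (hE : Elected S G π own pre) (hC : GoodColoring S G π)
    (hA : AllProgress S G π own pre σ) : AllProgress S G π own pre (σ + 1) := by
  intro r hr
  have hcol : ∀ w ∈ gtrans G π own (π.electionEnd + σ) (gstate S G π own (π.electionEnd + σ)),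
      box S G w = box S G r → σ % π.C = π.col r := fun w hw hb => by
    rw [((mem_gtrans_conversation G π own).1 hw).2.1, hC.eq_of_box w r hb]
  by_cases hmod : σ % π.C = π.col r
  · have h0 := hA r hr
    rcases hA r hr with ⟨h1, h2⟩ | ⟨h1, l₁, l₂, a, hl, ha, hlt, ht, h3, h4, h5, h6⟩ | ⟨h1, h2, h3⟩
    · refine Progress.of_start hE hC hA hr ?_ h2
      have := (π.col r).2
      rwa [Nat.mod_eq_of_lt (by omega)] at hmod
    · exact Progress.of_turn hE hC hA hr h1 hmod hl ha hlt ht h3 h4 h5 h6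
    · refine h0.of_silent hE hr ?_ (Or.inr fun v hv => ⟨h2 v hv, h1⟩)
      intro w hw hb
      obtain ⟨hw0, -, hw2⟩ := (mem_gtrans_conversation G π own).1 hw
      have hwm := mem_list_of_box_eq hE hr hw0 hb
      rcases hw2 with ⟨h4, -⟩ | ⟨-, h4⟩
      · rw [Nat.mod_eq_of_lt h4] at hmod
        omega
      · simp [h2 w hwm] at h4
  · exact (hA r hr).of_silent hE hr (fun w hw hb => hmod (hcol w hw hb)) (Or.inl hmod)

theorem allProgress (hE : Elected S G π own pre) (hC : GoodColoring S G π) (σ : ℕ) :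
    AllProgress S G π own pre σ := by
  induction σ with
  | zero =>
    exact fun r _ => .start (Nat.zero_le _) fun v _ => ⟨hE.clean.token v, hE.clean.spoken v⟩
  | succ σ ih => exact ih.succ hE hC

/-- After `C (k + 1)` rounds all conversations are over. -/
theorem conversation_over (hE : Elected S G π own pre) (hC : GoodColoring S G π)
    (hk : ∑ v, (own v).card ≤ π.k) (hσ : π.C * (π.k + 1) ≤ σ) {r : Fin n}
    (hr : (gstate S G π own π.electionEnd r).active = true) :
    ∀ v ∈ pre r ++ [r], (gstate S G π own (π.electionEnd + σ) v).token = false ∧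
      ∀ ρ ∈ own v, Delivered S G π own (π.electionEnd + σ) v ρ := by
  have hle : π.k + 1 ≤ π.turns (π.col r) σ :=
    (le_turns π (π.col r).2 _).trans (Nat.count_monotone _ hσ)
  have hpos : π.C ≤ σ := by
    refine le_trans ?_ hσ
    exact Nat.le_mul_of_pos_right _ (Nat.succ_pos _)
  rcases allProgress hE hC σ r hr with ⟨h1, -⟩ | ⟨-, l₁, l₂, a, hl, -, hlt, ht, -⟩ | ⟨-, h2, h3⟩
  · have := (π.col r).2
    omega
  · have hnd := hE.lists.nodup_append hr
    -- An unfinished conversation has used at most k turns, because its current speaker still has a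
    -- rumor left, whereas k + 1 turns have passed.
    have hsum : ((pre r ++ [r]).map fun v => (own v).card).sum ≤ ∑ v, (own v).card := by
      rw [← List.sum_toFinset _ hnd]
      exact Finset.sum_le_univ_sum_of_nonneg fun v => Nat.zero_le _
    rw [hl] at hsum
    simp only [List.map_append, List.sum_append, List.map_cons, List.sum_cons] at hsum
    omega
  · exact fun v hv => ⟨h2 v hv, h3 v hv⟩

/-- After the conversations nobody transmits in the collection any more. -/
theorem gout_eq_none_of_over (hE : Elected S G π own pre) (hC : GoodColoring S G π)
    (hk : ∑ v, (own v).card ≤ π.k) (hσ : π.C * (π.k + 1) ≤ σ) (v : Fin n) :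
    gout G π v (own v) (π.electionEnd + σ) (gstate S G π own (π.electionEnd + σ) v) = none := by
  by_contra h
  have hv : v ∈ gtrans G π own (π.electionEnd + σ) (gstate S G π own (π.electionEnd + σ)) := by
    simpa [gtrans] using h
  obtain ⟨h0, -, h2⟩ := (mem_gtrans_conversation G π own).1 hv
  have hpos : π.C ≤ σ := le_trans (Nat.le_mul_of_pos_right _ (Nat.succ_pos _)) hσ
  obtain ⟨r, hr, hvr⟩ := hE.lists.cover v h0
  have := conversation_over hE hC hk hσ hr v (by
    rw [List.mem_append, List.mem_singleton]; exact hvr.symm)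
  rcases h2 with ⟨h2, -⟩ | ⟨-, h2⟩
  · omega
  · simp [this.1] at h2

/-- After the conversations all rumors of a box are held by all stations of the box. -/
theorem mem_held_of_over (hE : Elected S G π own pre) (hC : GoodColoring S G π)
    (hk : ∑ v, (own v).card ≤ π.k) {v u : Fin n} (hbox : box S G u = box S G v) {ρ : R}
    (hρ : ρ ∈ own v) :
    ρ ∈ (conf S G π own (2 * (π.electionEnd + π.C * (π.k + 1))) u).held := by
  by_cases huv : u = v
  · subst huv
    exact own_subset_held S G π own _ u hρ
  obtain ⟨r, hr, hvr⟩ := hE.lists.cover v ⟨ρ, hρ⟩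
  obtain ⟨-, h⟩ := conversation_over hE hC hk le_rfl hr v (by
    rw [List.mem_append, List.mem_singleton]; exact hvr.symm)
  obtain ⟨τ, hτ, o, ho, hoρ, hrec⟩ := h ρ hρ
  exact mem_held_of_gout S G π own (hrec u hbox huv) ho hoρ (by omega)

end ConversationProgress

/-! ### Encoding, running time and the theorem. -/

section Main

theorem one_le_maxDeg (S : Params) {n : ℕ} (G : Network n) (hn : 2 ≤ n)
    (hconn : (commGraph S G).Connected) : 1 ≤ maxDeg S G := by
  classical
  have : Nontrivial (Fin n) := Fin.nontrivial_iff_two_le.2 hn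
  have v : Fin n := ⟨0, by omega⟩
  have h1 := hconn.preconnected.degree_pos_of_nontrivial v
  have h2 := (commGraph S G).degree_le_maxDegree v
  have h3 : 1 ≤ (commGraph S G).maxDegree := Nat.lt_of_lt_of_le h1 h2
  unfold maxDeg
  convert h3

/-- With l = ⌊log₂ n⌋ ≥ 1, both n and n + 1 are at most 2^(2 l), and q ≤ 2^(q l). Three stations,
one of them optional, and a residue thus need (q + 6) l bits. -/
theorem card_payload_le {n : ℕ} (hn : 2 ≤ n) (q : ℕ) :
    Fintype.card (Payload n q) ≤ 2 ^ ((q + 6) * Nat.log 2 n) := by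
  set l := Nat.log 2 n with hl
  have hl1 : 1 ≤ l := Nat.log_pos (by norm_num) hn
  have hlt : n + 1 ≤ 2 ^ (2 * l) :=
    (Nat.lt_pow_succ_log_self (by norm_num) n).trans_le
      (Nat.pow_le_pow_right (by norm_num) (by omega))
  have hq : q ≤ 2 ^ (q * l) := (Nat.lt_two_pow_self).le.trans
    (Nat.pow_le_pow_right (by norm_num) (Nat.le_mul_of_pos_right _ hl1))
  have hcard : Fintype.card (Payload n q) = n * (q * ((n + 1) * n)) := by simp
  rw [hcard]
  calc n * (q * ((n + 1) * n))
      ≤ 2 ^ (2 * l) * (2 ^ (q * l) * (2 ^ (2 * l) * 2 ^ (2 * l))) := by gcongr <;> omega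
    _ = 2 ^ ((q + 6) * l) := by rw [← pow_add, ← pow_add, ← pow_add]; congr 1; ring

theorem exists_encoding {n b q : ℕ} (hn : 2 ≤ n) (hq : 0 < q)
    (hb : (q + 6) * Nat.log 2 n ≤ b) : ∃ (enc : Payload n q → Fin b → Bool)
      (dec : (Fin b → Bool) → Payload n q), ∀ p, dec (enc p) = p := by
  have hcard : Fintype.card (Payload n q) ≤ Fintype.card (Fin b → Bool) := by
    refine (card_payload_le hn q).trans ?_
    simpa using Nat.pow_le_pow_right (by norm_num) hb
  obtain ⟨e⟩ := Function.Embedding.nonempty_of_card_le hcard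
  have : Nonempty (Payload n q) := ⟨(⟨0, by omega⟩, ⟨0, hq⟩, none, ⟨0, by omega⟩)⟩
  exact ⟨e, Function.invFun e, Function.leftInverse_invFun e.injective⟩

/-- A plan with a good coloring, a good election schedule and a backbone accomplishes
multi-broadcast. -/
theorem planProtocol_accomplishes (S : Params) {n b : ℕ} (G : Network n) (π : Plan n b)
    {R : Type} (own : Fin n → Finset R) (hC : GoodColoring S G π)
    (hsel : ∀ (A : Finset (Fin n)) (v u : Fin n), ClosestPair S G A v u →
      ∃ j < π.L, Receives S G (A ∩ π.sel j) v u)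
    (hH : IsBackbone S G π.c π.H)
    (hslot : ∀ T ⊆ π.H, (∀ v ∈ T, ∀ w ∈ T, π.slot v = π.slot w) →
      ∀ v ∈ T, ∀ u, (commGraph S G).Adj v u → Receives S G T v u)
    (hk : ∑ v, (own v).card = π.k) (hk1 : 1 ≤ π.k) :
    Accomplishes S G (planProtocol S G π R) own π.H
      (2 * (π.electionEnd + π.C * (π.k + 1)) +
        2 * π.c * (π.c * (commGraph S G).diam + π.k)) := by
  classical
  obtain ⟨h1, ⟨pre, h2⟩, h3⟩ := election S G π own hsel hk.le
  have hE : Elected S G π own pre := ⟨h1, h2, h3⟩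
  have hne : ∃ v, (own v).Nonempty := by
    by_contra! h
    rw [Finset.sum_eq_zero fun v _ => by rw [h v, Finset.card_empty]] at hk
    omega
  have hwalk : ∀ v o : (π.H : Set (Fin n)),
      ∃ p : ((commGraph S G).induce (π.H : Set (Fin n))).Walk v o,
        p.length ≤ π.c * (commGraph S G).diam := by
    intro v o
    have := hH.connected.nonempty
    obtain ⟨p, hp⟩ := hH.connected.exists_walk_length_eq_dist v o
    refine ⟨p, hp ▸ ?_⟩
    exact (SimpleGraph.dist_le_diam
      (SimpleGraph.connected_iff_ediam_ne_top.1 hH.connected)).trans hH.diam_le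
  have hcard : (Finset.univ.biUnion own).card ≤ π.k := Finset.card_biUnion_le.trans hk.le
  have hfl : ∀ t, 2 * (π.electionEnd + π.C * (π.k + 1)) +
      2 * π.c * (π.c * (commGraph S G).diam + π.k) ≤ t → ∀ v ∈ π.H,
        Finset.univ.biUnion own ⊆ (conf S G π own t v).flooded := by
    intro t ht v hv
    refine subset_flooded S G π own (t₀ := 2 * (π.electionEnd + π.C * (π.k + 1))) hslot hwalk ?_
      (le_trans ?_ ht) hv
    -- When the conversations are over, the leader of the box of a source holds all rumors of that
    -- source.
    · intro ρ hρ
      obtain ⟨v, -, hv⟩ := Finset.mem_biUnion.1 hρ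
      obtain ⟨u, hu, hbox⟩ := hH.leader v
      exact ⟨u, hu, mem_held_of_over hE hC hk.le hbox hv⟩
    · gcongr
  refine accomplishes_of_conf S G π own hne fun t ht v => ⟨?_, fun u => ?_⟩
  · refine out_eq_none S G π own ?_ (hfl t ht v)
    rintro τ rfl
    obtain ⟨σ, rfl⟩ := Nat.exists_eq_add_of_le
      (show π.electionEnd ≤ τ by have := le_of_add_le_left ht; omega)
    refine gout_eq_none_of_over hE hC hk.le ?_ v
    have := le_of_add_le_left ht
    omega
  · refine (Finset.subset_biUnion_of_mem own (Finset.mem_univ u)).trans ?_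
    rcases hH.dominating v with hv | ⟨w, hw, hadj⟩
    · exact (hfl t ht v hv).trans (flooded_subset_held S G π own t v)
    · exact (hfl t ht w hw).trans (flooded_subset_held_of_adj S G π own hslot t hadj)

/-- As lg ≥ 1 / 2 and k ≥ 1, the terms 2 k, 2 C (k + 1) and 2 cb k are absorbed by 4, 8 C and 4 cb
times k lg. -/
theorem time_bound {ce C cb c D k L lg T : ℝ} (hce : 0 ≤ ce) (hC : 0 ≤ C) (hcb : 0 ≤ cb)
    (hD : 0 ≤ D) (hk : 1 ≤ k) (hlg : 1 / 2 ≤ lg) (hL : L ≤ ce * lg)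
    (hT : T = 2 * (k * (2 * L + 1) + C * (k + 1)) + 2 * cb * (cb * D + k))
    (hc : 4 * ce + 4 + 8 * C + 4 * cb + 2 * cb ^ 2 ≤ c) : T ≤ c * (D + k * lg) := by
  have hklg : k ≤ 2 * (k * lg) := by nlinarith
  have hkL : k * L ≤ ce * (k * lg) := by nlinarith
  have hCk : C * (k + 1) ≤ C * (4 * (k * lg)) := mul_le_mul_of_nonneg_left (by linarith) hC
  have hcbk : cb * k ≤ cb * (2 * (k * lg)) := mul_le_mul_of_nonneg_left hklg hcb
  have hX : 0 ≤ k * lg := by nlinarith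
  have h1 : T ≤ (4 * ce + 4 + 8 * C + 4 * cb) * (k * lg) + 2 * cb ^ 2 * D := by
    rw [hT]; nlinarith
  have h2 : (4 * ce + 4 + 8 * C + 4 * cb) * (k * lg) ≤ c * (k * lg) :=
    mul_le_mul_of_nonneg_right (by nlinarith [sq_nonneg cb]) hX
  have h3 : 2 * cb ^ 2 * D ≤ c * D := mul_le_mul_of_nonneg_right (by linarith) hD
  linarith

/-- Every network with at least two stations has a backbone and plans that accomplish
multi-broadcast in time. -/
theorem exists_plan (S : Params) : ∃ c : ℕ, ∀ (n : ℕ) (G : Network n),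
    (commGraph S G).Connected → ∃ H, IsBackbone S G c H ∧ (2 ≤ n → ∀ k : ℕ,
      ∃ π : Plan n (c * Nat.log 2 n), π.H = H ∧ (1 ≤ k → ∀ (R : Type) (own : Fin n → Finset R),
        ∑ v, (own v).card = k →
        ∃ T : ℕ, (T : ℝ) ≤ c * ((commGraph S G).diam + k * Real.log ((maxDeg S G : ℝ) + 1)) ∧
          Accomplishes S G (planProtocol S G π R) own H T)) := by
  obtain ⟨cb, hcb0, hcb⟩ := exists_backbone S
  obtain ⟨C, -, hC⟩ := exists_box_coloring S
  obtain ⟨ce, hce⟩ := exists_election_schedule S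
  -- The summand 6 makes room for the (2 cb + 6) ⌊log₂ n⌋ bits of the encoding.
  refine ⟨4 * ce + 4 + 8 * C + 4 * cb + 2 * cb ^ 2 + 6, fun n G hconn => ?_⟩
  obtain ⟨H, hH⟩ := hcb n G hconn
  refine ⟨H, hH.mono S G (by omega), fun hn k => ?_⟩
  obtain ⟨col, hcol, -, hrec⟩ := hC n G
  obtain ⟨L, sel, hL, hsel⟩ := hce n G (one_le_maxDeg S G hn hconn)
  obtain ⟨slot, hslot⟩ := hH.schedule
  obtain ⟨enc, dec, hdec⟩ := exists_encoding (q := 2 * cb)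
    (b := (4 * ce + 4 + 8 * C + 4 * cb + 2 * cb ^ 2 + 6) * Nat.log 2 n) hn (by omega)
    (Nat.mul_le_mul_right _ (by omega))
  refine ⟨⟨L, sel, C, col, H, cb, slot, k, enc, dec, hdec⟩, rfl, fun hk1 R own hk => ?_⟩
  refine ⟨_, ?_, planProtocol_accomplishes S G _ own ⟨hcol, hrec⟩ hsel hH hslot hk hk1⟩
  have hlog : (1 : ℝ) / 2 ≤ Real.log ((maxDeg S G : ℝ) + 1) := by
    have h1 : (1 : ℝ) ≤ maxDeg S G := by exact_mod_cast one_le_maxDeg S G hn hconn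
    have h2 := Real.log_le_log (by norm_num) (show (2 : ℝ) ≤ (maxDeg S G : ℝ) + 1 by linarith)
    have h3 := Real.log_two_gt_d9
    linarith
  refine time_bound (ce := ce) (C := C) (cb := cb) (L := L) (Nat.cast_nonneg _)
    (Nat.cast_nonneg _) (Nat.cast_nonneg _) (Nat.cast_nonneg _) (by exact_mod_cast hk1) hlog hL
    ?_ ?_
  · simp only [Plan.electionEnd, Plan.len]
    push_cast
    ring
  · push_cast
    linarith

/-- The protocol in which nobody transmits. -/
def silentProtocol {n : ℕ} (H : Finset (Fin n)) (R : Type) (b : ℕ) : Protocol n R b where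
  transmit _ _ _ := none
  transmit_holds _ _ _ _ _ h := by simp at h
  inBackbone v _ _ := decide (v ∈ H)

/-- A station that is alone in the network has nothing to do. -/
theorem silentProtocol_accomplishes (S : Params) {n b : ℕ} (G : Network n) (hn : n < 2)
    (H : Finset (Fin n)) {R : Type} (own : Fin n → Finset R) (hown : 1 ≤ ∑ v, (own v).card) :
    Accomplishes S G (silentProtocol H R b) own H 0 := by
  have : Subsingleton (Fin n) := Fin.subsingleton_iff_le_one.2 (by omega)
  intro t _ v
  refine ⟨Or.inl ?_, ?_, by simp [silentProtocol], fun u ρ hρ =>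
    Or.inl (Subsingleton.elim u v ▸ hρ)⟩
  · by_contra hv
    rw [Finset.not_nonempty_iff_eq_empty] at hv
    rw [Finset.sum_eq_zero fun u _ => by rw [Subsingleton.elim u v, hv, Finset.card_empty]] at hown
    omega
  · unfold sent
    split_ifs <;> rfl

end Main

end SINR

theorem mainTheorem2 (S : SINR.Params) :
    ∃ (c : ℕ) (P : SINR.CentralizedProtocol c) (H : (n : ℕ) → SINR.Network n → Finset (Fin n)),
      ∀ (n : ℕ) (G : SINR.Network n), (SINR.commGraph S G).Connected →
        SINR.IsBackbone S G c (H n G) ∧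
        ∀ (k : ℕ), 1 ≤ k → ∀ (R : Type) (own : Fin n → Finset R),
          (∀ u v : Fin n, u ≠ v → Disjoint (own u) (own v)) →
          ∑ v, (own v).card = k →
          ∃ T : ℕ,
            (T : ℝ) ≤ c * ((SINR.commGraph S G).diam +
              k * Real.log ((SINR.maxDeg S G : ℝ) + 1)) ∧
            SINR.Accomplishes S G (P n G k R) own (H n G) T := by
  classical
  obtain ⟨c, hc⟩ := SINR.exists_plan S
  choose! H hH hplan using hc
  choose! π hπH hπ using hplan
  -- For n < 2 no control bits are available, and none are needed; on a disconnected network the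
  -- protocol is irrelevant.
  refine ⟨c, fun n G k R => if h : 2 ≤ n ∧ (SINR.commGraph S G).Connected then
    SINR.planProtocol S G (π n G h.2 h.1 k) R else SINR.silentProtocol (H n G) R _, H, ?_⟩
  intro n G hconn
  refine ⟨hH n G hconn, fun k hk R own _ hsum => ?_⟩
  by_cases hn : 2 ≤ n
  · simp only [hn, hconn, and_self, dite_true]
    exact hπ n G hconn hn k hk R own hsum
  · simp only [hn, false_and, dite_false]
    refine ⟨0, ?_, SINR.silentProtocol_accomplishes S G (by omega) (H n G) own (hsum ▸ hk)⟩
    have : (0 : ℝ) ≤ Real.log ((SINR.maxDeg S G : ℝ) + 1) :=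
      Real.log_nonneg (by linarith [Nat.cast_nonneg (α := ℝ) (SINR.maxDeg S G)])
    push_cast
    positivity
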